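/- **Setting.** Let $\mathbb K=\mathbb R$ or $\mathbb C$, let $M$ be a smooth manifold and $T_M^{\mathbb K}=T_M\otimes_{\mathbb R}\mathbb K$. A Lie algebroid over $M$ is a smooth $\mathbb K$-vector bundle $L\to M$ with a $\mathbb K$-Lie bracket on $\Gamma(L)$ and an anchor $\rho:L\to T_M^{\mathbb K}$ (a bundle map, compatible with brackets) satisfying $[u,fv]=\rho(u)(f)\,v+f[u,v]$. A Lie pair $(L,A)$ is such an $L$ with a Lie subalgebroid $A\subset L$. Put $B=L/A$, fix a splitting $j:B\to L$ of $0\to A\to L\to B\to 0$, and let $\mathrm{pr}_B:L\to B$ and $\mathrm{pr}_A=\mathrm{id}-j\,\mathrm{pr}_B:L\to A$ be the projections. Let $\mathbf{Art}_{\mathbb K}$ be the category of local Artinian $\mathbb K$-algebras $\mathscr A$ with maximal ideal $\mathfrak m_{\mathscr A}$ and residue field $\mathbb K$, and $\mathrm{ev}:\mathscr A\to\mathscr A/\mathfrak m_{\mathscr A}=\mathbb K$. **The cubic $L_\infty$-algebra $\mathfrak h$.** A derivation of $L$ is a linear operator $\delta$ on $\Gamma(L)$ together with a vector field $\sigma\in\Gamma(T_M^{\mathbb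 K})$ such that $\delta(fu)=\sigma(f)u+f\delta(u)$, $[\sigma,\rho(u)]=\rho(\delta u)$ and $\delta[u,v]=[\delta u,v]+[u,\delta v]$; these form the Lie algebra $\mathrm{Der}(L)$. Write $\Omega_A^n(B)=\Gamma(\wedge^nA^*\otimes B)$, and let $\mathfrak h^0=\mathrm{Der}(L)\oplus\Gamma(B)$ and $\mathfrak h^n=\Omega^n_A(B)$ for $n\ge1$. For $X\in\Omega^p_A(B)$, $Y\in\Omega^q_A(B)$, $Z\in\Omega^r_A(B)$, $\delta,\delta'\in\mathrm{Der}(L)$ and $a_i\in\Gamma(A)$, the brackets, extended graded skew-symmetrically, are as follows; all sums are over shuffles, and for an $A$-valued $n$-form $K$ $$(Z\circ K)(a_1,\dots,a_{n+r-1})=\sum_{\sigma\in \mathrm{sh}(n,r-1)}\mathrm{sgn}(\sigma)\,Z(K(a_{\sigma(1)},\dots,a_{\sigma(n)}),a_{\sigma(n+1)},\dots,a_{\sigma(n+r-1)}),$$ with $Z\circ K=0$ if $r=0$. * $[X]_1$ is the Chevalley–Eilenberg differential of the flat Bott connection $\nabla_ab=\mathrm{pr}_B[a,j(b)]$, and $[\delta]_1(a)=-\mathrm{pr}_B(\delta(a))$.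 * $[X,Y]_2(a_1,\dots,a_{p+q})=\sum_{\sigma\in\mathrm{sh}(p,q)}\mathrm{sgn}(\sigma)\big\{\mathrm{pr}_B[jX(u),jY(v)]-\sum_kY(v_1,\dots,\mathrm{pr}_A[jX(u),v_k],\dots,v_q)+\sum_kX(u_1,\dots,\mathrm{pr}_A[jY(v),u_k],\dots,u_p)\big\}$, where $u=(a_{\sigma(1)},\dots,a_{\sigma(p)})$ and $v=(a_{\sigma(p+1)},\dots,a_{\sigma(p+q)})$. Moreover $[\delta,\delta']_2=\delta\delta'-\delta'\delta$ and $[\delta,X]_2(a_1,\dots,a_p)=\mathrm{pr}_B\delta j(X(a_1,\dots,a_p))-\sum_kX(a_1,\dots,\mathrm{pr}_A\delta(a_k),\dots,a_p)$. * $[X,Y,Z]_3=T(X,Y|Z)+(-1)^{p(q+r)}T(Y,Z|X)+(-1)^{r(p+q)}T(Z,X|Y)$ with $T(X,Y|Z)=(-1)^{p+q+1}Z\circ K$, where $K=\mathrm{pr}_A[jX,jY]$ is the $A$-valued $(p+q)$-form $\sum_{\sigma\in\mathrm{sh}(p,q)}\mathrm{sgn}(\sigma)\,\mathrm{pr}_A[jX(u),jY(v)]$.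 Moreover $$[\delta,X,Y]_3=(-1)^{p+1}\,Y\circ(\mathrm{pr}_A\delta jX)+(-1)^{q(p+1)}\,X\circ(\mathrm{pr}_A\delta jY),$$ and $[\delta,\delta',\cdot\,]_3=0$. **The functor $\mathrm{Def}_{\mathfrak h}:\mathbf{Art}_{\mathbb K}\to\mathbf{Set}$.** Extend the brackets $\mathscr A$-multilinearly to $\mathfrak h\otimes\mathfrak m_{\mathscr A}$. Then $\mathrm{Def}_{\mathfrak h}(\mathscr A)$ is the set of $\xi\in\mathfrak h^1\otimes\mathfrak m_{\mathscr A}$ with $[\xi]_1+\frac1{2!}[\xi,\xi]_2+\frac1{3!}[\xi,\xi,\xi]_3=0$, modulo gauge equivalence $\xi\sim\eta$, which means that $$\eta=e^b*\xi:=\xi-\sum_{k\ge1}\tfrac1{k!}e^k_\xi(b)\quad\text{for some } b\in\mathfrak h^0\otimes\mathfrak m_{\mathscr A},$$ where $e^1_\xi(b)=[b]_1^\xi$ and $e_\xi^{k+1}(b)=\sum_{n\ge0}\frac1{n!}\sum_{k_1+\dots+k_n=k,\;k_i\ge1}\frac{k!}{k_1!\cdots k_n!}[b,e^{k_1}_\xi(b),\dots,e^{k_n}_\xi(b)]^\xi_{n+1}$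 for $k\ge1$, and $[x_1,\dots,x_i]_i^\xi=\sum_{l\ge0}\frac1{l!}[\xi,\dots,\xi,x_1,\dots,x_i]_{l+i}$ with $l$ copies of $\xi$ (brackets with more than three arguments are zero). A morphism $\vartheta$ acts by $[\xi]\mapsto[(\mathrm{id}\otimes\vartheta)\xi]$. **The functor $\mathrm{wDef}_{(L,A)}:\mathbf{Art}_{\mathbb K}\to\mathbf{Set}$.** Put $C^\infty(M_{\mathscr A})=C^\infty(M,\mathbb K)\otimes\mathscr A$ and $\Gamma(E_{\mathscr A})=\Gamma(E)\otimes\mathscr A$. * An $\mathscr A$-ringed Lie algebroid $E_{\mathscr A}$ is an $\mathscr A$-bilinear Lie bracket on $\Gamma(E_{\mathscr A})$ with a $C^\infty(M_{\mathscr A})$-linear anchor to $\Gamma(T^{\mathbb K}_M)\otimes\mathscr A$ satisfying the Leibniz rule; its center is the Lie algebroid on $E$ obtained by applying $\mathrm{ev}$. The Cartesian extension $L^0_{\mathscr A}$ is the $\mathscr A$-linear extension of the structure of $L$. * A morphism $(\Pi,\lambda):F_{\mathscr A}\to E_{\mathscr A}$ is an $\mathscr A$-linear map $\Pi:\Gamma(F_{\mathscr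 A})\to\Gamma(E_{\mathscr A})$ with an $\mathscr A$-algebra endomorphism $\lambda$ of $C^\infty(M_{\mathscr A})$, $\mathrm{ev}\circ\lambda=\mathrm{id}$ on $C^\infty(M,\mathbb K)$, such that $\Pi(fs)=\lambda(f)\Pi(s)$, $\Pi[s,s']=[\Pi s,\Pi s']$ and $\lambda\langle\rho(s),f\rangle=\langle\rho(\Pi s),\lambda f\rangle$; its center is $\mathrm{ev}\circ\Pi|_{\Gamma(F)}:F\to E$. A small automorphism is an endomorphism with center the identity. * An infinitesimal deformation of $(L,A)$ over $\mathscr A$ is an $\mathscr A$-ringed Lie algebroid structure on $A_{\mathscr A}$ with center $A$, together with a morphism $(I,\lambda):A_{\mathscr A}\to L^0_{\mathscr A}$ with center the inclusion $A\hookrightarrow L$. * Two of them, with inclusions $(I,\lambda)$ and $(I',\lambda')$, are weakly isomorphic if there are a small automorphism $(\Phi,\mu)$ of $L^0_{\mathscr A}$ and a morphism $(\Pi_A,\lambda_A)$ from the second $A_{\mathscr A}$ to the first with $(\Phi,\mu)\circ(I',\lambda')=(I,\lambda)\circ(\Pi_A,\lambda_A)$. $\mathrm{wDef}_{(L,A)}(\mathscr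 A)$ is the set of weak isomorphism classes of infinitesimal deformations over $\mathscr A$, and a morphism $\mathscr A\to\mathscr A'$ acts by base change (the $\mathscr A'$-linear extension of all structure maps). **Theorem.** For every Lie pair $(L,A)$ and every splitting $j$, the functors $\mathrm{Def}_{\mathfrak h}$ and $\mathrm{wDef}_{(L,A)}$ from $\mathbf{Art}_{\mathbb K}$ to $\mathbf{Set}$ are naturally isomorphic. -/

import Mathlib

open scoped TensorProduct Nat Manifold ContDiff Topology
open CategoryTheory Bundle

universe k v u

set_option linter.unusedSectionVars false
set_option linter.unusedSimpArgs false

noncomputable section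

namespace LieDef

section Algebra

/-- A Lie algebroid in terms of its sections: `R` is the algebra of functions, `V` the `R`-module of
sections, and vector fields are the derivations of `R`. For `R = C^∞(M, 𝕂)` and `V = Γ(L)` this is a
Lie algebroid structure on the vector bundle `L → M`. -/
structure LieRinehart (𝕂 R V : Type*) [Field 𝕂] [CommRing R] [Algebra 𝕂 R]
    [AddCommGroup V] [Module 𝕂 V] [Module R V] where
  bracket : V →ₗ[𝕂] V →ₗ[𝕂] V
  anchor : V →ₗ[R] Derivation 𝕂 R R
  bracket_self : ∀ u, bracket u u = 0
  jacobi : ∀ u v w, bracket u (bracket v w) = bracket (bracket u v) w + bracket v (bracket u w)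
  leibniz : ∀ u (f : R) v, bracket u (f • v) = anchor u f • v + f • bracket u v
  anchor_bracket : ∀ u v, anchor (bracket u v) = ⁅anchor u, anchor v⁆

/-- A Lie algebroid with a submodule `Γ(A) = sub` of sections which is closed under the bracket. -/
structure Pair (𝕂 R V : Type*) [Field 𝕂] [CommRing R] [Algebra 𝕂 R]
    [AddCommGroup V] [Module 𝕂 V] [Module R V] extends LieRinehart 𝕂 R V where
  sub : Submodule R V
  bracket_mem : ∀ u ∈ sub, ∀ v ∈ sub, bracket u v ∈ sub

variable {𝕂 R V : Type*} [Field 𝕂] [CommRing R] [Algebra 𝕂 R]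
    [AddCommGroup V] [Module 𝕂 V] [Module R V] [IsScalarTower 𝕂 R V]

theorem LieRinehart.bracket_skew (P : LieRinehart 𝕂 R V) (u v : V) :
    P.bracket u v = - P.bracket v u := by
  have h := P.bracket_self (u + v)
  simp only [map_add, LinearMap.add_apply, P.bracket_self, zero_add, add_zero] at h
  exact eq_neg_of_add_eq_zero_right h

theorem LieRinehart.leibniz_left (P : LieRinehart 𝕂 R V) (u : V) (f : R) (v : V) :
    P.bracket (f • u) v = f • P.bracket u v - P.anchor v f • u := by
  rw [P.bracket_skew, P.leibniz, P.bracket_skew v u]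
  module

/-- `Der(L)`: a derivation is an operator `d.1` on `Γ(L)` together with its symbol, the vector field
`d.2`. -/
def LieRinehart.Der (P : LieRinehart 𝕂 R V) : Submodule 𝕂 (Module.End 𝕂 V × Derivation 𝕂 R R) where
  carrier := {d | (∀ (f : R) u, d.1 (f • u) = d.2 f • u + f • d.1 u) ∧
    (∀ u, ⁅d.2, P.anchor u⁆ = P.anchor (d.1 u)) ∧
    ∀ u v, d.1 (P.bracket u v) = P.bracket (d.1 u) v + P.bracket u (d.1 v)}
  zero_mem' := by simp
  add_mem' := by
    rintro d e ⟨h1, h2, h3⟩ ⟨k1, k2, k3⟩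
    refine ⟨fun f u => ?_, fun u => ?_, fun u v => ?_⟩
    · simp only [Prod.fst_add, Prod.snd_add, LinearMap.add_apply, Derivation.add_apply, h1, k1]
      module
    · simp [h2, k2]
    · simp only [Prod.fst_add, LinearMap.add_apply, map_add, h3, k3]
      abel
  smul_mem' := by
    rintro c d ⟨h1, h2, h3⟩
    refine ⟨fun f u => ?_, fun u => ?_, fun u v => ?_⟩
    · simp only [Prod.smul_fst, Prod.smul_snd, LinearMap.smul_apply, Derivation.smul_apply, h1,
        smul_add, smul_assoc, smul_comm c f]
    · simp only [Prod.smul_fst, Prod.smul_snd, LinearMap.smul_apply, smul_lie, h2]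
      rw [← algebraMap_smul R c (d.1 u), map_smul, algebraMap_smul]
    · simp only [Prod.smul_fst, LinearMap.smul_apply, map_smul, h3, smul_add]

/-- The commutator `[δ, δ'] = δ δ' - δ' δ` of derivations; its symbol is the commutator of the
symbols. -/
def LieRinehart.derBracket (P : LieRinehart 𝕂 R V) : P.Der →ₗ[𝕂] P.Der →ₗ[𝕂] P.Der :=
  LinearMap.mk₂ 𝕂
    (fun d e => ⟨(d.1.1 * e.1.1 - e.1.1 * d.1.1, ⁅d.1.2, e.1.2⁆), by
      obtain ⟨⟨d, s⟩, h1, h2, h3⟩ := d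
      obtain ⟨⟨e, t⟩, k1, k2, k3⟩ := e
      dsimp only at h1 h2 h3 k1 k2 k3
      refine ⟨fun f u => ?_, fun u => ?_, fun u v => ?_⟩
      · simp only [LinearMap.sub_apply, Module.End.mul_apply, h1, k1, map_add,
          Derivation.commutator_apply]
        module
      · simp only [LinearMap.sub_apply, Module.End.mul_apply, map_sub, ← h2, ← k2]
        rw [lie_lie]
      · simp only [LinearMap.sub_apply, Module.End.mul_apply, h3, k3, map_add, map_sub]
        abel⟩)
    (fun d d' e => by ext1; ext1 <;> simp [add_mul, mul_add] ; abel)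
    (fun c d e => by ext1; ext1 <;> simp [smul_sub])
    (fun d e e' => by ext1; ext1 <;> simp [add_mul, mul_add] ; abel)
    (fun c d e => by ext1; ext1 <;> simp [smul_sub])

namespace Pair
variable (P : Pair 𝕂 R V)

/-- A splitting `j : B → L` of `0 → A → L → B → 0`, where `Γ(B) = Γ(L) / Γ(A)`. -/
structure Splitting where
  toFun : (V ⧸ P.sub) →ₗ[R] V
  mk_toFun : ∀ b, P.sub.mkQ (toFun b) = b

variable {P} (S : P.Splitting)
/-- The projection `Pr_B : L → B`. -/
def prB (P : Pair 𝕂 R V) : V →ₗ[R] V ⧸ P.sub := P.sub.mkQ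

/-- The projection `Pr_A : L → A`, that is `id - j ∘ Pr_B`. -/
def prA : V →ₗ[R] P.sub :=
  (LinearMap.id - S.toFun ∘ₗ P.sub.mkQ).codRestrict P.sub (fun v => by
    refine (Submodule.Quotient.mk_eq_zero P.sub).1 ?_
    change P.sub.mkQ (v - S.toFun (P.sub.mkQ v)) = 0
    rw [map_sub, S.mk_toFun, sub_self])

theorem prA_j (b : V ⧸ P.sub) : prA S (S.toFun b) = 0 := by
  ext; simp [prA, S.mk_toFun]
theorem prA_coe (a : P.sub) : prA S a = a := by
  ext; simp [prA, (Submodule.Quotient.mk_eq_zero P.sub).2 a.2]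
theorem prB_coe (a : P.sub) : P.prB a = 0 := by
  simp [prB]
theorem prB_j (b : V ⧸ P.sub) : P.prB (S.toFun b) = b := S.mk_toFun b

/-- `Ω^k_A(B)`, the alternating `C^∞(M, 𝕂)`-multilinear maps `Γ(A)^k → Γ(B)`. -/
abbrev Form (P : Pair 𝕂 R V) (k : ℕ) : Type _ := P.sub [⋀^Fin k]→ₗ[R] (V ⧸ P.sub)
/-- `Ω^k_A(A)`. -/
abbrev FormA (P : Pair 𝕂 R V) (k : ℕ) : Type _ := P.sub [⋀^Fin k]→ₗ[R] P.sub


section Multi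
variable {A N : Type*} [AddCommGroup A] [Module R A] [AddCommGroup N] [Module R N]
  [Module 𝕂 N] [IsScalarTower 𝕂 R N]

/-- A function of `p + q` arguments, `R`-linear in each of them, as a multilinear map. -/
def biMul {p q : ℕ} (S : (Fin p → A) → (Fin q → A) → N)
    (add₁ : ∀ u v i x y, S (Function.update u i (x + y)) v =
      S (Function.update u i x) v + S (Function.update u i y) v)
    (smul₁ : ∀ u v i (f : R) x, S (Function.update u i (f • x)) v = f • S (Function.update u i x) v)
    (add₂ : ∀ u v i x y, S u (Function.update v i (x + y)) =
      S u (Function.update v i x) + S u (Function.update v i y))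
    (smul₂ : ∀ u v i (f : R) x,
      S u (Function.update v i (f • x)) = f • S u (Function.update v i x)) :
    MultilinearMap R (fun _ : Fin p ⊕ Fin q => A) N where
  toFun w := S (w ∘ Sum.inl) (w ∘ Sum.inr)
  map_update_add' {inst} w i x y := by
    rw [Subsingleton.elim inst instDecidableEqSum]
    rcases i with i | i <;> simp [add₁, add₂]
  map_update_smul' {inst} w i c x := by
    rw [Subsingleton.elim inst instDecidableEqSum]
    rcases i with i | i <;> simp [smul₁, smul₂]

/-- The signed sum of `m (a_{σ 1}, …, a_{σ p}; a_{σ (p + 1)}, …, a_{σ (p + q)})` over all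
permutations `σ`, divided by `p! q!`. If `m` is alternating in the first `p` and in the last `q`
arguments this is the signed sum over all `(p, q)`-shuffles. -/
def shuffleSum (𝕂 : Type*) {R A N : Type*} [Field 𝕂] [CommRing R] [Algebra 𝕂 R]
    [AddCommGroup A] [Module R A] [AddCommGroup N] [Module R N] [Module 𝕂 N]
    [IsScalarTower 𝕂 R N] {p q : ℕ} (m : MultilinearMap R (fun _ : Fin p ⊕ Fin q => A) N) :
    A [⋀^Fin (p + q)]→ₗ[R] N :=
  ((p ! * q ! : 𝕂)⁻¹ • MultilinearMap.alternatization m).domDomCongr finSumFinEquiv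

theorem shuffleSum_apply {p q : ℕ} (m : MultilinearMap R (fun _ : Fin p ⊕ Fin q => A) N)
    (a : Fin (p + q) → A) :
    shuffleSum 𝕂 m a = (p ! * q ! : 𝕂)⁻¹ •
      ∑ σ : Equiv.Perm (Fin p ⊕ Fin q), Equiv.Perm.sign σ • m (fun i => a (finSumFinEquiv (σ i))) := by
  simp [shuffleSum, MultilinearMap.alternatization_apply, MultilinearMap.domDomCongr_apply]

/-- `∑ₖ X (u₁, …, D uₖ, …, u_p)`. -/
def slotSum {p : ℕ} (X : A [⋀^Fin p]→ₗ[R] N) (D : A → A) (u : Fin p → A) : N :=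
  ∑ k, X (Function.update u k (D (u k)))

theorem slotSum_add {p : ℕ} (X : A [⋀^Fin p]→ₗ[R] N) (D : A → A)
    (hD : ∀ x y, D (x + y) = D x + D y) (u : Fin p → A) (i : Fin p) (x y : A) :
    slotSum X D (Function.update u i (x + y)) =
      slotSum X D (Function.update u i x) + slotSum X D (Function.update u i y) := by
  simp only [slotSum, ← Finset.sum_add_distrib]
  refine Finset.sum_congr rfl fun k _ => ?_
  by_cases h : k = i
  · subst h; simp [hD]
  · simp only [Function.update_of_ne h, Function.update_comm (Ne.symm h)]
    simp

theorem slotSum_smul {p : ℕ} (X : A [⋀^Fin p]→ₗ[R] N) (D : A → A) (f g : R)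
    (hD : ∀ x, D (f • x) = f • D x + g • x) (u : Fin p → A) (i : Fin p) (x : A) :
    slotSum X D (Function.update u i (f • x)) =
      f • slotSum X D (Function.update u i x) + g • X (Function.update u i x) := by
  have key : ∀ k, X (Function.update (Function.update u i (f • x)) k
        (D (Function.update u i (f • x) k))) =
      f • X (Function.update (Function.update u i x) k (D (Function.update u i x k))) +
      if k = i then g • X (Function.update u i x) else 0 := by
    intro k
    by_cases h : k = i
    · subst h; simp [hD]
    · simp only [Function.update_of_ne h, Function.update_comm (Ne.symm h)]
      simp [h]
  simp only [slotSum, key, Finset.sum_add_distrib, Finset.smul_sum]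
  simp

theorem slotSum_eq_zero {p : ℕ} (X : A [⋀^Fin p]→ₗ[R] N) (D : A → A) (u : Fin p → A)
    (i j : Fin p) (hu : u i = u j) (hij : i ≠ j) : slotSum X D u = 0 := by
  have hsub : slotSum X D u = ∑ k ∈ {i, j}, X (Function.update u k (D (u k))) := by
    refine (Finset.sum_subset (Finset.subset_univ _) fun k _ hk => ?_).symm
    simp only [Finset.mem_insert, Finset.mem_singleton, not_or] at hk
    refine X.map_eq_zero_of_eq _ ?_ hij
    rw [Function.update_of_ne (Ne.symm hk.1), Function.update_of_ne (Ne.symm hk.2), hu]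
  rw [hsub, Finset.sum_pair hij, ← hu]
  have hsw : Function.update u j (D (u i)) = Function.update u i (D (u i)) ∘ Equiv.swap i j := by
    funext k
    by_cases hk : k = i
    · subst hk; simp [hij, Function.update_of_ne (Ne.symm hij), hu]
    · by_cases hk' : k = j
      · subst hk'; simp
      · simp [Function.update_of_ne hk, Function.update_of_ne hk',
          Equiv.swap_apply_of_ne_of_ne hk hk']
  rw [hsw, X.map_swap _ hij, add_neg_cancel]

theorem slotSum_form_add {p : ℕ} (X Y : A [⋀^Fin p]→ₗ[R] N) (D : A → A) (u : Fin p → A) :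
    slotSum (X + Y) D u = slotSum X D u + slotSum Y D u := by
  simp [slotSum, Finset.sum_add_distrib]

theorem slotSum_form_smul {p : ℕ} (c : 𝕂) (X : A [⋀^Fin p]→ₗ[R] N) (D : A → A)
    (u : Fin p → A) : slotSum (c • X) D u = c • slotSum X D u := by
  simp [slotSum, Finset.smul_sum]

theorem slotSum_der_add {p : ℕ} (X : A [⋀^Fin p]→ₗ[R] N) (D D' : A → A) (u : Fin p → A) :
    slotSum X (fun a => D a + D' a) u = slotSum X D u + slotSum X D' u := by
  simp [slotSum, Finset.sum_add_distrib]

theorem slotSum_der_smul [Module 𝕂 A] [IsScalarTower 𝕂 R A] {p : ℕ} (c : 𝕂)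
    (X : A [⋀^Fin p]→ₗ[R] N) (D : A → A) (u : Fin p → A) :
    slotSum X (fun a => c • D a) u = c • slotSum X D u := by
  simp only [slotSum, Finset.smul_sum]
  refine Finset.sum_congr rfl fun k _ => ?_
  rw [← algebraMap_smul R c (D (u k)), X.map_update_smul, algebraMap_smul]

end Multi

/-- A trilinear map from its values. -/
def mk₃ {X Y Z W : Type*} [AddCommGroup X] [Module 𝕂 X] [AddCommGroup Y] [Module 𝕂 Y]
    [AddCommGroup Z] [Module 𝕂 Z] [AddCommGroup W] [Module 𝕂 W] (f : X → Y → Z → W)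
    (add₁ : ∀ x x' y z, f (x + x') y z = f x y z + f x' y z)
    (smul₁ : ∀ (c : 𝕂) x y z, f (c • x) y z = c • f x y z)
    (add₂ : ∀ x y y' z, f x (y + y') z = f x y z + f x y' z)
    (smul₂ : ∀ (c : 𝕂) x y z, f x (c • y) z = c • f x y z)
    (add₃ : ∀ x y z z', f x y (z + z') = f x y z + f x y z')
    (smul₃ : ∀ (c : 𝕂) x y z, f x y (c • z) = c • f x y z) : X →ₗ[𝕂] Y →ₗ[𝕂] Z →ₗ[𝕂] W :=
  LinearMap.mk₂ 𝕂
    (fun x y => { toFun := f x y, map_add' := add₃ x y, map_smul' := fun c => smul₃ c x y })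
    (fun x x' y => LinearMap.ext fun z => add₁ x x' y z)
    (fun c x y => LinearMap.ext fun z => smul₁ c x y z)
    (fun x y y' => LinearMap.ext fun z => add₂ x y y' z)
    (fun c x y => LinearMap.ext fun z => smul₂ c x y z)

section Operations

/-- The `A`-component of the bracket with `v`, as an operator on `Γ(A)`. -/
def adA (v : V) : P.sub →ₗ[𝕂] P.sub :=
  ((prA S).restrictScalars 𝕂) ∘ₗ P.bracket v ∘ₗ (P.sub.subtype.restrictScalars 𝕂)

theorem adA_smul (v : V) (f : R) (a : P.sub) :
    adA S v (f • a) = f • adA S v a + P.anchor v f • a := by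
  simp [adA, P.leibniz, prA_coe, add_comm]

theorem adA_smul_j (f : R) (b : V ⧸ P.sub) (a : P.sub) :
    adA S (f • S.toFun b) a = f • adA S (S.toFun b) a := by
  simp [adA, P.leibniz_left, prA_j]

theorem slotSum_adA_add {q : ℕ} (Y : Form P q) (x y : V) (v : Fin q → P.sub) :
    slotSum Y (adA S (x + y)) v = slotSum Y (adA S x) v + slotSum Y (adA S y) v := by
  rw [← slotSum_der_add]
  congr 1
  funext a
  simp [adA]

theorem slotSum_adA_smul {q : ℕ} (Y : Form P q) (c : 𝕂) (x : V) (v : Fin q → P.sub) :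
    slotSum Y (adA S (c • x)) v = c • slotSum Y (adA S x) v := by
  rw [← slotSum_der_smul]
  congr 1
  funext a
  simp [adA]

theorem slotSum_adA_smul_j {q : ℕ} (Y : Form P q) (f : R) (b : V ⧸ P.sub) (v : Fin q → P.sub) :
    slotSum Y (adA S (f • S.toFun b)) v = f • slotSum Y (adA S (S.toFun b)) v := by
  simp only [slotSum, Finset.smul_sum, adA_smul_j]
  refine Finset.sum_congr rfl fun k _ => ?_
  rw [Y.map_update_smul]

/-- `Pr_B [j X(u), j Y(v)] - ∑ₖ Y(v₁, …, Pr_A [j X(u), vₖ], …) + ∑ₖ X(u₁, …, Pr_A [j Y(v), uₖ], …)`. -/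
def c2Fun {p q : ℕ} (X : Form P p) (Y : Form P q) (u : Fin p → P.sub) (v : Fin q → P.sub) :
    V ⧸ P.sub :=
  P.prB (P.bracket (S.toFun (X u)) (S.toFun (Y v)))
    - slotSum Y (adA S (S.toFun (X u))) v + slotSum X (adA S (S.toFun (Y v))) u

/-- `c2Fun` as a multilinear map. -/
def c2Mul {p q : ℕ} (X : Form P p) (Y : Form P q) :
    MultilinearMap R (fun _ : Fin p ⊕ Fin q => P.sub) (V ⧸ P.sub) :=
  biMul (c2Fun S X Y)
    (fun u v i x y => by
      simp only [c2Fun, AlternatingMap.map_update_add, map_add, LinearMap.add_apply,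
        slotSum_adA_add, slotSum_add X _ (fun x y => map_add (adA S _) x y)]
      abel)
    (fun u v i f x => by
      simp only [c2Fun, AlternatingMap.map_update_smul, map_smul, slotSum_adA_smul_j,
        slotSum_smul X _ f _ (fun x => adA_smul S (S.toFun (Y v)) f x), P.leibniz_left, map_sub,
        prB_j]
      module)
    (fun u v i x y => by
      simp only [c2Fun, AlternatingMap.map_update_add, map_add,
        slotSum_adA_add, slotSum_add Y _ (fun x y => map_add (adA S _) x y)]
      abel)
    (fun u v i f x => by
      simp only [c2Fun, AlternatingMap.map_update_smul, map_smul, slotSum_adA_smul_j,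
        slotSum_smul Y _ f _ (fun x => adA_smul S (S.toFun (X u)) f x), P.leibniz, map_add,
        prB_j]
      module)

/-- The binary bracket `[X, Y]₂` of `Ω_A(B)`: the shuffle sum of
`Pr_B [j X(u), j Y(v)] - ∑ₖ Y(v₁, …, Pr_A [j X(u), vₖ], …) + ∑ₖ X(u₁, …, Pr_A [j Y(v), uₖ], …)`. -/
def c2 (p q : ℕ) : Form P p →ₗ[𝕂] Form P q →ₗ[𝕂] Form P (p + q) :=
  LinearMap.mk₂ 𝕂 (fun X Y => shuffleSum 𝕂 (c2Mul S X Y))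
    (fun X X' Y => by
      ext a
      simp only [AlternatingMap.add_apply, shuffleSum_apply, ← smul_add, ← Finset.sum_add_distrib]
      refine congrArg _ (Finset.sum_congr rfl fun σ _ => congrArg _ ?_)
      simp only [c2Mul, biMul, c2Fun, MultilinearMap.coe_mk, AlternatingMap.add_apply, map_add, LinearMap.add_apply, slotSum_adA_add,
        slotSum_form_add]
      abel)
    (fun c X Y => by
      ext a
      simp only [AlternatingMap.smul_apply, shuffleSum_apply, Finset.smul_sum]
      refine Finset.sum_congr rfl fun σ _ => ?_
      rw [smul_comm c, smul_comm c]
      refine congrArg _ (congrArg _ ?_)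
      simp only [c2Mul, biMul, c2Fun, MultilinearMap.coe_mk, AlternatingMap.smul_apply, LinearMap.map_smul_of_tower, LinearMap.smul_apply, slotSum_adA_smul,
        slotSum_form_smul, smul_add, smul_sub])
    (fun X Y Y' => by
      ext a
      simp only [AlternatingMap.add_apply, shuffleSum_apply, ← smul_add, ← Finset.sum_add_distrib]
      refine congrArg _ (Finset.sum_congr rfl fun σ _ => congrArg _ ?_)
      simp only [c2Mul, biMul, c2Fun, MultilinearMap.coe_mk, AlternatingMap.add_apply, map_add, slotSum_adA_add,
        slotSum_form_add]
      abel)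
    (fun c X Y => by
      ext a
      simp only [AlternatingMap.smul_apply, shuffleSum_apply, Finset.smul_sum]
      refine Finset.sum_congr rfl fun σ _ => ?_
      rw [smul_comm c, smul_comm c]
      refine congrArg _ (congrArg _ ?_)
      simp only [c2Mul, biMul, c2Fun, MultilinearMap.coe_mk, AlternatingMap.smul_apply, LinearMap.map_smul_of_tower, slotSum_adA_smul,
        slotSum_form_smul, smul_add, smul_sub])

/-- `Pr_A ∘ δ` as an operator on `Γ(A)`. -/
def derA (δ : P.Der) : P.sub →ₗ[𝕂] P.sub :=
  ((prA S).restrictScalars 𝕂) ∘ₗ δ.1.1 ∘ₗ (P.sub.subtype.restrictScalars 𝕂)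

theorem derA_smul (δ : P.Der) (f : R) (a : P.sub) :
    derA S δ (f • a) = f • derA S δ a + δ.1.2 f • a := by
  simp [derA, δ.2.1, prA_coe, add_comm]

/-- `[δ, X]₂ = Pr_B ∘ δ ∘ j ∘ X - ∑ₖ X(…, Pr_A δ(aₖ), …)`. -/
def act (q : ℕ) : P.Der →ₗ[𝕂] Form P q →ₗ[𝕂] Form P q :=
  LinearMap.mk₂ 𝕂
    (fun δ X =>
      { toFun := fun u => P.prB (δ.1.1 (S.toFun (X u))) - slotSum X (derA S δ) u
        map_update_add' := fun {inst} u i x y => by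
          rw [Subsingleton.elim inst (instDecidableEqFin q)]
          simp only [AlternatingMap.map_update_add, map_add,
            slotSum_add X _ (fun x y => map_add (derA S _) x y)]
          abel
        map_update_smul' := fun {inst} u i f x => by
          rw [Subsingleton.elim inst (instDecidableEqFin q)]
          simp only [AlternatingMap.map_update_smul, map_add, map_smul, δ.2.1, prB_j,
            slotSum_smul X _ f _ (fun x => derA_smul S δ f x)]
          module
        map_eq_zero_of_eq' := fun u i j hu hij => by
          simp [slotSum_eq_zero X _ u i j hu hij, X.map_eq_zero_of_eq u hu hij] })
    (fun δ δ' X => by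
      ext u
      have h : slotSum X (derA S (δ + δ')) u = slotSum X (derA S δ) u + slotSum X (derA S δ') u := by
        rw [← slotSum_der_add]
        congr 1
        funext a
        simp [derA]
      change P.prB ((δ.1.1 + δ'.1.1) _) - _ = (_ - _) + (_ - _)
      rw [h, LinearMap.add_apply, map_add]
      abel)
    (fun c δ X => by
      ext u
      have h : slotSum X (derA S (c • δ)) u = c • slotSum X (derA S δ) u := by
        rw [← slotSum_der_smul]
        congr 1
        funext a
        simp [derA]
      change P.prB ((c • δ.1.1) _) - _ = c • (_ - _)
      rw [h, LinearMap.smul_apply, LinearMap.map_smul_of_tower, smul_sub])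
    (fun δ X Y => by
      ext u
      change P.prB (δ.1.1 (S.toFun (X u + Y u))) - _ = (_ - _) + (_ - _)
      rw [slotSum_form_add, map_add, map_add, map_add]
      abel)
    (fun c δ X => by
      ext u
      change P.prB (δ.1.1 (S.toFun (c • X u))) - _ = c • (_ - _)
      rw [slotSum_form_smul, LinearMap.map_smul_of_tower S.toFun, LinearMap.map_smul_of_tower,
        LinearMap.map_smul_of_tower, smul_sub])

/-- `[δ]₁ = - Pr_B ∘ δ` on `Γ(A)`. -/
def kappa : P.Der →ₗ[𝕂] Form P 1 where
  toFun δ :=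
    { toFun := fun u => - P.prB (δ.1.1 (u 0))
      map_update_add' := fun {inst} u i x y => by
        rw [Subsingleton.elim inst (instDecidableEqFin 1), Subsingleton.elim i 0]
        simp [add_comm]
      map_update_smul' := fun {inst} u i f x => by
        rw [Subsingleton.elim inst (instDecidableEqFin 1), Subsingleton.elim i 0]
        simp [δ.2.1, prB_coe]
      map_eq_zero_of_eq' := fun u i j _ hij => absurd (Subsingleton.elim i j) hij }
  map_add' δ δ' := by
    refine AlternatingMap.ext fun u => ?_
    change -P.prB ((δ.1.1 + δ'.1.1) (u 0)) = -P.prB (δ.1.1 (u 0)) + -P.prB (δ'.1.1 (u 0))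
    rw [LinearMap.add_apply, map_add, neg_add]
  map_smul' c δ := by
    refine AlternatingMap.ext fun u => ?_
    change -P.prB ((c • δ.1.1) (u 0)) = c • -P.prB (δ.1.1 (u 0))
    rw [LinearMap.smul_apply, LinearMap.map_smul_of_tower, smul_neg]

/-- `(b, b') ↦ Pr_A [j b, j b']`, which is `C^∞(M, 𝕂)`-bilinear. -/
def curv : (V ⧸ P.sub) →ₗ[R] (V ⧸ P.sub) →ₗ[R] P.sub :=
  LinearMap.mk₂ R (fun b b' => prA S (P.bracket (S.toFun b) (S.toFun b')))
    (fun b b' c => by simp)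
    (fun f b c => by simp [P.leibniz_left, prA_j])
    (fun b c c' => by simp)
    (fun f b c => by simp [P.leibniz, prA_j])

/-- The `A`-valued form `Pr_A [j X, j Y]`, the shuffle sum of `Pr_A [j X(u), j Y(v)]`. -/
def wedge (p q : ℕ) : Form P p →ₗ[𝕂] Form P q →ₗ[𝕂] FormA P (p + q) :=
  LinearMap.mk₂ 𝕂
    (fun X Y => shuffleSum 𝕂 (biMul (fun u v => curv S (X u) (Y v))
      (by simp) (by simp) (by simp) (by simp)))
    (fun X X' Y => by
      ext1 a
      simp only [AlternatingMap.add_apply, shuffleSum_apply, ← smul_add, ← Finset.sum_add_distrib]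
      simp [biMul])
    (fun c X Y => by
      ext1 a
      simp only [AlternatingMap.smul_apply, shuffleSum_apply, Finset.smul_sum]
      refine Finset.sum_congr rfl fun σ _ => ?_
      rw [smul_comm c, smul_comm c]
      simp [biMul, LinearMap.map_smul_of_tower (curv S)])
    (fun X Y Y' => by
      ext1 a
      simp only [AlternatingMap.add_apply, shuffleSum_apply, ← smul_add, ← Finset.sum_add_distrib]
      simp [biMul])
    (fun c X Y => by
      ext1 a
      simp only [AlternatingMap.smul_apply, shuffleSum_apply, Finset.smul_sum]
      refine Finset.sum_congr rfl fun σ _ => ?_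
      rw [smul_comm c, smul_comm c]
      simp [biMul, LinearMap.map_smul_of_tower])

/-- The insertion `Z ∘ K` of an `A`-valued `n`-form in the first argument of `Z`: the shuffle sum of
`Z (K(u), v₁, …, v_{r - 1})`; it is zero for `r = 0`. -/
def ins (n : ℕ) : (r : ℕ) → Form P r →ₗ[𝕂] FormA P n →ₗ[𝕂] Form P (n + r - 1)
  | 0 => 0
  | s + 1 => LinearMap.mk₂ 𝕂
    (fun Z K => shuffleSum (p := n) (q := s) 𝕂
      (biMul (fun u v => AlternatingMap.curryLeft Z (K u) v)
      (by simp) (by simp) (by simp) (by simp)))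
    (fun X X' Y => by
      ext1 a
      simp only [AlternatingMap.add_apply, shuffleSum_apply, ← smul_add, ← Finset.sum_add_distrib]
      simp [biMul])
    (fun c X Y => by
      ext1 a
      simp only [AlternatingMap.smul_apply, shuffleSum_apply, Finset.smul_sum]
      refine Finset.sum_congr rfl fun σ _ => ?_
      rw [smul_comm c, smul_comm c]
      simp [biMul])
    (fun X Y Y' => by
      ext1 a
      simp only [AlternatingMap.add_apply, shuffleSum_apply, ← smul_add, ← Finset.sum_add_distrib]
      simp only [biMul, MultilinearMap.coe_mk, AlternatingMap.add_apply, map_add, smul_add])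
    (fun c X Y => by
      ext1 a
      simp only [AlternatingMap.smul_apply, shuffleSum_apply, Finset.smul_sum]
      refine Finset.sum_congr rfl fun σ _ => ?_
      rw [smul_comm c, smul_comm c]
      simp only [biMul, MultilinearMap.coe_mk, AlternatingMap.smul_apply]
      rw [← algebraMap_smul R c, map_smul, AlternatingMap.smul_apply, algebraMap_smul])

/-- Change of the name of the degree. -/
def castDeg {p q : ℕ} (h : p = q) : Form P p →ₗ[𝕂] Form P q where
  toFun X := X.domDomCongr (finCongr h)
  map_add' _ _ := rfl
  map_smul' _ _ := rfl

/-- `T(X, Y | Z) = (-1)^{p+q+1} Z ∘ Pr_A [j X, j Y]`. -/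
def tern (p q r : ℕ) : Form P p →ₗ[𝕂] Form P q →ₗ[𝕂] Form P r →ₗ[𝕂] Form P (p + q + r - 1) :=
  mk₃ (fun X Y Z => (-1 : 𝕂) ^ (p + q + 1) • ins (p + q) r Z (wedge S p q X Y))
    (by intros; simp only [map_add, LinearMap.add_apply, smul_add])
    (by intros; simp only [map_smul, LinearMap.smul_apply]; module)
    (by intros; simp only [map_add, smul_add])
    (by intros; simp only [map_smul]; module)
    (by intros; simp only [map_add, LinearMap.add_apply, smul_add])
    (by intros; simp only [map_smul, LinearMap.smul_apply]; module)

/-- The ternary bracket `[X, Y, Z]₃` of `Ω_A(B)`,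
`T(X, Y | Z) + (-1)^{p(q+r)} T(Y, Z | X) + (-1)^{r(p+q)} T(Z, X | Y)`. -/
def c3 (p q r : ℕ) : Form P p →ₗ[𝕂] Form P q →ₗ[𝕂] Form P r →ₗ[𝕂] Form P (p + q + r - 1) :=
  mk₃ (fun X Y Z => tern S p q r X Y Z
      + (-1 : 𝕂) ^ (p * (q + r)) • castDeg (by omega) (tern S q r p Y Z X)
      + (-1 : 𝕂) ^ (r * (p + q)) • castDeg (by omega) (tern S r p q Z X Y))
    (by intros; simp only [map_add, LinearMap.add_apply, smul_add]; module)
    (by intros; simp only [map_smul, LinearMap.smul_apply]; module)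
    (by intros; simp only [map_add, LinearMap.add_apply, smul_add]; module)
    (by intros; simp only [map_smul, LinearMap.smul_apply]; module)
    (by intros; simp only [map_add, LinearMap.add_apply, smul_add]; module)
    (by intros; simp only [map_smul, LinearMap.smul_apply]; module)

/-- `(δ, X) ↦ Pr_A ∘ δ ∘ j ∘ X`. -/
def derForm (p : ℕ) : P.Der →ₗ[𝕂] Form P p →ₗ[𝕂] FormA P p :=
  LinearMap.mk₂ 𝕂 (fun δ X => LinearMap.compAlternatingMap
    { toFun := fun b => prA S (δ.1.1 (S.toFun b))
      map_add' := by simp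
      map_smul' := by simp [δ.2.1, prA_j] } X)
    (by intros; ext; simp) (by intros; ext; simp [LinearMap.map_smul_of_tower])
    (by intros; ext; simp) (by intros; ext; simp [LinearMap.map_smul_of_tower])

/-- `[δ, X, Y]₃ = (-1)^{p+1} Y ∘ (Pr_A δ j X) + (-1)^{q(p+1)} X ∘ (Pr_A δ j Y)`; moving the inserted
form from the first arguments to the last `q` ones absorbs the sign of the second term. -/
def d3 (p q : ℕ) : P.Der →ₗ[𝕂] Form P p →ₗ[𝕂] Form P q →ₗ[𝕂] Form P (p + q - 1) :=
  mk₃ (fun δ X Y => (-1 : 𝕂) ^ (p + 1) • ins p q Y (derForm S p δ X)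
      + (-1 : 𝕂) ^ (q * (p + 1)) • castDeg (by omega) (ins q p X (derForm S q δ Y)))
    (by intros; simp only [map_add, LinearMap.add_apply, smul_add]; module)
    (by intros; simp only [map_smul, LinearMap.smul_apply]; module)
    (by intros; simp only [map_add, LinearMap.add_apply, smul_add]; module)
    (by intros; simp only [map_smul, LinearMap.smul_apply]; module)
    (by intros; simp only [map_add, LinearMap.add_apply, smul_add]; module)
    (by intros; simp only [map_smul, LinearMap.smul_apply]; module)

/-- `Pr_B [w₀, j X(w₁, …, w_p)] - ½ ∑ₖ X(w₁, …, Pr_A [w₀, wₖ], …, w_p)`. -/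
def c1Fun {p : ℕ} (X : Form P p) (w : Fin (p + 1) → P.sub) : V ⧸ P.sub :=
  P.prB (P.bracket (w 0) (S.toFun (X (Fin.tail w))))
    - (2⁻¹ : 𝕂) • slotSum X (adA S (w 0)) (Fin.tail w)

theorem tail_update_zero {A : Type*} {p : ℕ} (w : Fin (p + 1) → A) (z : A) :
    Fin.tail (Function.update w 0 z) = Fin.tail w := by
  funext k; simp [Fin.tail]

theorem tail_update_succ {A : Type*} {p : ℕ} (w : Fin (p + 1) → A) (k : Fin p) (z : A) :
    Fin.tail (Function.update w k.succ z) = Function.update (Fin.tail w) k z := by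
  rw [Fin.tail_update_succ]

theorem adA_smul_coe (f : R) (z a : P.sub) :
    adA S ((f • z : P.sub) : V) a = f • adA S z a - P.anchor a f • z := by
  simp [adA, P.leibniz_left, prA_coe]

theorem c1Fun_update_add {p : ℕ} (X : Form P p) (w : Fin (p + 1) → P.sub) (i : Fin (p + 1))
    (x y : P.sub) : c1Fun S X (Function.update w i (x + y)) =
      c1Fun S X (Function.update w i x) + c1Fun S X (Function.update w i y) := by
  refine Fin.cases ?_ (fun k => ?_) i
  · simp only [c1Fun, tail_update_zero, Function.update_self, Submodule.coe_add, map_add,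
      LinearMap.add_apply, slotSum_adA_add, smul_add]
    abel
  · simp only [c1Fun, tail_update_succ, Function.update_of_ne (Fin.succ_ne_zero k).symm,
      AlternatingMap.map_update_add, map_add, slotSum_add X _ (fun x y => map_add (adA S _) x y),
      smul_add]
    abel

theorem c1Fun_update_zero {p : ℕ} (X : Form P p) (w : Fin (p + 1) → P.sub) (f : R) (z : P.sub) :
    c1Fun S X (Function.update w 0 (f • z)) = f • c1Fun S X (Function.update w 0 z) +
      ∑ k : Fin p, (2⁻¹ : 𝕂) • P.anchor (w k.succ) f • X (Function.update (Fin.tail w) k z) := by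
  have h : slotSum X (adA S ((f • z : P.sub) : V)) (Fin.tail w) =
      f • slotSum X (adA S (z : V)) (Fin.tail w) -
        ∑ k : Fin p, P.anchor (w k.succ) f • X (Function.update (Fin.tail w) k z) := by
    simp only [slotSum, adA_smul_coe, Finset.smul_sum, ← Finset.sum_sub_distrib]
    refine Finset.sum_congr rfl fun k _ => ?_
    rw [X.map_update_sub, X.map_update_smul, X.map_update_smul]
    rfl
  simp only [c1Fun, tail_update_zero, Function.update_self, h]
  simp only [smul_sub, Finset.smul_sum,
    Submodule.coe_smul, P.leibniz_left, map_sub, map_smul, prB_coe, smul_zero]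
  rw [smul_comm f (2⁻¹ : 𝕂)]
  abel

theorem c1Fun_update_succ {p : ℕ} (X : Form P p) (w : Fin (p + 1) → P.sub) (k : Fin p)
    (f : R) (z : P.sub) [CharZero 𝕂] :
    c1Fun S X (Function.update w k.succ (f • z)) = f • c1Fun S X (Function.update w k.succ z) +
      (2⁻¹ : 𝕂) • P.anchor (w 0) f • X (Function.update (Fin.tail w) k z) := by
  simp only [c1Fun, tail_update_succ, Function.update_of_ne (Fin.succ_ne_zero k).symm,
    AlternatingMap.map_update_smul, map_smul, P.leibniz, map_add, prB_j,
    slotSum_smul X _ f _ (fun x => adA_smul S (w 0) f x), smul_add, smul_sub]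
  rw [smul_comm f (2⁻¹ : 𝕂)]
  have h2 : P.anchor (w 0) f • X (Function.update (Fin.tail w) k z) =
      (2⁻¹ : 𝕂) • P.anchor (w 0) f • X (Function.update (Fin.tail w) k z) +
      (2⁻¹ : 𝕂) • P.anchor (w 0) f • X (Function.update (Fin.tail w) k z) := by
    rw [← add_smul, ← two_mul, mul_inv_cancel₀ two_ne_zero, one_smul]
  nth_rewrite 1 [h2]
  abel

/-- `c1Fun` as a `𝕂`-multilinear map. -/
def c1Mul [CharZero 𝕂] {p : ℕ} (X : Form P p) :
    MultilinearMap 𝕂 (fun _ : Fin (p + 1) => P.sub) (V ⧸ P.sub) where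
  toFun := c1Fun S X
  map_update_add' {inst} w i x y := by
    rw [Subsingleton.elim inst (instDecidableEqFin (p + 1))]
    exact c1Fun_update_add S X w i x y
  map_update_smul' {inst} w i c x := by
    rw [Subsingleton.elim inst (instDecidableEqFin (p + 1)), ← algebraMap_smul R c,
      ← algebraMap_smul R c]
    obtain rfl | ⟨k, rfl⟩ := Fin.eq_zero_or_eq_succ i
    · rw [c1Fun_update_zero]; simp only [Derivation.map_algebraMap, zero_smul, smul_zero, Finset.sum_const_zero, add_zero]
    · rw [c1Fun_update_succ]; simp only [Derivation.map_algebraMap, zero_smul, smul_zero, add_zero]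

theorem alternatization_c1Mul_smul [CharZero 𝕂] {p : ℕ} (X : Form P p) (v : Fin (p + 1) → P.sub)
    (l : Fin (p + 1)) (f : R) (z : P.sub) :
    MultilinearMap.alternatization (c1Mul S X) (Function.update v l (f • z)) =
      f • MultilinearMap.alternatization (c1Mul S X) (Function.update v l z) := by
  let G : Equiv.Perm (Fin (p + 1)) → Fin p → V ⧸ P.sub := fun σ k =>
    if σ 0 = l then (2⁻¹ : 𝕂) • P.anchor (v (σ k.succ)) f •
      X (Function.update (Fin.tail (v ∘ σ)) k z) else 0
  have key : ∀ σ : Equiv.Perm (Fin (p + 1)),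
      c1Fun S X (Function.update v l (f • z) ∘ σ) = f • c1Fun S X (Function.update v l z ∘ σ) +
        ∑ k, (G σ k + G (σ * Equiv.swap 0 k.succ) k) := by
    intro σ
    obtain ⟨i, rfl⟩ := σ.surjective l
    have hu : ∀ y : P.sub, Function.update v (σ i) y ∘ σ = Function.update (v ∘ σ) i y := by
      intro y
      exact Function.update_comp_eq_of_injective v σ.injective i y
    rw [hu, hu]
    obtain rfl | ⟨k, rfl⟩ := Fin.eq_zero_or_eq_succ i
    · rw [c1Fun_update_zero]
      congr 1
      refine Finset.sum_congr rfl fun k _ => ?_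
      simp [G, σ.injective.eq_iff]
    · rw [c1Fun_update_succ]
      congr 1
      rw [Finset.sum_eq_single k]
      · have ht : Function.update (Fin.tail (v ∘ σ ∘ Equiv.swap 0 k.succ)) k z =
            Function.update (Fin.tail (v ∘ σ)) k z := by
          funext m
          by_cases hm : m = k
          · subst hm; simp
          · rw [Function.update_of_ne hm, Function.update_of_ne hm]
            simp only [Fin.tail, Function.comp]
            rw [Equiv.swap_apply_of_ne_of_ne (Fin.succ_ne_zero m)
              (fun h => hm (Fin.succ_injective _ h))]
        simp only [G, Equiv.Perm.coe_mul, Function.comp_apply, Equiv.swap_apply_left,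
          Equiv.swap_apply_right, if_true, ht, σ.injective.eq_iff]
        rw [if_neg (Fin.succ_ne_zero k).symm, zero_add]
      · intro m _ hm
        simp only [G, Equiv.Perm.coe_mul, Function.comp_apply, Equiv.swap_apply_left,
          σ.injective.eq_iff]
        rw [if_neg (Fin.succ_ne_zero k).symm, if_neg (fun h => hm (Fin.succ_injective _ h)),
          add_zero]
      · simp
  simp only [MultilinearMap.alternatization_apply, MultilinearMap.domDomCongr_apply]
  change ∑ σ : Equiv.Perm (Fin (p + 1)), Equiv.Perm.sign σ •
      c1Fun S X (Function.update v l (f • z) ∘ σ) =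
    f • ∑ σ : Equiv.Perm (Fin (p + 1)), Equiv.Perm.sign σ • c1Fun S X (Function.update v l z ∘ σ)
  have hzero : ∑ σ : Equiv.Perm (Fin (p + 1)), Equiv.Perm.sign σ •
      ∑ k, (G σ k + G (σ * Equiv.swap 0 k.succ) k) = 0 := by
    simp only [Finset.smul_sum, smul_add]
    rw [Finset.sum_comm]
    refine Finset.sum_eq_zero fun k _ => ?_
    rw [Finset.sum_add_distrib]
    have := Equiv.sum_comp (Equiv.mulRight (Equiv.swap (0 : Fin (p + 1)) k.succ))
      (fun σ => Equiv.Perm.sign (σ * Equiv.swap 0 k.succ) • G σ k)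
    simp only [Equiv.coe_mulRight, mul_assoc, Equiv.swap_mul_self, mul_one] at this
    rw [this, ← Finset.sum_add_distrib]
    refine Finset.sum_eq_zero fun σ _ => ?_
    rw [Equiv.Perm.sign_mul, Equiv.Perm.sign_swap (Fin.succ_ne_zero k).symm]
    simp
  simp only [key]
  simp only [smul_add (Equiv.Perm.sign _)]
  rw [Finset.sum_add_distrib, hzero, add_zero, Finset.smul_sum]
  refine Finset.sum_congr rfl fun σ _ => ?_
  rw [smul_comm]

/-- The Chevalley–Eilenberg differential of the Bott connection `∇_a b = Pr_B [a, j b]`: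
`(d X)(a₀, …, a_p) = ∑ᵢ (-1)^i ∇_{aᵢ} (X(…, âᵢ, …)) + ∑_{i<k} (-1)^{i+k} X([aᵢ, aₖ], …, âᵢ, …, âₖ, …)`,
written as the signed sum of `c1Fun` over all permutations of the arguments, divided by `p!`. -/
def c1 [CharZero 𝕂] (p : ℕ) : Form P p →ₗ[𝕂] Form P (p + 1) where
  toFun X :=
    { toFun := fun v => (p ! : 𝕂)⁻¹ • MultilinearMap.alternatization (c1Mul S X) v
      map_update_add' := fun {inst} v i x y => by
        rw [Subsingleton.elim inst (instDecidableEqFin (p + 1)), AlternatingMap.map_update_add,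
          smul_add]
      map_update_smul' := fun {inst} v i f x => by
        rw [Subsingleton.elim inst (instDecidableEqFin (p + 1)), alternatization_c1Mul_smul,
          smul_comm]
      map_eq_zero_of_eq' := fun v i j hv hij => by
        rw [AlternatingMap.map_eq_zero_of_eq _ v hv hij, smul_zero] }
  map_add' X Y := by
    refine AlternatingMap.ext fun v => ?_
    change (p ! : 𝕂)⁻¹ • MultilinearMap.alternatization (c1Mul S (X + Y)) v =
      (p ! : 𝕂)⁻¹ • MultilinearMap.alternatization (c1Mul S X) v +
      (p ! : 𝕂)⁻¹ • MultilinearMap.alternatization (c1Mul S Y) v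
    rw [← smul_add, ← AlternatingMap.add_apply, ← map_add]
    congr 3
    refine MultilinearMap.ext fun w => ?_
    change c1Fun S (X + Y) w = c1Fun S X w + c1Fun S Y w
    simp only [c1Fun, AlternatingMap.add_apply, map_add, slotSum_form_add, smul_add]
    abel
  map_smul' c X := by
    refine AlternatingMap.ext fun v => ?_
    change (p ! : 𝕂)⁻¹ • MultilinearMap.alternatization (c1Mul S (c • X)) v =
      c • (p ! : 𝕂)⁻¹ • MultilinearMap.alternatization (c1Mul S X) v
    simp only [MultilinearMap.alternatization_apply, MultilinearMap.domDomCongr_apply,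
      Finset.smul_sum]
    refine Finset.sum_congr rfl fun σ _ => ?_
    rw [smul_comm c, smul_comm c]
    refine congrArg _ (congrArg _ ?_)
    change c1Fun S (c • X) _ = c • c1Fun S X _
    simp only [c1Fun, AlternatingMap.smul_apply, LinearMap.map_smul_of_tower, slotSum_form_smul,
      smul_sub, smul_comm c]

end Operations

end Pair
end Algebra

/-- A local Artinian `𝕂`-algebra with residue field `𝕂`. -/
structure ArtAlg (𝕂 : Type k) [Field 𝕂] where
  carrier : Type v
  [commRing : CommRing carrier]
  [algebra : Algebra 𝕂 carrier]
  [isLocalRing : IsLocalRing carrier]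
  [isArtinianRing : IsArtinianRing carrier]
  residue : Function.Surjective (algebraMap 𝕂 (IsLocalRing.ResidueField carrier))

namespace ArtAlg
variable {𝕂 : Type k} [Field 𝕂]

instance : CoeSort (ArtAlg.{k, v} 𝕂) (Type v) := ⟨ArtAlg.carrier⟩

attribute [instance] ArtAlg.commRing ArtAlg.algebra ArtAlg.isLocalRing ArtAlg.isArtinianRing

instance : Category (ArtAlg.{k, v} 𝕂) where
  Hom 𝒜 ℬ := 𝒜 →ₐ[𝕂] ℬ
  id 𝒜 := AlgHom.id 𝕂 𝒜
  comp f g := AlgHom.comp g f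

/-- The underlying algebra map of a morphism. -/
def hom {𝒜 ℬ : ArtAlg.{k, v} 𝕂} (ϑ : 𝒜 ⟶ ℬ) : 𝒜 →ₐ[𝕂] ℬ := ϑ

/-- The maximal ideal. -/
abbrev max (𝒜 : ArtAlg.{k, v} 𝕂) : Ideal 𝒜 := IsLocalRing.maximalIdeal 𝒜

theorem hom_mem_max {𝒜 ℬ : ArtAlg.{k, v} 𝕂} (ϑ : 𝒜 ⟶ ℬ) {a : 𝒜} (ha : a ∈ 𝒜.max) :
    hom ϑ a ∈ ℬ.max := by
  rw [← Ring.KrullDimLE.isNilpotent_iff_mem_maximalIdeal] at ha ⊢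
  exact ha.map (hom ϑ)

/-- The evaluation `ev : 𝒜 → 𝒜 / 𝔪 = 𝕂`. -/
def ev (𝒜 : ArtAlg.{k, v} 𝕂) : 𝒜 →ₐ[𝕂] 𝕂 :=
  (AlgEquiv.ofBijective (Algebra.ofId 𝕂 (IsLocalRing.ResidueField 𝒜))
    ⟨(algebraMap 𝕂 (IsLocalRing.ResidueField 𝒜)).injective, 𝒜.residue⟩).symm.toAlgHom.comp
    (IsScalarTower.toAlgHom 𝕂 𝒜 (IsLocalRing.ResidueField 𝒜))

theorem ev_eq_zero_iff {𝒜 : ArtAlg.{k, v} 𝕂} (a : 𝒜) : 𝒜.ev a = 0 ↔ a ∈ 𝒜.max := by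
  simp only [ev, AlgHom.comp_apply]
  rw [← IsLocalRing.residue_eq_zero_iff]
  exact map_eq_zero_iff _ (AlgEquiv.injective _)

theorem ev_hom {𝒜 ℬ : ArtAlg.{k, v} 𝕂} (ϑ : 𝒜 ⟶ ℬ) (a : 𝒜) : ℬ.ev (hom ϑ a) = 𝒜.ev a := by
  have h : a - algebraMap 𝕂 𝒜 (𝒜.ev a) ∈ 𝒜.max := by
    rw [← ev_eq_zero_iff, map_sub, AlgHom.commutes]
    exact sub_self _
  have h2 := (ev_eq_zero_iff _).2 (hom_mem_max ϑ h)
  rw [map_sub, map_sub, AlgHom.commutes, AlgHom.commutes, sub_eq_zero] at h2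
  exact h2

/-- The product `𝔪 × 𝔪 → 𝔪`. -/
def mulMax (𝒜 : ArtAlg.{k, v} 𝕂) : 𝒜.max →ₗ[𝕂] 𝒜.max →ₗ[𝕂] 𝒜.max :=
  LinearMap.mk₂ 𝕂 (fun a b => ⟨a * b, 𝒜.max.mul_mem_left _ b.2⟩)
    (fun _ _ _ => Subtype.ext (add_mul _ _ _))
    (fun _ _ _ => Subtype.ext (smul_mul_assoc _ _ _))
    (fun _ _ _ => Subtype.ext (mul_add _ _ _))
    (fun _ _ _ => Subtype.ext (mul_smul_comm _ _ _))

/-- The map induced by a morphism on maximal ideals. -/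
def homMax {𝒜 ℬ : ArtAlg.{k, v} 𝕂} (ϑ : 𝒜 ⟶ ℬ) : 𝒜.max →ₗ[𝕂] ℬ.max where
  toFun a := ⟨hom ϑ a, hom_mem_max ϑ a.2⟩
  map_add' _ _ := Subtype.ext (map_add (hom ϑ) _ _)
  map_smul' _ _ := Subtype.ext (map_smul (hom ϑ) _ _)

end ArtAlg

/-- Brackets `l1`, `l2`, `l3` of degrees `1`, `0`, `-1` on a graded vector space concentrated in
nonnegative degrees. These are the structure maps of a cubic `L_∞`-algebra; the Jacobi identities do
not enter in the definition of its deformation functor. -/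
structure CubicBrackets (𝕂 : Type k) [Field 𝕂] (g : ℕ → Type u) [∀ i, AddCommGroup (g i)]
    [∀ i, Module 𝕂 (g i)] where
  l1 : ∀ i, g i →ₗ[𝕂] g (i + 1)
  l2 : ∀ i j n, i + j = n → g i →ₗ[𝕂] g j →ₗ[𝕂] g n
  l3 : ∀ i j k n, i + j + k = n + 1 → g i →ₗ[𝕂] g j →ₗ[𝕂] g k →ₗ[𝕂] g n

section Ext
variable {𝕂 : Type k} [Field 𝕂] (𝒜 : ArtAlg.{k, v} 𝕂) {ℬ : ArtAlg.{k, v} 𝕂}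
  {X Y Z W : Type*} [AddCommGroup X] [Module 𝕂 X] [AddCommGroup Y] [Module 𝕂 Y]
    [AddCommGroup Z] [Module 𝕂 Z] [AddCommGroup W] [Module 𝕂 W]

/-- The extension `a ⊗ x ↦ a ⊗ f x` to `𝔪 ⊗ X`. -/
def ext1 (f : X →ₗ[𝕂] Y) : 𝒜.max ⊗[𝕂] X →ₗ[𝕂] 𝒜.max ⊗[𝕂] Y := f.lTensor 𝒜.max

/-- The extension `(a ⊗ x, b ⊗ y) ↦ a b ⊗ f x y`. -/
def ext2 (f : X →ₗ[𝕂] Y →ₗ[𝕂] Z) :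
    𝒜.max ⊗[𝕂] X →ₗ[𝕂] 𝒜.max ⊗[𝕂] Y →ₗ[𝕂] 𝒜.max ⊗[𝕂] Z :=
  TensorProduct.map₂ 𝒜.mulMax f

/-- The extension `(a ⊗ x, b ⊗ y, c ⊗ z) ↦ a b c ⊗ f x y z`. -/
def ext3 (f : X →ₗ[𝕂] Y →ₗ[𝕂] Z →ₗ[𝕂] W) :
    𝒜.max ⊗[𝕂] X →ₗ[𝕂] 𝒜.max ⊗[𝕂] Y →ₗ[𝕂] 𝒜.max ⊗[𝕂] Z →ₗ[𝕂] 𝒜.max ⊗[𝕂] W :=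
  (ext2 𝒜 (TensorProduct.mk 𝕂 X Y)).compr₂ (ext2 𝒜 (TensorProduct.lift f))

variable {𝒜}
/-- The map `𝔪_𝒜 ⊗ X → 𝔪_ℬ ⊗ X` induced by a morphism `𝒜 → ℬ`. -/
def push (ϑ : 𝒜 ⟶ ℬ) (X : Type*) [AddCommGroup X] [Module 𝕂 X] :
    𝒜.max ⊗[𝕂] X →ₗ[𝕂] ℬ.max ⊗[𝕂] X := (ArtAlg.homMax ϑ).rTensor X

theorem push_ext1 (ϑ : 𝒜 ⟶ ℬ) (f : X →ₗ[𝕂] Y) (x) :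
    push ϑ Y (ext1 𝒜 f x) = ext1 ℬ f (push ϑ X x) := by
  induction x with
  | zero => simp
  | add x y hx hy => simp only [map_add, hx, hy]
  | tmul a x => simp [push, ext1]

theorem push_ext2 (ϑ : 𝒜 ⟶ ℬ) (f : X →ₗ[𝕂] Y →ₗ[𝕂] Z) (x y) :
    push ϑ Z (ext2 𝒜 f x y) = ext2 ℬ f (push ϑ X x) (push ϑ Y y) := by
  induction x with
  | zero => simp
  | add x y hx hy => simp only [map_add, LinearMap.add_apply, hx, hy]
  | tmul a x =>
    induction y with
    | zero => simp
    | add x y hx hy => simp only [map_add, hx, hy]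
    | tmul b y =>
      have h : ArtAlg.homMax ϑ (𝒜.mulMax a b) =
          ℬ.mulMax (ArtAlg.homMax ϑ a) (ArtAlg.homMax ϑ b) :=
        Subtype.ext (map_mul (ArtAlg.hom ϑ) _ _)
      simp [push, ext2, h]

theorem push_ext3 (ϑ : 𝒜 ⟶ ℬ) (f : X →ₗ[𝕂] Y →ₗ[𝕂] Z →ₗ[𝕂] W) (x y z) :
    push ϑ W (ext3 𝒜 f x y z) = ext3 ℬ f (push ϑ X x) (push ϑ Y y) (push ϑ Z z) := by
  simp [ext3, LinearMap.compr₂_apply, push_ext2]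

theorem push_id (x : 𝒜.max ⊗[𝕂] X) : push (𝟙 𝒜) X x = x := by
  have h : ArtAlg.homMax (𝟙 𝒜) = LinearMap.id := rfl
  simp [push, h]

theorem push_comp {𝒞 : ArtAlg.{k, v} 𝕂} (ϑ : 𝒜 ⟶ ℬ) (η : ℬ ⟶ 𝒞) (x : 𝒜.max ⊗[𝕂] X) :
    push (ϑ ≫ η) X x = push η X (push ϑ X x) := by
  have h : ArtAlg.homMax (ϑ ≫ η) = ArtAlg.homMax η ∘ₗ ArtAlg.homMax ϑ := rfl
  simp [push, h, LinearMap.rTensor_comp]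
end Ext

namespace CubicBrackets
variable {𝕂 : Type k} [Field 𝕂] {g : ℕ → Type u} [∀ i, AddCommGroup (g i)]
    [∀ i, Module 𝕂 (g i)] (c : CubicBrackets 𝕂 g)

/-- The Maurer–Cartan equation `[ξ]₁ + [ξ, ξ]₂ / 2! + [ξ, ξ, ξ]₃ / 3! = 0` in `𝔪 ⊗ g`. -/
def IsMC (𝒜 : ArtAlg.{k, v} 𝕂) (ξ : 𝒜.max ⊗[𝕂] g 1) : Prop :=
  ext1 𝒜 (c.l1 1) ξ + (2 ! : 𝕂)⁻¹ • ext2 𝒜 (c.l2 1 1 2 rfl) ξ ξ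
    + (3 ! : 𝕂)⁻¹ • ext3 𝒜 (c.l3 1 1 1 2 rfl) ξ ξ ξ = 0

/-- The Maurer–Cartan elements of `𝔪 ⊗ g`. -/
def MC (𝒜 : ArtAlg.{k, v} 𝕂) : Type (max u v) := {ξ : 𝒜.max ⊗[𝕂] g 1 // c.IsMC 𝒜 ξ}

section
variable {𝒜 : ArtAlg.{k, v} 𝕂}

/-- The `ξ`-bracket `[b]₁^ξ`. -/
def tw1 (ξ : 𝒜.max ⊗[𝕂] g 1) (b : 𝒜.max ⊗[𝕂] g 0) : 𝒜.max ⊗[𝕂] g 1 :=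
  ext1 𝒜 (c.l1 0) b + ext2 𝒜 (c.l2 1 0 1 rfl) ξ b
    + (2 ! : 𝕂)⁻¹ • ext3 𝒜 (c.l3 1 1 0 1 rfl) ξ ξ b

/-- The `ξ`-bracket `[b, x]₂^ξ`. -/
def tw2 (ξ : 𝒜.max ⊗[𝕂] g 1) (b : 𝒜.max ⊗[𝕂] g 0) (x : 𝒜.max ⊗[𝕂] g 1) : 𝒜.max ⊗[𝕂] g 1 :=
  ext2 𝒜 (c.l2 0 1 1 rfl) b x + ext3 𝒜 (c.l3 1 0 1 1 rfl) ξ b x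

/-- The `ξ`-bracket `[b, x, y]₃^ξ`. -/
def tw3 (b : 𝒜.max ⊗[𝕂] g 0) (x y : 𝒜.max ⊗[𝕂] g 1) : 𝒜.max ⊗[𝕂] g 1 :=
  ext3 𝒜 (c.l3 0 1 1 1 rfl) b x y

/-- `gaugeTerm ξ b n` is the component `e^{n+1}_ξ(b)` of the `L_∞`-exponential: `e¹_ξ(b) = [b]₁^ξ` and
`e^{m+1}_ξ(b) = [b, e^m_ξ(b)]₂^ξ + ½ ∑_{k+l=m, k,l≥1} m! / (k! l!) [b, e^k_ξ(b), e^l_ξ(b)]₃^ξ`. -/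
def gaugeTerm (ξ : 𝒜.max ⊗[𝕂] g 1) (b : 𝒜.max ⊗[𝕂] g 0) : ℕ → 𝒜.max ⊗[𝕂] g 1
  | 0 => c.tw1 ξ b
  | n + 1 => c.tw2 ξ b (gaugeTerm ξ b n) + (2 ! : 𝕂)⁻¹ • ∑ i : Fin n,
      (((n + 1) ! : 𝕂) / (((i : ℕ) + 1) ! * (n - (i : ℕ)) ! : 𝕂)) •
        c.tw3 b (gaugeTerm ξ b i) (gaugeTerm ξ b (n - 1 - i))
  decreasing_by all_goals omega

/-- `η = e^b * ξ = ξ - ∑_{n≥1} e^n_ξ(b) / n!` for some `b ∈ 𝔪 ⊗ g⁰`. The sum is finite, since `𝔪` is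
nilpotent: its partial sums are eventually constant. -/
def Gauge (ξ η : 𝒜.max ⊗[𝕂] g 1) : Prop :=
  ∃ b : 𝒜.max ⊗[𝕂] g 0, ∀ᶠ N in Filter.atTop,
    η = ξ - ∑ n ∈ Finset.range N, ((n + 1) ! : 𝕂)⁻¹ • c.gaugeTerm ξ b n
end

section
variable {𝒜 ℬ : ArtAlg.{k, v} 𝕂} (ϑ : 𝒜 ⟶ ℬ)

theorem IsMC.push {ξ : 𝒜.max ⊗[𝕂] g 1} (h : c.IsMC 𝒜 ξ) :
    c.IsMC ℬ (push ϑ (g 1) ξ) := by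
  have := congrArg (LieDef.push ϑ (g 2)) h
  simp only [map_add, map_smul, map_zero, push_ext1, push_ext2, push_ext3] at this
  exact this

theorem push_gaugeTerm (ξ : 𝒜.max ⊗[𝕂] g 1) (b : 𝒜.max ⊗[𝕂] g 0) (n : ℕ) :
    push ϑ (g 1) (c.gaugeTerm ξ b n) = c.gaugeTerm (push ϑ (g 1) ξ) (push ϑ (g 0) b) n := by
  induction n using Nat.strongRec with
  | ind n ih =>
    cases n with
    | zero =>
      simp only [gaugeTerm, tw1, map_add, map_smul, push_ext1, push_ext2, push_ext3]
    | succ n =>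
      rw [gaugeTerm, gaugeTerm]
      simp only [tw2, tw3, map_add, map_smul, map_sum, push_ext2, push_ext3, ih n (by omega)]
      refine congrArg _ (congrArg _ (Finset.sum_congr rfl fun i _ => ?_))
      rw [ih i (by omega), ih (n - 1 - i) (by omega)]

theorem Gauge.push {ξ η : 𝒜.max ⊗[𝕂] g 1} (h : c.Gauge ξ η) :
    c.Gauge (push ϑ (g 1) ξ) (push ϑ (g 1) η) := by
  obtain ⟨b, hb⟩ := h
  refine ⟨LieDef.push ϑ (g 0) b, hb.mono fun N hN => ?_⟩
  rw [hN]
  simp only [map_sub, map_sum, map_smul, push_gaugeTerm]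
end

/-- The algebraic deformation functor: gauge equivalence classes of Maurer–Cartan elements of
`𝔪 ⊗ g`. -/
def deformationFunctor : ArtAlg.{k, v} 𝕂 ⥤ Type (max u v) where
  obj 𝒜 := Quot fun ξ η : c.MC 𝒜 => c.Gauge ξ.1 η.1
  map ϑ := ↾ Quot.map (fun ξ => ⟨push ϑ (g 1) ξ.1, IsMC.push c ϑ ξ.2⟩) (fun _ _ h => Gauge.push c ϑ h)
  map_id 𝒜 := by
    ext x
    induction x using Quot.inductionOn with
    | h x => exact congrArg (Quot.mk _) (Subtype.ext (push_id x.1))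
  map_comp ϑ η := by
    ext x
    induction x using Quot.inductionOn with
    | h x => exact congrArg (Quot.mk _) (Subtype.ext (push_comp ϑ η x.1))
end CubicBrackets

namespace Pair
variable {𝕂 : Type k} {R V : Type u} [Field 𝕂] [CommRing R] [Algebra 𝕂 R]
    [AddCommGroup V] [Module 𝕂 V] [Module R V] [IsScalarTower 𝕂 R V] (P : Pair 𝕂 R V)

/-- The graded vector space `𝔥`, with `𝔥⁰ = Der(L) ⊕ Γ(B)` and `𝔥ⁿ = Ωⁿ_A(B)` for `n ≥ 1`. -/
def Ext : ℕ → Type u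
  | 0 => P.Der × Form P 0
  | n + 1 => Form P (n + 1)

instance : ∀ n, AddCommGroup (P.Ext n)
  | 0 => inferInstanceAs (AddCommGroup (P.Der × Form P 0))
  | n + 1 => inferInstanceAs (AddCommGroup (Form P (n + 1)))

instance : ∀ n, Module 𝕂 (P.Ext n)
  | 0 => inferInstanceAs (Module 𝕂 (P.Der × Form P 0))
  | n + 1 => inferInstanceAs (Module 𝕂 (Form P (n + 1)))

/-- The projection `𝔥ⁿ → Ωⁿ_A(B)`. -/
def formOf : ∀ n, P.Ext n →ₗ[𝕂] Form P n
  | 0 => LinearMap.snd 𝕂 P.Der (Form P 0)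
  | _ + 1 => LinearMap.id

/-- The projection `𝔥⁰ → Der(L)`, and zero in positive degrees. -/
def derOf : ∀ n, P.Ext n →ₗ[𝕂] P.Der
  | 0 => LinearMap.fst 𝕂 P.Der (Form P 0)
  | _ + 1 => 0

/-- The inclusion `Ωⁿ_A(B) → 𝔥ⁿ`. -/
def ofForm : ∀ n, Form P n →ₗ[𝕂] P.Ext n
  | 0 => LinearMap.inr 𝕂 P.Der (Form P 0)
  | _ + 1 => LinearMap.id

/-- The inclusion `Der(L) → 𝔥⁰`, and zero in positive degrees. -/
def ofDer : ∀ n, P.Der →ₗ[𝕂] P.Ext n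
  | 0 => LinearMap.inl 𝕂 P.Der (Form P 0)
  | _ + 1 => 0

variable {P} (S : P.Splitting)

/-- The identity of `Ω^p_A(B)` if `p = q`, and zero otherwise. -/
def castForm (p q : ℕ) : Form P p →ₗ[𝕂] Form P q :=
  if h : p = q then castDeg h else 0

theorem castForm_self (p : ℕ) (X : Form P p) : castForm (𝕂 := 𝕂) p p X = X := by
  rw [castForm, dif_pos rfl]
  rfl

/-- The 1-bracket `[X + δ]₁ = d X + [δ]₁` of `𝔥`. -/
def h1 [CharZero 𝕂] (i : ℕ) : P.Ext i →ₗ[𝕂] P.Ext (i + 1) :=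
  P.ofForm (i + 1) ∘ₗ (c1 S i ∘ₗ P.formOf i + castForm 1 (i + 1) ∘ₗ kappa ∘ₗ P.derOf i)

/-- The 2-bracket of `𝔥`: `[X + δ, Y + δ']₂ = [X, Y]₂ + [δ, Y]₂ - [δ', X]₂ + [δ, δ']`, where the
derivations only occur in degree `0`; here `n = i + j`. -/
def h2 (i j n : ℕ) : P.Ext i →ₗ[𝕂] P.Ext j →ₗ[𝕂] P.Ext n :=
  LinearMap.mk₂ 𝕂
    (fun x y =>
      P.ofForm n (castForm (i + j) n (c2 S i j (P.formOf i x) (P.formOf j y))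
        + castForm j n (act S j (P.derOf i x) (P.formOf j y))
        - castForm i n (act S i (P.derOf j y) (P.formOf i x)))
      + P.ofDer n (P.derBracket (P.derOf i x) (P.derOf j y)))
    (by intros; simp only [map_add, map_sub, LinearMap.add_apply]; abel)
    (by intros; simp only [map_add, map_sub, map_smul, LinearMap.smul_apply, smul_add, smul_sub])
    (by intros; simp only [map_add, map_sub, LinearMap.add_apply]; abel)
    (by intros; simp only [map_add, map_sub, map_smul, LinearMap.smul_apply, smul_add, smul_sub])

/-- The 3-bracket of `𝔥`: the graded skew-symmetric extension of `[X, Y, Z]₃` and `[δ, Y, Z]₃`, where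
derivations only occur in degree `0`, and the bracket with two of them is zero; here
`n = i + j + k - 1`. -/
def h3 (i j k n : ℕ) : P.Ext i →ₗ[𝕂] P.Ext j →ₗ[𝕂] P.Ext k →ₗ[𝕂] P.Ext n :=
  mk₃ (fun x y z =>
      P.ofForm n (castForm (i + j + k - 1) n
          (c3 S i j k (P.formOf i x) (P.formOf j y) (P.formOf k z))
        + castForm (j + k - 1) n (d3 S j k (P.derOf i x) (P.formOf j y) (P.formOf k z))
        - castForm (i + k - 1) n (d3 S i k (P.derOf j y) (P.formOf i x) (P.formOf k z))
        + castForm (i + j - 1) n (d3 S i j (P.derOf k z) (P.formOf i x) (P.formOf j y))))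
    (by intros; simp only [map_add, map_sub, LinearMap.add_apply]; abel)
    (by intros; simp only [map_add, map_sub, map_smul, LinearMap.smul_apply, smul_add, smul_sub])
    (by intros; simp only [map_add, map_sub, LinearMap.add_apply]; abel)
    (by intros; simp only [map_add, map_sub, map_smul, LinearMap.smul_apply, smul_add, smul_sub])
    (by intros; simp only [map_add, map_sub, LinearMap.add_apply]; abel)
    (by intros; simp only [map_add, map_sub, map_smul, LinearMap.smul_apply, smul_add, smul_sub])

/-- The extended cubic `L_∞`-algebra `𝔥` for a splitting `j`. -/
def extended [CharZero 𝕂] : CubicBrackets 𝕂 P.Ext where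
  l1 := h1 S
  l2 i j n _ := h2 S i j n
  l3 i j k n _ := h3 S i j k n
end Pair

section Thick
variable {𝕂 : Type k} [Field 𝕂]

/-- `X ⊗ 𝒜`, written with the factor `𝒜` on the left: `C^∞(M_𝒜)` for `X = C^∞(M, 𝕂)`, `Γ(E_𝒜)` for
`X = Γ(E)`, and the vector fields of `M_𝒜` for `X` the vector fields of `M`. -/
abbrev Thick (𝒜 : ArtAlg.{k, v} 𝕂) (X : Type*) [AddCommGroup X] [Module 𝕂 X] : Type _ :=
  𝒜 ⊗[𝕂] X

section
variable (𝒜 : ArtAlg.{k, v} 𝕂) {X Y Z : Type*} [AddCommGroup X] [Module 𝕂 X]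
  [AddCommGroup Y] [Module 𝕂 Y] [AddCommGroup Z] [Module 𝕂 Z]

/-- The inclusion `X → X ⊗ 𝒜`. -/
def inc : X →ₗ[𝕂] Thick 𝒜 X := TensorProduct.mk 𝕂 𝒜 X 1

/-- The evaluation `X ⊗ 𝒜 → X` at the maximal ideal. -/
def evT : Thick 𝒜 X →ₗ[𝕂] X :=
  (TensorProduct.lid 𝕂 X).toLinearMap ∘ₗ 𝒜.ev.toLinearMap.rTensor X

theorem evT_inc (x : X) : evT 𝒜 (inc 𝒜 x) = x := by
  simp [evT, inc]

theorem evT_smul (a : 𝒜) (x : Thick 𝒜 X) : evT 𝒜 (a • x) = 𝒜.ev a • evT 𝒜 x := by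
  induction x using TensorProduct.induction_on with
  | zero => simp
  | add x y hx hy => simp only [smul_add, map_add, hx, hy]
  | tmul b x => simp [evT, TensorProduct.smul_tmul', mul_smul]

theorem thick_induction {𝒜 : ArtAlg.{k, v} 𝕂} {p : Thick 𝒜 X → Prop} (x : Thick 𝒜 X)
    (hi : ∀ x, p (inc 𝒜 x)) (hs : ∀ (a : 𝒜) x, p x → p (a • x))
    (ha : ∀ x y, p x → p y → p (x + y)) : p x := by
  induction x using TensorProduct.induction_on with
  | zero => simpa using hi 0
  | add x y hx hy => exact ha x y hx hy
  | tmul b x =>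
    have := hs b _ (hi x)
    simpa [inc, TensorProduct.smul_tmul'] using this

/-- The `𝒜`-bilinear extension of a bilinear map with values in an `𝒜`-module. -/
def liftBil {N : Type*} [AddCommGroup N] [Module 𝕂 N] [Module 𝒜 N] [IsScalarTower 𝕂 𝒜 N]
    (B : X →ₗ[𝕂] Y →ₗ[𝕂] N) : Thick 𝒜 X →ₗ[𝒜] Thick 𝒜 Y →ₗ[𝒜] N :=
  LinearMap.liftBaseChange 𝒜
    (((LinearMap.liftBaseChangeEquiv (R := 𝕂) (M := Y) (N := N) 𝒜).toLinearMap.restrictScalars 𝕂) ∘ₗ B)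

theorem liftBil_inc {N : Type*} [AddCommGroup N] [Module 𝕂 N] [Module 𝒜 N] [IsScalarTower 𝕂 𝒜 N]
    (B : X →ₗ[𝕂] Y →ₗ[𝕂] N) (x : X) (y : Y) : liftBil 𝒜 B (inc 𝒜 x) (inc 𝒜 y) = B x y := by
  simp [liftBil, inc]

/-- The `𝒜`-bilinear extension of a bilinear map. -/
def extBil (B : X →ₗ[𝕂] Y →ₗ[𝕂] Z) : Thick 𝒜 X →ₗ[𝒜] Thick 𝒜 Y →ₗ[𝒜] Thick 𝒜 Z :=
  liftBil 𝒜 (B.compr₂ (inc 𝒜))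

theorem extBil_inc (B : X →ₗ[𝕂] Y →ₗ[𝕂] Z) (x : X) (y : Y) :
    extBil 𝒜 B (inc 𝒜 x) (inc 𝒜 y) = inc 𝒜 (B x y) := by
  simp [extBil, liftBil_inc]

theorem lin_inc {N : Type*} [AddCommGroup N] [Module 𝕂 N] [Module 𝒜 N] [IsScalarTower 𝕂 𝒜 N]
    (f : X →ₗ[𝕂] N) (x : X) : LinearMap.liftBaseChange 𝒜 f (inc 𝒜 x) = f x := by
  simp [inc]

theorem lin_ext {N : Type*} [AddCommGroup N] [Module 𝒜 N] {f g : Thick 𝒜 X →ₗ[𝒜] N}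
    (h : ∀ x, f (inc 𝒜 x) = g (inc 𝒜 x)) : f = g := by
  refine LinearMap.ext fun x => ?_
  induction x using thick_induction with
  | hi x => exact h x
  | hs a x hx => rw [map_smul, map_smul, hx]
  | ha x y hx hy => rw [map_add, map_add, hx, hy]

theorem bil_ext {N : Type*} [AddCommGroup N] [Module 𝒜 N]
    {f g : Thick 𝒜 X →ₗ[𝒜] Thick 𝒜 Y →ₗ[𝒜] N}
    (h : ∀ x y, f (inc 𝒜 x) (inc 𝒜 y) = g (inc 𝒜 x) (inc 𝒜 y)) : f = g :=
  lin_ext 𝒜 fun x => lin_ext 𝒜 fun y => h x y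

end

section
variable {𝒜 ℬ 𝒞 : ArtAlg.{k, v} 𝕂} (ϑ : 𝒜 ⟶ ℬ) {X Y Z : Type*} [AddCommGroup X] [Module 𝕂 X]
  [AddCommGroup Y] [Module 𝕂 Y] [AddCommGroup Z] [Module 𝕂 Z]

/-- The map `X ⊗ 𝒜 → X ⊗ ℬ` induced by a morphism `𝒜 → ℬ`. -/
def pushT : Thick 𝒜 X →ₗ[𝕂] Thick ℬ X := (ArtAlg.hom ϑ).toLinearMap.rTensor X

theorem pushT_inc (x : X) : pushT ϑ (inc 𝒜 x) = inc ℬ x := by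
  simp [pushT, inc]

theorem pushT_smul (a : 𝒜) (x : Thick 𝒜 X) :
    pushT ϑ (a • x) = ArtAlg.hom ϑ a • pushT ϑ x := by
  induction x using TensorProduct.induction_on with
  | zero => simp
  | add x y hx hy => simp only [smul_add, map_add, hx, hy]
  | tmul b x => simp [pushT, TensorProduct.smul_tmul']

theorem evT_pushT (x : Thick 𝒜 X) : evT ℬ (pushT ϑ x) = evT 𝒜 x := by
  induction x using thick_induction with
  | hi x => rw [pushT_inc, evT_inc, evT_inc]
  | hs a x hx => rw [pushT_smul, evT_smul, evT_smul, hx, ArtAlg.ev_hom]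
  | ha x y hx hy => simp only [map_add, hx, hy]

theorem pushT_id (x : Thick 𝒜 X) : pushT (𝟙 𝒜) x = x := by
  have h : (ArtAlg.hom (𝟙 𝒜)).toLinearMap = LinearMap.id := rfl
  simp [pushT, h]

theorem pushT_comp (η : ℬ ⟶ 𝒞) (x : Thick 𝒜 X) :
    pushT (ϑ ≫ η) x = pushT η (pushT ϑ x) := by
  have h : (ArtAlg.hom (ϑ ≫ η)).toLinearMap =
    (ArtAlg.hom η).toLinearMap ∘ₗ (ArtAlg.hom ϑ).toLinearMap := rfl
  simp [pushT, h, LinearMap.rTensor_comp]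

theorem bil_pushT {f : Thick 𝒜 X →ₗ[𝒜] Thick 𝒜 Y →ₗ[𝒜] Thick 𝒜 Z}
    {g : Thick ℬ X →ₗ[ℬ] Thick ℬ Y →ₗ[ℬ] Thick ℬ Z}
    (h : ∀ x y, g (inc ℬ x) (inc ℬ y) = pushT ϑ (f (inc 𝒜 x) (inc 𝒜 y))) (x y) :
    g (pushT ϑ x) (pushT ϑ y) = pushT ϑ (f x y) := by
  induction x using thick_induction with
  | hs a x hx => simp only [pushT_smul, map_smul, LinearMap.smul_apply, hx]
  | ha x y hx hy => simp only [map_add, LinearMap.add_apply, hx, hy]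
  | hi x =>
    induction y using thick_induction with
    | hs a x hx => simp only [pushT_smul, map_smul, hx]
    | ha x y hx hy => simp only [map_add, hx, hy]
    | hi y => rw [pushT_inc, pushT_inc, h]

theorem lin_pushT {f : Thick 𝒜 X →ₗ[𝒜] Thick 𝒜 Y} {g : Thick ℬ X →ₗ[ℬ] Thick ℬ Y}
    (h : ∀ x, g (inc ℬ x) = pushT ϑ (f (inc 𝒜 x))) (x) :
    g (pushT ϑ x) = pushT ϑ (f x) := by
  induction x using thick_induction with
  | hs a x hx => simp only [pushT_smul, map_smul, hx]
  | ha x y hx hy => simp only [map_add, hx, hy]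
  | hi x => rw [pushT_inc, h]

/-- Base change of a linear map along a morphism of parameter algebras. -/
def pushLin (f : Thick 𝒜 X →ₗ[𝒜] Thick 𝒜 Y) : Thick ℬ X →ₗ[ℬ] Thick ℬ Y :=
  LinearMap.liftBaseChange ℬ (pushT ϑ ∘ₗ f.restrictScalars 𝕂 ∘ₗ inc 𝒜)

theorem pushLin_inc (f : Thick 𝒜 X →ₗ[𝒜] Thick 𝒜 Y) (x : X) :
    pushLin ϑ f (inc ℬ x) = pushT ϑ (f (inc 𝒜 x)) := by
  simp [pushLin, lin_inc]

theorem pushLin_pushT (f : Thick 𝒜 X →ₗ[𝒜] Thick 𝒜 Y) (x) :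
    pushLin ϑ f (pushT ϑ x) = pushT ϑ (f x) := lin_pushT ϑ (pushLin_inc ϑ f) x

/-- Base change of a bilinear map along a morphism of parameter algebras. -/
def pushBil (f : Thick 𝒜 X →ₗ[𝒜] Thick 𝒜 Y →ₗ[𝒜] Thick 𝒜 Z) :
    Thick ℬ X →ₗ[ℬ] Thick ℬ Y →ₗ[ℬ] Thick ℬ Z :=
  liftBil ℬ (LinearMap.mk₂ 𝕂 (fun x y => pushT ϑ (f (inc 𝒜 x) (inc 𝒜 y)))
    (by simp) (fun c x y => by
      rw [map_smul, ← algebraMap_smul 𝒜 c (inc 𝒜 x), map_smul, LinearMap.smul_apply,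
        algebraMap_smul, map_smul])
    (by simp) (fun c x y => by
      rw [map_smul, ← algebraMap_smul 𝒜 c (inc 𝒜 y), map_smul, algebraMap_smul, map_smul]))

theorem pushBil_inc (f : Thick 𝒜 X →ₗ[𝒜] Thick 𝒜 Y →ₗ[𝒜] Thick 𝒜 Z) (x : X) (y : Y) :
    pushBil ϑ f (inc ℬ x) (inc ℬ y) = pushT ϑ (f (inc 𝒜 x) (inc 𝒜 y)) := by
  simp [pushBil, liftBil_inc]

theorem pushBil_pushT (f : Thick 𝒜 X →ₗ[𝒜] Thick 𝒜 Y →ₗ[𝒜] Thick 𝒜 Z) (x y) :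
    pushBil ϑ f (pushT ϑ x) (pushT ϑ y) = pushT ϑ (f x y) := bil_pushT ϑ (pushBil_inc ϑ f) x y

end
end Thick

section Ringed
variable {𝕂 : Type k} {R : Type u} [Field 𝕂] [CommRing R] [Algebra 𝕂 R]

section
variable (𝒜 : ArtAlg.{k, v} 𝕂) {X Y : Type u} [AddCommGroup X] [Module 𝕂 X] [Module R X]
  [IsScalarTower 𝕂 R X] [AddCommGroup Y] [Module 𝕂 Y] [Module R Y] [IsScalarTower 𝕂 R Y]

/-- The action of `C^∞(M_𝒜)` on `Γ(E_𝒜)`. -/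
def rsm : Thick 𝒜 R →ₗ[𝒜] Thick 𝒜 X →ₗ[𝒜] Thick 𝒜 X :=
  extBil 𝒜 (LinearMap.mk₂ 𝕂 (fun (f : R) (x : X) => f • x) add_smul
    (fun c f x => smul_assoc c f x) smul_add (fun c f x => smul_comm f c x))

/-- The action `⟨D, f⟩` of vector fields on functions of `M_𝒜`. -/
def vf : Thick 𝒜 (Derivation 𝕂 R R) →ₗ[𝒜] Thick 𝒜 R →ₗ[𝒜] Thick 𝒜 R :=
  extBil 𝒜 (LinearMap.mk₂ 𝕂 (fun (D : Derivation 𝕂 R R) (f : R) => D f)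
    (fun _ _ _ => rfl) (fun _ _ _ => rfl) (fun D f g => map_add D f g)
    (fun c D f => D.map_smul c f))

theorem rsm_inc (f : R) (x : X) : rsm 𝒜 (inc 𝒜 f) (inc 𝒜 x) = inc 𝒜 (f • x) := by
  simp [rsm, extBil_inc]

theorem vf_inc (D : Derivation 𝕂 R R) (f : R) : vf 𝒜 (inc 𝒜 D) (inc 𝒜 f) = inc 𝒜 (D f) := by
  simp [vf, extBil_inc]

end

section
variable {X Y : Type u} [AddCommGroup X] [Module 𝕂 X] [Module R X]
  [IsScalarTower 𝕂 R X] [AddCommGroup Y] [Module 𝕂 Y] [Module R Y] [IsScalarTower 𝕂 R Y]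

/-- An `𝒜`-ringed Lie algebroid structure on `E_𝒜`, for `X = Γ(E)`: an `𝒜`-bilinear Lie bracket on
`Γ(E_𝒜)` and a `C^∞(M_𝒜)`-linear anchor with the Leibniz rule. -/
@[ext] structure RingedLA {𝕂 : Type k} [Field 𝕂] (𝒜 : ArtAlg.{k, v} 𝕂) (R X : Type u) [CommRing R] [Algebra 𝕂 R]
    [AddCommGroup X] [Module 𝕂 X] [Module R X] [IsScalarTower 𝕂 R X] where
  bracket : Thick 𝒜 X →ₗ[𝒜] Thick 𝒜 X →ₗ[𝒜] Thick 𝒜 X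
  anchor : Thick 𝒜 X →ₗ[𝒜] Thick 𝒜 (Derivation 𝕂 R R)
  anchor_smul : ∀ (f : Thick 𝒜 R) x, anchor (rsm 𝒜 f x) = rsm 𝒜 f (anchor x)
  bracket_skew : ∀ x y, bracket x y = - bracket y x
  jacobi : ∀ x y z, bracket x (bracket y z) = bracket (bracket x y) z + bracket y (bracket x z)
  leibniz : ∀ x (f : Thick 𝒜 R) y,
    bracket x (rsm 𝒜 f y) = rsm 𝒜 (vf 𝒜 (anchor x) f) y + rsm 𝒜 f (bracket x y)

/-- A morphism `E_𝒜 → F_𝒜` of `𝒜`-ringed vector bundles, for `X = Γ(E)` and `Y = Γ(F)`, over a small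
automorphism `base` of `M_𝒜`. -/
@[ext] structure RingedMap {𝕂 : Type k} [Field 𝕂] (𝒜 : ArtAlg.{k, v} 𝕂) (R X Y : Type u) [CommRing R] [Algebra 𝕂 R]
    [AddCommGroup X] [Module 𝕂 X] [Module R X] [IsScalarTower 𝕂 R X]
    [AddCommGroup Y] [Module 𝕂 Y] [Module R Y] [IsScalarTower 𝕂 R Y] where
  toFun : Thick 𝒜 X →ₗ[𝒜] Thick 𝒜 Y
  base : Thick 𝒜 R →ₐ[𝒜] Thick 𝒜 R
  ev_base : ∀ f : R, evT 𝒜 (base (inc 𝒜 f)) = f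
  map_smul : ∀ (f : Thick 𝒜 R) x, toFun (rsm 𝒜 f x) = rsm 𝒜 (base f) (toFun x)

/-- `Φ` is a morphism of `𝒜`-ringed Lie algebroids: it preserves brackets, and
`λ ⟨ρ(x), f⟩ = ⟨ρ'(Φ x), λ f⟩` for the base map `λ`. -/
structure RingedMap.IsLieHom {𝒜 : ArtAlg.{k, v} 𝕂} (Φ : RingedMap 𝒜 R X Y) (Q : RingedLA 𝒜 R X)
    (Q' : RingedLA 𝒜 R Y) : Prop where
  map_bracket : ∀ x y, Φ.toFun (Q.bracket x y) = Q'.bracket (Φ.toFun x) (Φ.toFun y)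
  map_anchor : ∀ x f, Φ.base (vf 𝒜 (Q.anchor x) f) = vf 𝒜 (Q'.anchor (Φ.toFun x)) (Φ.base f)

end

/-- The `𝒜`-Cartesian extension `L⁰_𝒜`: the `𝒜`-linear extension of bracket and anchor. -/
def LieRinehart.cartesian {V : Type u} [AddCommGroup V] [Module 𝕂 V] [Module R V]
    [IsScalarTower 𝕂 R V] (L : LieRinehart 𝕂 R V) (𝒜 : ArtAlg.{k, v} 𝕂) : RingedLA 𝒜 R V where
  bracket := extBil 𝒜 L.bracket
  anchor := LinearMap.baseChange 𝒜 (L.anchor.restrictScalars 𝕂)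
  anchor_smul f x := by
    have hh : ∀ x, LinearMap.baseChange 𝒜 (L.anchor.restrictScalars 𝕂) (inc 𝒜 x) =
      inc 𝒜 (L.anchor x) := fun x => by simp [inc]
    induction x using thick_induction with
    | hs a x hx => simp only [map_smul, hx]
    | ha x y hx hy => simp only [map_add, hx, hy]
    | hi x =>
      induction f using thick_induction with
      | hs a x hx => simp only [map_smul, LinearMap.smul_apply, hx]
      | ha x y hx hy => simp only [map_add, LinearMap.add_apply, hx, hy]
      | hi f => rw [rsm_inc, hh, hh, rsm_inc, map_smul]
  bracket_skew x y := by
    induction x using thick_induction with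
    | hs a x hx => simp only [map_smul, LinearMap.smul_apply, hx, smul_neg]
    | ha x y hx hy => simp only [map_add, LinearMap.add_apply, hx, hy, neg_add]
    | hi x =>
      induction y using thick_induction with
      | hs a x hx => simp only [map_smul, LinearMap.smul_apply, hx, smul_neg]
      | ha x y hx hy => simp only [map_add, LinearMap.add_apply, hx, hy, neg_add]
      | hi y => rw [extBil_inc, extBil_inc, L.bracket_skew, map_neg]
  jacobi x y z := by
    induction x using thick_induction with
    | hs a x hx => simp only [map_smul, LinearMap.smul_apply, hx, smul_add]
    | ha x y hx hy => simp only [map_add, LinearMap.add_apply, hx, hy]; abel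
    | hi x =>
      induction y using thick_induction with
      | hs a x hx => simp only [map_smul, LinearMap.smul_apply, hx, smul_add]
      | ha x y hx hy => simp only [map_add, LinearMap.add_apply, hx, hy]; abel
      | hi y =>
        induction z using thick_induction with
        | hs a x hx => simp only [map_smul, hx, smul_add]
        | ha x y hx hy => simp only [map_add, hx, hy]; abel
        | hi z => simp only [extBil_inc, L.jacobi x y z, map_add]
  leibniz x f y := by
    have hh : ∀ x, LinearMap.baseChange 𝒜 (L.anchor.restrictScalars 𝕂) (inc 𝒜 x) =
      inc 𝒜 (L.anchor x) := fun x => by simp [inc]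
    induction x using thick_induction with
    | hs a x hx => simp only [map_smul, LinearMap.smul_apply, hx, smul_add]
    | ha x y hx hy => simp only [map_add, LinearMap.add_apply, hx, hy]; abel
    | hi x =>
      induction y using thick_induction with
      | hs a x hx => simp only [map_smul, hx, smul_add]
      | ha x y hx hy => simp only [map_add, hx, hy]; abel
      | hi y =>
        induction f using thick_induction with
        | hs a x hx => simp only [map_smul, LinearMap.smul_apply, hx, smul_add]
        | ha x y hx hy => simp only [map_add, LinearMap.add_apply, hx, hy]; abel
        | hi f => simp only [extBil_inc, rsm_inc, hh, vf_inc, L.leibniz, map_add]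

end Ringed

section Push
variable {𝕂 : Type k} {R : Type u} [Field 𝕂] [CommRing R] [Algebra 𝕂 R]
  {𝒜 ℬ 𝒞 : ArtAlg.{k, v} 𝕂} (ϑ : 𝒜 ⟶ ℬ)
  {X Y : Type u} [AddCommGroup X] [Module 𝕂 X] [Module R X]
  [IsScalarTower 𝕂 R X] [AddCommGroup Y] [Module 𝕂 Y] [Module R Y] [IsScalarTower 𝕂 R Y]

theorem rsm_pushT (f : Thick 𝒜 R) (x : Thick 𝒜 X) :
    rsm ℬ (pushT ϑ f) (pushT ϑ x) = pushT ϑ (rsm 𝒜 f x) :=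
  bil_pushT ϑ (f := rsm 𝒜) (g := rsm ℬ) (fun f x => by rw [rsm_inc, rsm_inc, pushT_inc]) f x

theorem vf_pushT (D : Thick 𝒜 (Derivation 𝕂 R R)) (f : Thick 𝒜 R) :
    vf ℬ (pushT ϑ D) (pushT ϑ f) = pushT ϑ (vf 𝒜 D f) :=
  bil_pushT ϑ (f := vf 𝒜) (g := vf ℬ) (fun f x => by rw [vf_inc, vf_inc, pushT_inc]) D f

/-- Base change of an `𝒜`-ringed Lie algebroid structure along `𝒜 → ℬ`. -/
def RingedLA.push (Q : RingedLA 𝒜 R X) : RingedLA ℬ R X where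
  bracket := pushBil ϑ Q.bracket
  anchor := pushLin ϑ Q.anchor
  anchor_smul f x := by
    induction x using thick_induction with
    | hs a x hx => simp only [map_smul, hx]
    | ha x y hx hy => simp only [map_add, hx, hy]
    | hi x =>
      induction f using thick_induction with
      | hs a x hx => simp only [map_smul, LinearMap.smul_apply, hx]
      | ha x y hx hy => simp only [map_add, LinearMap.add_apply, hx, hy]
      | hi f =>
        rw [← pushT_inc ϑ, ← pushT_inc ϑ, rsm_pushT, pushLin_pushT, pushLin_pushT, rsm_pushT,
          Q.anchor_smul]
  bracket_skew x y := by
    induction x using thick_induction with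
    | hs a x hx => simp only [map_smul, LinearMap.smul_apply, hx, smul_neg]
    | ha x y hx hy => simp only [map_add, LinearMap.add_apply, hx, hy, neg_add]
    | hi x =>
      induction y using thick_induction with
      | hs a x hx => simp only [map_smul, LinearMap.smul_apply, hx, smul_neg]
      | ha x y hx hy => simp only [map_add, LinearMap.add_apply, hx, hy, neg_add]
      | hi y => rw [pushBil_inc, pushBil_inc, Q.bracket_skew, map_neg]
  jacobi x y z := by
    induction x using thick_induction with
    | hs a x hx => simp only [map_smul, LinearMap.smul_apply, hx, smul_add]
    | ha x y hx hy => simp only [map_add, LinearMap.add_apply, hx, hy]; abel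
    | hi x =>
      induction y using thick_induction with
      | hs a x hx => simp only [map_smul, LinearMap.smul_apply, hx, smul_add]
      | ha x y hx hy => simp only [map_add, LinearMap.add_apply, hx, hy]; abel
      | hi y =>
        induction z using thick_induction with
        | hs a x hx => simp only [map_smul, hx, smul_add]
        | ha x y hx hy => simp only [map_add, hx, hy]; abel
        | hi z =>
          simp only [← pushT_inc ϑ, pushBil_pushT]
          rw [Q.jacobi, map_add]
  leibniz x f y := by
    induction x using thick_induction with
    | hs a x hx => simp only [map_smul, LinearMap.smul_apply, hx, smul_add]
    | ha x y hx hy => simp only [map_add, LinearMap.add_apply, hx, hy]; abel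
    | hi x =>
      induction y using thick_induction with
      | hs a x hx => simp only [map_smul, hx, smul_add]
      | ha x y hx hy => simp only [map_add, hx, hy]; abel
      | hi y =>
        induction f using thick_induction with
        | hs a x hx => simp only [map_smul, LinearMap.smul_apply, hx, smul_add]
        | ha x y hx hy => simp only [map_add, LinearMap.add_apply, hx, hy]; abel
        | hi f =>
          simp only [← pushT_inc ϑ, pushBil_pushT, pushLin_pushT, rsm_pushT, vf_pushT]
          rw [Q.leibniz, map_add]

/-- The map `C^∞(M_𝒜) → C^∞(M_ℬ)` as a morphism of algebras. -/
def pushAlg : Thick 𝒜 R →ₐ[𝕂] Thick ℬ R :=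
  Algebra.TensorProduct.map (ArtAlg.hom ϑ) (AlgHom.id 𝕂 R)

theorem pushAlg_apply (f : Thick 𝒜 R) : pushAlg ϑ f = pushT ϑ f := rfl

/-- Base change of an algebra endomorphism of `C^∞(M_𝒜)`. -/
def pushBase (b : Thick 𝒜 R →ₐ[𝒜] Thick 𝒜 R) : Thick ℬ R →ₐ[ℬ] Thick ℬ R :=
  Algebra.TensorProduct.lift (Algebra.ofId ℬ (Thick ℬ R))
    ((pushAlg ϑ).comp ((b.restrictScalars 𝕂).comp Algebra.TensorProduct.includeRight))
    (fun _ _ => Commute.all _ _)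

theorem pushBase_inc (b : Thick 𝒜 R →ₐ[𝒜] Thick 𝒜 R) (f : R) :
    pushBase ϑ b (inc ℬ f) = pushT ϑ (b (inc 𝒜 f)) := by
  simp only [pushBase, inc, TensorProduct.mk_apply, Algebra.TensorProduct.lift_tmul, map_one, one_mul]
  rfl

theorem pushBase_pushT (b : Thick 𝒜 R →ₐ[𝒜] Thick 𝒜 R) (f : Thick 𝒜 R) :
    pushBase ϑ b (pushT ϑ f) = pushT ϑ (b f) :=
  lin_pushT ϑ (f := b.toLinearMap) (g := (pushBase ϑ b).toLinearMap) (pushBase_inc ϑ b) f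

/-- Base change of a morphism along `𝒜 → ℬ`. -/
def RingedMap.push (Φ : RingedMap 𝒜 R X Y) : RingedMap ℬ R X Y where
  toFun := pushLin ϑ Φ.toFun
  base := pushBase ϑ Φ.base
  ev_base f := by rw [pushBase_inc, evT_pushT, Φ.ev_base]
  map_smul f x := by
    induction x using thick_induction with
    | hs a x hx => simp only [_root_.map_smul, hx]
    | ha x y hx hy => simp only [map_add, hx, hy]
    | hi x =>
      induction f using thick_induction with
      | hs a x hx => simp only [_root_.map_smul, LinearMap.smul_apply, hx]
      | ha x y hx hy => simp only [map_add, LinearMap.add_apply, hx, hy]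
      | hi f =>
        simp only [← pushT_inc ϑ, pushBase_pushT, pushLin_pushT, rsm_pushT]
        rw [Φ.map_smul]

theorem RingedMap.IsLieHom.push {Φ : RingedMap 𝒜 R X Y} {Q : RingedLA 𝒜 R X}
    {Q' : RingedLA 𝒜 R Y} (h : Φ.IsLieHom Q Q') :
    (Φ.push ϑ).IsLieHom (Q.push ϑ) (Q'.push ϑ) where
  map_bracket x y := by
    induction x using thick_induction with
    | hs a x hx => simp only [_root_.map_smul, LinearMap.smul_apply, hx]
    | ha x y hx hy => simp only [map_add, LinearMap.add_apply, hx, hy]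
    | hi x =>
      induction y using thick_induction with
      | hs a x hx => simp only [_root_.map_smul, hx]
      | ha x y hx hy => simp only [map_add, hx, hy]
      | hi y =>
        simp only [RingedMap.push, RingedLA.push, ← pushT_inc ϑ, pushBil_pushT, pushLin_pushT]
        rw [h.map_bracket]
  map_anchor x f := by
    induction x using thick_induction with
    | hs a x hx => simp only [_root_.map_smul, LinearMap.smul_apply, hx]
    | ha x y hx hy => simp only [map_add, LinearMap.add_apply, hx, hy]
    | hi x =>
      induction f using thick_induction with
      | hs a x hx => simp only [_root_.map_smul, hx]
      | ha x y hx hy => simp only [map_add, hx, hy]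
      | hi y =>
        simp only [RingedMap.push, RingedLA.push, ← pushT_inc ϑ, pushBase_pushT, pushLin_pushT,
          vf_pushT]
        rw [h.map_anchor]

theorem LieRinehart.cartesian_push (L : LieRinehart 𝕂 R X) :
    (L.cartesian 𝒜).push ϑ = L.cartesian ℬ := by
  refine RingedLA.ext ?_ ?_
  · refine bil_ext ℬ fun x y => ?_
    simp only [RingedLA.push, LieRinehart.cartesian, pushBil_inc, extBil_inc, pushT_inc]
  · refine lin_ext ℬ fun x => ?_
    simp only [RingedLA.push, LieRinehart.cartesian, pushLin_inc]
    simp [inc, pushT]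

theorem RingedMap.ext_inc {Φ Ψ : RingedMap 𝒜 R X Y}
    (h : ∀ x, Φ.toFun (inc 𝒜 x) = Ψ.toFun (inc 𝒜 x))
    (h' : ∀ f, Φ.base (inc 𝒜 f) = Ψ.base (inc 𝒜 f)) : Φ = Ψ := by
  refine RingedMap.ext (lin_ext 𝒜 h) (AlgHom.toLinearMap_injective (lin_ext 𝒜 h'))

theorem RingedLA.ext_inc {Φ Ψ : RingedLA 𝒜 R X}
    (h : ∀ x y, Φ.bracket (inc 𝒜 x) (inc 𝒜 y) = Ψ.bracket (inc 𝒜 x) (inc 𝒜 y))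
    (h' : ∀ x, Φ.anchor (inc 𝒜 x) = Ψ.anchor (inc 𝒜 x)) : Φ = Ψ :=
  RingedLA.ext (bil_ext 𝒜 h) (lin_ext 𝒜 h')

end Push

namespace Pair
variable {𝕂 : Type k} {R V : Type u} [Field 𝕂] [CommRing R] [Algebra 𝕂 R]
    [AddCommGroup V] [Module 𝕂 V] [Module R V] [IsScalarTower 𝕂 R V]

/-- An infinitesimal deformation of `(L, A)` over `𝒜`: an `𝒜`-ringed Lie algebroid structure on `A_𝒜`
with center the Lie algebroid `A`, and a morphism `incl : A_𝒜 → L⁰_𝒜` of `𝒜`-ringed Lie algebroids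
with center the inclusion `A → L`. -/
@[ext] structure InfDef (P : Pair 𝕂 R V) (𝒜 : ArtAlg.{k, v} 𝕂) where
  alg : RingedLA 𝒜 R P.sub
  ev_bracket : ∀ a b : P.sub,
    ((evT 𝒜 (alg.bracket (inc 𝒜 a) (inc 𝒜 b)) : P.sub) : V) = P.bracket a b
  ev_anchor : ∀ a : P.sub, evT 𝒜 (alg.anchor (inc 𝒜 a)) = P.anchor a
  incl : RingedMap 𝒜 R P.sub V
  isLieHom : incl.IsLieHom alg (P.cartesian 𝒜)
  ev_incl : ∀ a : P.sub, evT 𝒜 (incl.toFun (inc 𝒜 a)) = a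

variable {P : Pair 𝕂 R V}

/-- Weak isomorphism: there are a small automorphism `Φ` of `L⁰_𝒜`, that is an endomorphism with center
the identity, and a morphism `Ψ` from the `A_𝒜` of `D'` to that of `D` such that `Φ ∘ I' = I ∘ Ψ`. -/
def WeakIso {𝒜 : ArtAlg.{k, v} 𝕂} (D D' : P.InfDef 𝒜) : Prop :=
  ∃ Φ : RingedMap 𝒜 R V V, Φ.IsLieHom (P.cartesian 𝒜) (P.cartesian 𝒜) ∧
    (∀ u : V, evT 𝒜 (Φ.toFun (inc 𝒜 u)) = u) ∧
  ∃ Ψ : RingedMap 𝒜 R P.sub P.sub, Ψ.IsLieHom D'.alg D.alg ∧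
    Φ.toFun ∘ₗ D'.incl.toFun = D.incl.toFun ∘ₗ Ψ.toFun ∧
    Φ.base.comp D'.incl.base = D.incl.base.comp Ψ.base

variable {𝒜 ℬ 𝒞 : ArtAlg.{k, v} 𝕂} (ϑ : 𝒜 ⟶ ℬ)

/-- Base change of an infinitesimal deformation along `𝒜 → ℬ`. -/
def InfDef.push (D : P.InfDef 𝒜) : P.InfDef ℬ where
  alg := D.alg.push ϑ
  ev_bracket a b := by
    rw [← D.ev_bracket, RingedLA.push, pushBil_inc, evT_pushT]
  ev_anchor a := by
    rw [← D.ev_anchor, RingedLA.push, pushLin_inc, evT_pushT]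
  incl := D.incl.push ϑ
  isLieHom := by
    rw [← LieRinehart.cartesian_push ϑ]
    exact D.isLieHom.push ϑ
  ev_incl a := by
    rw [RingedMap.push, pushLin_inc, evT_pushT, D.ev_incl]

theorem WeakIso.push {D D' : P.InfDef 𝒜} (h : WeakIso D D') :
    WeakIso (D.push ϑ) (D'.push ϑ) := by
  obtain ⟨Φ, hΦ, hev, Ψ, hΨ, h1, h2⟩ := h
  refine ⟨Φ.push ϑ, ?_, fun u => ?_, Ψ.push ϑ, hΨ.push ϑ, ?_, ?_⟩
  · rw [← LieRinehart.cartesian_push ϑ]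
    exact hΦ.push ϑ
  · rw [RingedMap.push, pushLin_inc, evT_pushT, hev]
  · refine lin_ext ℬ fun a => ?_
    have := congrArg (pushT ϑ) (LinearMap.congr_fun h1 (inc 𝒜 a))
    simpa only [LinearMap.comp_apply, InfDef.push, RingedMap.push, pushLin_inc,
      pushLin_pushT] using this
  · refine AlgHom.toLinearMap_injective (lin_ext ℬ fun a => ?_)
    have := congrArg (pushT ϑ) (AlgHom.congr_fun h2 (inc 𝒜 a))
    simpa only [AlgHom.comp_apply, AlgHom.toLinearMap_apply, InfDef.push, RingedMap.push,
      pushBase_inc, pushBase_pushT] using this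

theorem InfDef.push_id (D : P.InfDef 𝒜) : D.push (𝟙 𝒜) = D := by
  refine InfDef.ext ?_ ?_
  · refine RingedLA.ext_inc (fun x y => ?_) (fun x => ?_)
    · simp only [InfDef.push, RingedLA.push, pushBil_inc, pushT_id]
    · simp only [InfDef.push, RingedLA.push, pushLin_inc, pushT_id]
  · refine RingedMap.ext_inc (fun x => ?_) (fun x => ?_)
    · simp only [InfDef.push, RingedMap.push, pushLin_inc, pushT_id]
    · simp only [InfDef.push, RingedMap.push, pushBase_inc, pushT_id]

theorem InfDef.push_comp (η : ℬ ⟶ 𝒞) (D : P.InfDef 𝒜) :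
    D.push (ϑ ≫ η) = (D.push ϑ).push η := by
  refine InfDef.ext ?_ ?_
  · refine RingedLA.ext_inc (fun x y => ?_) (fun x => ?_)
    · simp only [InfDef.push, RingedLA.push, pushBil_inc, pushT_comp]
    · simp only [InfDef.push, RingedLA.push, pushLin_inc, pushT_comp]
  · refine RingedMap.ext_inc (fun x => ?_) (fun x => ?_)
    · simp only [InfDef.push, RingedMap.push, pushLin_inc, pushT_comp]
    · simp only [InfDef.push, RingedMap.push, pushBase_inc, pushT_comp]

/-- The weak infinitesimal deformation functor: weak isomorphism classes of infinitesimal deformations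
of `(L, A)`, with base change along morphisms of parameter algebras. -/
def weakDef (P : Pair 𝕂 R V) : ArtAlg.{k, v} 𝕂 ⥤ Type (max u v) where
  obj 𝒜 := Quot fun D D' : P.InfDef 𝒜 => WeakIso D D'
  map ϑ := ↾ Quot.map (fun D => D.push ϑ) (fun _ _ h => WeakIso.push ϑ h)
  map_id 𝒜 := by
    ext x
    induction x using Quot.inductionOn with
    | h x => exact congrArg (Quot.mk _) (InfDef.push_id x)
  map_comp ϑ η := by
    ext x
    induction x using Quot.inductionOn with
    | h x => exact congrArg (Quot.mk _) (InfDef.push_comp ϑ η x)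

end Pair

section Geometry

variable (𝕂 : Type) [RCLike 𝕂]
  (E : Type*) [NormedAddCommGroup E] [NormedSpace ℝ E]
  (M : Type*) [TopologicalSpace M] [ChartedSpace E M]

/-- The algebra `C^∞(M, 𝕂)` of smooth functions. -/
def SmoothFun : Subalgebra 𝕂 (M → 𝕂) where
  carrier := {f | ContMDiff 𝓘(ℝ, E) 𝓘(ℝ, 𝕂) ∞ f}
  mul_mem' {_ _} hf hg :=
    (contDiff_mul (𝕜 := ℝ) (𝔸 := 𝕂)).contMDiff.comp (hf.prodMk_space hg)
  add_mem' {_ _} hf hg :=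
    (contDiff_add (𝕜 := ℝ) (F := 𝕂)).contMDiff.comp (hf.prodMk_space hg)
  algebraMap_mem' _ := contMDiff_const

variable {M}
variable [IsManifold 𝓘(ℝ, E) ∞ M]
  (F : Type*) [NormedAddCommGroup F] [NormedSpace ℝ F] [NormedSpace 𝕂 F]
  [IsScalarTower ℝ 𝕂 F]
  (L : M → Type*) [∀ x, AddCommGroup (L x)] [∀ x, Module ℝ (L x)] [∀ x, Module 𝕂 (L x)]
  [∀ x, IsScalarTower ℝ 𝕂 (L x)]
  [∀ x, TopologicalSpace (L x)] [TopologicalSpace (TotalSpace F L)] [FiberBundle F L]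
  [VectorBundle ℝ F L] [VectorBundle 𝕂 F L]

/-- The module `Γ(L)` of smooth sections of a `𝕂`-vector bundle. -/
def Sections : Submodule (SmoothFun 𝕂 E M) (∀ x, L x) where
  carrier := {s | ContMDiff 𝓘(ℝ, E) (𝓘(ℝ, E).prod 𝓘(ℝ, F)) ∞ (fun x => TotalSpace.mk' F x (s x))}
  zero_mem' := contMDiff_zeroSection ℝ L
  add_mem' {s t} hs ht := by
    intro x₀
    have hs := hs x₀
    have ht := ht x₀
    rw [contMDiffAt_section] at hs ht ⊢
    set e := trivializationAt F L x₀
    refine (hs.add ht).congr_of_eventuallyEq ?_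
    refine Filter.eventually_of_mem
      (e.open_baseSet.mem_nhds (FiberBundle.mem_baseSet_trivializationAt F L x₀)) ?_
    intro x hx
    exact (e.linear ℝ hx).map_add _ _
  smul_mem' f s hs := by
    intro x₀
    have hs := hs x₀
    have hf : ContMDiffAt 𝓘(ℝ, E) 𝓘(ℝ, 𝕂) ∞ (f : M → 𝕂) x₀ := f.2 x₀
    rw [contMDiffAt_section] at hs ⊢
    set e := trivializationAt F L x₀
    have h2 : ContMDiffAt 𝓘(ℝ, E) 𝓘(ℝ, F) ∞
        (fun x => (f : M → 𝕂) x • (e ⟨x, s x⟩).2) x₀ :=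
      ((contDiff_smul (𝕜 := ℝ) (𝕜' := 𝕂) (F := F)).contMDiff.contMDiffAt (x := _)).comp x₀ (hf.prodMk_space hs)
    refine h2.congr_of_eventuallyEq ?_
    refine Filter.eventually_of_mem
      (e.open_baseSet.mem_nhds (FiberBundle.mem_baseSet_trivializationAt F L x₀)) ?_
    intro x hx
    exact (e.linear 𝕂 hx).map_smul _ _

/-- The submodule of sections of `L` with values in `A`. -/
def subSections (A : ∀ x, Submodule 𝕂 (L x)) :
    Submodule (SmoothFun 𝕂 E M) (Sections 𝕂 E F L) where
  carrier := {s | ∀ x, s.1 x ∈ A x}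
  zero_mem' x := (A x).zero_mem
  add_mem' hs ht x := (A x).add_mem (hs x) (ht x)
  smul_mem' f _ hs x := (A x).smul_mem (f.1 x) (hs x)

/-- `A` is a smooth subbundle of `L`: around each point it is spanned by linearly independent smooth
sections. -/
def IsSubbundle (A : ∀ x, Submodule 𝕂 (L x)) : Prop :=
  ∀ x₀ : M, ∃ (r : ℕ) (s : Fin r → Sections 𝕂 E F L), ∀ᶠ x in 𝓝 x₀,
    LinearIndependent 𝕂 (fun i => (s i).1 x) ∧
      Submodule.span 𝕂 (Set.range fun i => (s i).1 x) = A x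

/-- A Lie pair `(L, A)`: a Lie algebroid structure on `L` and a Lie subalgebroid `A`, that is a smooth
subbundle whose sections are closed under the bracket. -/
structure LiePair extends LieRinehart 𝕂 (SmoothFun 𝕂 E M) (Sections 𝕂 E F L) where
  A : ∀ x, Submodule 𝕂 (L x)
  isSubbundle : IsSubbundle 𝕂 E F L A
  bracket_mem : ∀ u ∈ subSections 𝕂 E F L A, ∀ v ∈ subSections 𝕂 E F L A,
    bracket u v ∈ subSections 𝕂 E F L A

variable {𝕂 E F L}

/-- The Lie pair in terms of its sections. -/
def LiePair.toPair (P : LiePair 𝕂 E F L) :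
    Pair 𝕂 (SmoothFun 𝕂 E M) (Sections 𝕂 E F L) where
  toLieRinehart := P.toLieRinehart
  sub := subSections 𝕂 E F L P.A
  bracket_mem := P.bracket_mem

end Geometry

end LieDef

end

/-! Write p = j pr_B and q = pr_A for the two projections of Γ(L_𝒜). An element ξ of 𝔪 ⊗ Ω¹_A(B) is
the same thing as an 𝔪-valued, function-linear operator x = j ξ pr_A on Γ(L_𝒜) with x = p x q. Its
graph is the image of q + x, which is also the kernel of p - x. The theorem holds because both
functors classify such graphs, when closed under the bracket, up to small automorphisms of L⁰_𝒜.

Maurer–Cartan equation. The graph is closed under the bracket iff (p - x)[(q + x)u, (q + x)v] = 0.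
Since A is a subalgebroid the term p[qu, qv] vanishes, and the terms of degree 1, 2, 3 in x are
[ξ]₁, [ξ, ξ]₂ / 2! and [ξ, ξ, ξ]₃ / 3! (`isMC_iff`). So a Maurer–Cartan element makes its graph an
infinitesimal deformation (`graphDef`). Conversely, for any infinitesimal deformation with inclusion
I the map pr_A ∘ I is unipotent, hence invertible, so the image of I is a graph (`exists_graph`).

Gauge action. An element b = δ + X of 𝔪 ⊗ 𝔥⁰ enters the brackets only through the derivation D = δ +
[j X, -]. The recursion for the terms of e^b * ξ is the power series form of the Riccati equation y'
= (p - y) D (q + y), y(0) = x (`riccati_of_gauge_recursion`), and this equation describes how the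
linear flow of D moves a graph (`riccati_graph`). Hence exp D maps the graph of ξ to the graph of
e^b * ξ (`nilExp_mul_graph`).

Small automorphisms. They are unipotent, so they have nilpotent logarithms. A unipotent map
preserves a bilinear operation iff its logarithm is a derivation of it (`nilExp_bilin`,
`bilin_of_nilExp_bilin`). Applied to the product of functions, the module structure, the bracket and
the action of the anchor, this shows that the small automorphisms of L⁰_𝒜 are exactly the
exponentials of elements of 𝔪 ⊗ Der(L) (`expMap`, `exists_nilExp_thickDer_eq`). Gauge equivalence of
Maurer–Cartan elements is therefore weak isomorphism of their graphs.

Forming the graph commutes with base change (`graphDef_push`), so the bijections are natural. Only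
the algebra of functions, the modules of sections and the splitting enter. -/

noncomputable section

namespace LieDef

/-! ### Linear flows and the Riccati equation for graphs -/

section Riccati

variable {E : Type*} [Ring E]

/-- The formal derivative of a power series with coefficients in a possibly noncommutative ring. -/
def formalDeriv (f : PowerSeries E) : PowerSeries E :=
  PowerSeries.mk fun n => (n + 1) • PowerSeries.coeff (n + 1) f

theorem coeff_formalDeriv (f : PowerSeries E) (n : ℕ) :
    PowerSeries.coeff n (formalDeriv f) = (n + 1) • PowerSeries.coeff (n + 1) f := by
  simp [formalDeriv]

theorem formalDeriv_mul (f g : PowerSeries E) :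
    formalDeriv (f * g) = formalDeriv f * g + f * formalDeriv g := by
  ext n
  rw [map_add, coeff_formalDeriv]
  simp only [PowerSeries.coeff_mul, coeff_formalDeriv]
  have h1 : ∑ p ∈ Finset.HasAntidiagonal.antidiagonal (n + 1),
      p.1 • (PowerSeries.coeff p.1 f * PowerSeries.coeff p.2 g) =
      ∑ p ∈ Finset.HasAntidiagonal.antidiagonal n,
        ((p.1 + 1) • PowerSeries.coeff (p.1 + 1) f) * PowerSeries.coeff p.2 g := by
    rw [Finset.Nat.sum_antidiagonal_succ]
    simp only [zero_smul, add_zero, zero_add, smul_mul_assoc]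
  have h2 : ∑ p ∈ Finset.HasAntidiagonal.antidiagonal (n + 1),
      p.2 • (PowerSeries.coeff p.1 f * PowerSeries.coeff p.2 g) =
      ∑ p ∈ Finset.HasAntidiagonal.antidiagonal n,
        PowerSeries.coeff p.1 f * ((p.2 + 1) • PowerSeries.coeff (p.2 + 1) g) := by
    rw [Finset.Nat.sum_antidiagonal_succ']
    simp only [zero_smul, add_zero, zero_add, mul_smul_comm]
  rw [← h1, ← h2, ← Finset.sum_add_distrib, Finset.smul_sum]
  refine Finset.sum_congr rfl fun p hp => ?_
  rw [← add_smul, Finset.HasAntidiagonal.mem_antidiagonal.1 hp]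

theorem formalDeriv_sub (f g : PowerSeries E) :
    formalDeriv (f - g) = formalDeriv f - formalDeriv g := by
  ext n
  simp [coeff_formalDeriv, smul_sub]

theorem formalDeriv_C (a : E) : formalDeriv (PowerSeries.C a) = 0 := by
  ext n
  simp [coeff_formalDeriv, PowerSeries.coeff_C]

/-- A power series solution of a linear equation `h' = A h` vanishes if its constant term does. -/
theorem eq_zero_of_formalDeriv_eq_mul [IsAddTorsionFree E] {A h : PowerSeries E}
    (h0 : PowerSeries.coeff 0 h = 0) (hd : formalDeriv h = A * h) : h = 0 := by
  ext n
  induction n using Nat.strongRec with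
  | ind n ih =>
    cases n with
    | zero => simpa using h0
    | succ n =>
      have := congrArg (PowerSeries.coeff n) hd
      -- The coefficient of degree n of A h involves only coefficients of h of degree at most n,
      -- which vanish by induction; the factor n + 1 is then cancelled.
      rw [coeff_formalDeriv, PowerSeries.coeff_mul, Finset.sum_eq_zero] at this
      · rw [map_zero]
        exact (nsmul_eq_zero_iff_right (Nat.succ_ne_zero n)).1 this
      · intro p hp
        rw [ih p.2 (by have := Finset.HasAntidiagonal.mem_antidiagonal.1 hp; omega), map_zero, mul_zero]

/-- The Riccati equation `y' = p D q + p D y - y D q - y D y` describes the motion of the graph of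
`y` under the linear flow of `D`. -/
theorem riccati_graph [IsAddTorsionFree E] {p q D : E} (hpq : p + q = 1) {y g : ℕ → E}
    (hy : ∀ n, (n + 1) • y (n + 1) = (if n = 0 then p * D * q else 0) + p * D * y n
      - y n * D * q - ∑ kl ∈ Finset.HasAntidiagonal.antidiagonal n, y kl.1 * D * y kl.2)
    (hg : ∀ n, (n + 1) • g (n + 1) = D * g n) (h0 : p * g 0 = y 0 * g 0) (n : ℕ) :
    p * g n = ∑ kl ∈ Finset.HasAntidiagonal.antidiagonal n, y kl.1 * g kl.2 := by
  set Y := PowerSeries.mk y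
  set G := PowerSeries.mk g
  let C := PowerSeries.C (R := E)
  have hYD (B : E) (n : ℕ) : PowerSeries.coeff n (Y * C B) = y n * B := by
    simp [Y, C, PowerSeries.coeff_mul_C]
  -- The quadratic right-hand side factors as (p - Y) D (q + Y), which is what makes the defect
  -- below satisfy a linear equation.
  have dY : formalDeriv Y = (C p - Y) * C D * (C q + Y) := by
    ext n
    have : (C p - Y) * C D * (C q + Y) = C (p * D * q) + C (p * D) * Y - Y * C (D * q)
        - (Y * C D) * Y := by
      simp only [C, map_mul]
      noncomm_ring
    rw [this, coeff_formalDeriv]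
    have h1 : PowerSeries.coeff n (Y * C D * Y) =
        ∑ kl ∈ Finset.HasAntidiagonal.antidiagonal n, y kl.1 * D * y kl.2 := by
      rw [PowerSeries.coeff_mul]
      simp only [hYD, Y, PowerSeries.coeff_mk]
    have h2 : PowerSeries.coeff n (C (p * D) * Y) = p * D * y n := by
      simp only [C, Y, PowerSeries.coeff_C_mul, PowerSeries.coeff_mk]
    rw [map_sub, map_sub, map_add, h1, h2, hYD]
    simp only [C, Y, PowerSeries.coeff_mk, PowerSeries.coeff_C, hy, mul_assoc]
  have dG : formalDeriv G = C D * G := by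
    ext n
    simp [coeff_formalDeriv, G, C, hg, PowerSeries.coeff_C_mul]
  have hC : C p + C q = 1 := by rw [← map_add, hpq, map_one]
  have key : (C p - Y) * G = 0 := by
    -- The derivative of (p - Y) G is (p - Y) D (1 - q - Y) G = (p - Y) D · (p - Y) G, because p + q
    -- = 1.
    refine eq_zero_of_formalDeriv_eq_mul (A := (C p - Y) * C D) ?_ ?_
    · simp [PowerSeries.coeff_mul, Y, G, C, sub_mul, h0]
    · rw [formalDeriv_mul, formalDeriv_sub, formalDeriv_C, dY, dG]
      have : C q = 1 - C p := by rw [← hC]; abel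
      rw [this]
      noncomm_ring
  have := congrArg (PowerSeries.coeff n) key
  rw [sub_mul, map_sub, PowerSeries.coeff_C_mul, PowerSeries.coeff_mul, map_zero,
    sub_eq_zero] at this
  simpa [Y, G] using this

end Riccati

/-! ### Exponentials and logarithms of nilpotent elements -/

section Exponential

variable {𝕂 : Type*} [Field 𝕂] [CharZero 𝕂]

section
variable (𝕂) {E : Type*} [Ring E] [Algebra 𝕂 E]

/-- The exponential of a nilpotent element of an algebra over a field of characteristic zero. -/
def nilExp (D : E) : E := ∑ k ∈ Finset.range (nilpotencyClass D), (k ! : 𝕂)⁻¹ • D ^ k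

/-- Any exponent that kills D may bound the sum, so several operators can be expanded with a common
bound. -/
theorem nilExp_eq_sum {D : E} {K : ℕ} (h : D ^ K = 0) :
    nilExp 𝕂 D = ∑ k ∈ Finset.range K, (k ! : 𝕂)⁻¹ • D ^ k := by
  refine Finset.sum_subset (Finset.range_mono (csInf_le' h)) fun k _ hk => ?_
  rw [pow_eq_zero_of_le (not_lt.1 fun h => hk (Finset.mem_range.2 h))
    (pow_nilpotencyClass ⟨K, h⟩), smul_zero]

theorem nilExp_eq_exp [Module ℚ E] {D : E} (h : IsNilpotent D) : nilExp 𝕂 D = IsNilpotent.exp D := by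
  obtain ⟨K, hK⟩ := h
  rw [nilExp_eq_sum 𝕂 hK, IsNilpotent.exp_eq_sum hK]
  refine Finset.sum_congr rfl fun k _ => ?_
  have : ((k ! : 𝕂)⁻¹ : 𝕂) = (((k ! : ℚ)⁻¹ : ℚ) : 𝕂) := by push_cast; rfl
  rw [this, Rat.cast_smul_eq_qsmul]

/-- This provides the integer points of the one-parameter group of D. As both sides of later
identities are polynomial in n, integer points are enough to compare coefficients. -/
theorem nilExp_natCast_smul {D : E} (h : IsNilpotent D) (n : ℕ) :
    nilExp 𝕂 ((n : 𝕂) • D) = nilExp 𝕂 D ^ n := by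
  let _ : Module ℚ E := Module.compHom E (algebraMap ℚ 𝕂)
  induction n with
  | zero => simp [nilExp_eq_sum 𝕂 (pow_one (0 : E))]
  | succ n ih =>
    have hn : IsNilpotent ((n : 𝕂) • D) := h.smul _
    have hc : Commute ((n : 𝕂) • D) D := (Commute.refl D).smul_left _
    rw [Nat.cast_succ, add_smul, one_smul, pow_succ, ← ih, nilExp_eq_exp 𝕂 hn, nilExp_eq_exp 𝕂 h,
      nilExp_eq_exp 𝕂 (hc.isNilpotent_add hn h), IsNilpotent.exp_add_of_commute hc hn h]

/-- A polynomial with coefficients in a vector space which vanishes at all natural numbers is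
zero. -/
theorem eq_zero_of_sum_natCast_pow_smul {W : Type*} [AddCommGroup W] [Module 𝕂 W] {K : ℕ}
    {w : ℕ → W} (h : ∀ n : ℕ, ∑ k ∈ Finset.range K, (n : 𝕂) ^ k • w k = 0) {k : ℕ} (hk : k < K) :
    w k = 0 := by
  -- Linear forms separate vectors, which reduces the claim to a scalar polynomial with infinitely
  -- many roots, since the characteristic is zero.
  rw [← Module.forall_dual_apply_eq_zero_iff 𝕂]
  intro f
  let P : Polynomial 𝕂 := ∑ k ∈ Finset.range K, Polynomial.monomial k (f (w k))
  have hP : P = 0 := by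
    refine Polynomial.eq_zero_of_infinite_isRoot P ?_
    refine Set.Infinite.mono ?_ (Set.infinite_range_of_injective (Nat.cast_injective (R := 𝕂)))
    rintro _ ⟨n, rfl⟩
    have := congrArg f (h n)
    simp only [map_sum, map_smul, map_zero, smul_eq_mul] at this
    simp only [Set.mem_ofPred_eq, Polynomial.IsRoot, P, Polynomial.eval_finsetSum,
      Polynomial.eval_monomial]
    simpa only [mul_comm] using this
  have := congrArg (fun Q => Polynomial.coeff Q k) hP
  simpa [P, Polynomial.finsetSum_coeff, Polynomial.coeff_monomial, hk] using this

/-- Powers of a unipotent element depend polynomially on the exponent. -/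
theorem exists_one_add_pow_eq_sum {N : E} {K : ℕ} (hN : N ^ K = 0) :
    ∃ P : ℕ → E, (∀ k, ∃ s, P (k + 1) = N * s) ∧ (∀ k, K ≤ k → P k = 0) ∧
      ∀ n : ℕ, (1 + N) ^ n = ∑ k ∈ Finset.range K, (n : 𝕂) ^ k • P k := by
  -- The coefficient of n^k in the binomial coefficient `n.choose j`, viewed as a polynomial of
  -- degree j in n.
  let c (j k : ℕ) : 𝕂 := (j ! : 𝕂)⁻¹ * (descPochhammer 𝕂 j).coeff k
  have hc (j n : ℕ) (hj : j < K) : (n.choose j : 𝕂) = ∑ k ∈ Finset.range K, (n : 𝕂) ^ k * c j k := by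
    have h1 : (descPochhammer 𝕂 j).eval (n : 𝕂) = (j ! : 𝕂) * n.choose j := by
      rw [descPochhammer_eval_eq_descFactorial, Nat.descFactorial_eq_factorial_mul_choose]
      push_cast; rfl
    have hj0 : (j ! : 𝕂) ≠ 0 := Nat.cast_ne_zero.2 (Nat.factorial_ne_zero j)
    rw [Polynomial.eval_eq_sum_range' (n := K) (by rw [descPochhammer_natDegree]; exact hj)] at h1
    rw [eq_comm, mul_comm, ← eq_div_iff hj0] at h1
    rw [h1, Finset.sum_div]
    refine Finset.sum_congr rfl fun k _ => ?_
    simp only [c]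
    field_simp
  refine ⟨fun k => ∑ j ∈ Finset.range K, c j k • N ^ j, fun k => ?_, fun k hk => ?_, fun n => ?_⟩
  -- The summand j = 0 is the constant polynomial 1 and does not contribute in positive degree, so
  -- every remaining summand has a factor N.
  · refine ⟨∑ j ∈ Finset.range K, c j (k + 1) • N ^ (j - 1), ?_⟩
    rw [Finset.mul_sum]
    refine Finset.sum_congr rfl fun j _ => ?_
    cases j with
    | zero => simp [c, Polynomial.coeff_one]
    | succ j => rw [mul_smul_comm, Nat.add_sub_cancel, ← pow_succ']
  · refine Finset.sum_eq_zero fun j hj => ?_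
    rw [show c j k = 0 from ?_, zero_smul]
    rw [show c j k = (j ! : 𝕂)⁻¹ * (descPochhammer 𝕂 j).coeff k from rfl,
      Polynomial.coeff_eq_zero_of_natDegree_lt, mul_zero]
    rw [descPochhammer_natDegree]
    exact (Finset.mem_range.1 hj).trans_le hk
  · have h2 : (1 + N) ^ n = ∑ j ∈ Finset.range K, (n.choose j : 𝕂) • N ^ j := by
      rw [add_comm, (Commute.one_right N).add_pow]
      have h3 (m : ℕ) (f : ℕ → E) (hf : ∀ j, m ≤ j → f j = 0) (hm : m ≤ n + 1 + K) :
          ∑ j ∈ Finset.range m, f j = ∑ j ∈ Finset.range (n + 1 + K), f j :=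
        Finset.sum_subset (Finset.range_mono hm) fun j _ hj =>
          hf j (not_lt.1 fun h => hj (Finset.mem_range.2 h))
      rw [h3 (n + 1) _ (fun j hj => by simp [Nat.choose_eq_zero_of_lt (show n < j by omega)])
        (by omega), h3 K _ (fun j hj => by rw [pow_eq_zero_of_le hj hN, smul_zero]) (by omega)]
      refine Finset.sum_congr rfl fun j _ => ?_
      rw [one_pow, mul_one, Nat.cast_smul_eq_nsmul, nsmul_eq_mul, Nat.cast_comm]
    rw [h2]
    simp only [Finset.smul_sum]
    rw [Finset.sum_comm]
    refine Finset.sum_congr rfl fun j hj => ?_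
    rw [hc j n (Finset.mem_range.1 hj), Finset.sum_smul]
    refine Finset.sum_congr rfl fun k _ => ?_
    rw [mul_smul]

/-- A unipotent element is the exponential of a nilpotent one, its logarithm. -/
theorem exists_nilExp_eq {N : E} (hN : IsNilpotent N) :
    ∃ s : E, IsNilpotent (N * s) ∧ nilExp 𝕂 (N * s) = 1 + N := by
  obtain ⟨K, hK⟩ := hN
  -- The bound K + 2 ensures that the index 1, that of the logarithm, lies in the range of
  -- summation.
  have hK' : N ^ (K + 2) = 0 := pow_eq_zero_of_le (by omega) hK
  obtain ⟨P, hP, hP0, hpow⟩ := exists_one_add_pow_eq_sum 𝕂 hK'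
  -- The logarithm is P 1, the coefficient of n in (1 + N)^n. Its form N s keeps it in every right
  -- ideal containing N, in particular among the 𝔪-valued operators.
  obtain ⟨s, hs⟩ := hP 0
  rw [zero_add] at hs
  have h0 : P 0 = 1 := by
    have := hpow 0
    rw [Finset.sum_eq_single 0 (fun k _ hk => by simp [hk]) (by simp)] at this
    simpa using this.symm
  -- Comparison of the coefficients of m in (1 + N)^(m + n) = (1 + N)^m (1 + N)^n: the derivative of
  -- (1 + N)^n in n is P 1 · (1 + N)^n.
  have h1 (n : ℕ) : ∑ k ∈ Finset.range (K + 2), ((k : 𝕂) * (n : 𝕂) ^ (k - 1)) • P k =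
      P 1 * (1 + N) ^ n := by
    rw [← sub_eq_zero]
    have := eq_zero_of_sum_natCast_pow_smul (𝕂 := 𝕂) (K := K + 2) (k := 1)
      (w := fun i => (∑ k ∈ Finset.range (K + 2), ((k.choose i : 𝕂) * (n : 𝕂) ^ (k - i)) • P k) -
        P i * (1 + N) ^ n) (fun m => ?_) (by omega)
    · simpa using this
    · have h2 := pow_add (1 + N) m n
      rw [hpow (m + n), hpow m, ← sub_eq_zero] at h2
      rw [← h2]
      simp only [smul_sub, Finset.sum_sub_distrib, Finset.sum_mul, Finset.smul_sum,
        smul_mul_assoc]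
      rw [Finset.sum_comm]
      congr 1
      refine Finset.sum_congr rfl fun k hk => ?_
      simp only [smul_smul]
      rw [← Finset.sum_smul, Nat.cast_add, add_pow]
      congr 1
      symm
      refine Finset.sum_subset_zero_on_sdiff (Finset.range_mono (Finset.mem_range.1 hk))
        (fun i hi => ?_) (fun i _ => by ring)
      have : k < i := by simpa using (Finset.mem_sdiff.1 hi).2
      simp [Nat.choose_eq_zero_of_lt this]
  -- The same identity compared in degree k in n gives the recursion of the exponential series.
  have h3 (k : ℕ) : ((k : 𝕂) + 1) • P (k + 1) = P 1 * P k := by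
    by_cases hk : k < K + 2
    · rw [← sub_eq_zero]
      refine eq_zero_of_sum_natCast_pow_smul (𝕂 := 𝕂) (K := K + 2)
        (w := fun k => ((k : 𝕂) + 1) • P (k + 1) - P 1 * P k) (fun n => ?_) hk
      have h4 := h1 n
      rw [hpow n, Finset.sum_range_succ', ← sub_eq_zero] at h4
      rw [← h4, Finset.sum_congr rfl fun k _ => smul_sub _ _ _, Finset.sum_sub_distrib,
        Finset.sum_range_succ, hP0 (K + 1 + 1) le_rfl, Finset.mul_sum]
      simp [smul_smul, mul_comm]
    · rw [hP0 k (by omega), hP0 (k + 1) (by omega), mul_zero, smul_zero]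
  have h4 (k : ℕ) : P k = (k ! : 𝕂)⁻¹ • P 1 ^ k := by
    induction k with
    | zero => simp [h0]
    | succ k ih =>
      have h5 : ((k : 𝕂) + 1) ≠ 0 := Nat.cast_add_one_ne_zero k
      have h6 := h3 k
      rw [ih, mul_smul_comm, ← pow_succ'] at h6
      rw [← inv_smul_smul₀ h5 (P (k + 1)), h6, smul_smul, Nat.factorial_succ]
      push_cast
      rw [mul_inv]
  -- P vanishes from K + 2 on, and P (K + 2) is a nonzero multiple of this power.
  have h5 : P 1 ^ (K + 2) = 0 := by
    have h6 := h4 (K + 2)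
    rw [hP0 _ le_rfl, eq_comm] at h6
    exact (smul_eq_zero.1 h6).resolve_left
      (inv_ne_zero (Nat.cast_ne_zero.2 (Nat.factorial_ne_zero _)))
  refine ⟨s, ⟨K + 2, hs ▸ h5⟩, ?_⟩
  rw [← hs, nilExp_eq_sum 𝕂 h5]
  have := hpow 1
  simp only [pow_one, Nat.cast_one, one_pow, one_smul] at this
  rw [this]
  exact Finset.sum_congr rfl fun k _ => (h4 k).symm

end

section
variable {A U V W : Type*} [CommRing A] [Algebra 𝕂 A]
  [AddCommGroup U] [Module A U] [Module 𝕂 U] [IsScalarTower 𝕂 A U]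
  [AddCommGroup V] [Module A V] [Module 𝕂 V] [IsScalarTower 𝕂 A V]
  [AddCommGroup W] [Module A W] [Module 𝕂 W] [IsScalarTower 𝕂 A W]

/-- Exponentials of derivations of a bilinear operation preserve the operation. -/
theorem nilExp_bilin {DU : Module.End A U} {DV : Module.End A V} {DW : Module.End A W}
    (hU : IsNilpotent DU) (hV : IsNilpotent DV) (hW : IsNilpotent DW) (m : U →ₗ[A] V →ₗ[A] W)
    (h : ∀ u v, DW (m u v) = m (DU u) v + m u (DV v)) (u : U) (v : V) :
    nilExp 𝕂 DW (m u v) = m (nilExp 𝕂 DU u) (nilExp 𝕂 DV v) := by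
  let _ : Module ℚ U := Module.compHom U (algebraMap ℚ 𝕂)
  let _ : Module ℚ V := Module.compHom V (algebraMap ℚ 𝕂)
  let _ : Module ℚ W := Module.compHom W (algebraMap ℚ 𝕂)
  rw [nilExp_eq_exp 𝕂 hU, nilExp_eq_exp 𝕂 hV, nilExp_eq_exp 𝕂 hW]
  -- The Leibniz rule says that the map U ⊗ V → W induced by m intertwines DU ⊗ 1 + 1 ⊗ DV with DW.
  -- The two summands commute, so the exponential of their sum is the product exp DU ⊗ exp DV.
  let D1 : Module.End A (U ⊗[A] V) := DU.rTensor V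
  let D2 : Module.End A (U ⊗[A] V) := DV.lTensor U
  have h1 : IsNilpotent D1 := hU.map (Module.End.rTensorAlgHom A U V)
  have h2 : IsNilpotent D2 := hV.map (Module.End.lTensorAlgHom A V U)
  have hc : Commute D1 D2 := by
    refine TensorProduct.ext' fun x y => ?_
    simp [D1, D2]
  have e1 : IsNilpotent.exp D1 = (IsNilpotent.exp DU).rTensor V :=
    (hU.map_exp (Module.End.rTensorAlgHom A U V)).symm
  have e2 : IsNilpotent.exp D2 = (IsNilpotent.exp DV).lTensor U :=
    (hV.map_exp (Module.End.lTensorAlgHom A V U)).symm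
  have key := Module.End.commute_exp_left_of_commute (g := TensorProduct.lift m)
    (hc.isNilpotent_add h1 h2) hW (by
      refine TensorProduct.ext' fun x y => ?_
      simp [D1, D2, h])
  have := LinearMap.congr_fun key (u ⊗ₜ v)
  rw [IsNilpotent.exp_add_of_commute hc h1 h2, e1, e2] at this
  simpa using this

theorem nilExp_natCast_smul_apply (𝕂 : Type*) [Field 𝕂] [CharZero 𝕂] [Algebra 𝕂 A] [Module 𝕂 U]
    [IsScalarTower 𝕂 A U] {D : Module.End A U} {K : ℕ} (hD : D ^ K = 0) (n : ℕ) (x : U) :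
    nilExp 𝕂 ((n : 𝕂) • D) x =
      ∑ k ∈ Finset.range K, (n : 𝕂) ^ k • (k ! : 𝕂)⁻¹ • (D ^ k) x := by
  rw [nilExp_eq_sum 𝕂 (K := K) (by rw [smul_pow, hD, smul_zero])]
  simp [LinearMap.sum_apply, smul_pow, smul_comm ((n : 𝕂) ^ _)]

/-- If unipotent maps preserve a bilinear operation, then their logarithms are derivations of it. -/
theorem bilin_of_nilExp_bilin {DU : Module.End A U} {DV : Module.End A V} {DW : Module.End A W}
    (hU : IsNilpotent DU) (hV : IsNilpotent DV) (hW : IsNilpotent DW) (m : U →ₗ[A] V →ₗ[A] W)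
    (h : ∀ u v, nilExp 𝕂 DW (m u v) = m (nilExp 𝕂 DU u) (nilExp 𝕂 DV v)) (u : U) (v : V) :
    DW (m u v) = m (DU u) v + m u (DV v) := by
  obtain ⟨K, hU', hV', hW'⟩ : ∃ K, DU ^ (K + 2) = 0 ∧ DV ^ (K + 2) = 0 ∧ DW ^ (K + 2) = 0 := by
    obtain ⟨a, ha⟩ := hU
    obtain ⟨b, hb⟩ := hV
    obtain ⟨c, hc⟩ := hW
    exact ⟨a + b + c, pow_eq_zero_of_le (by omega) ha, pow_eq_zero_of_le (by omega) hb,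
      pow_eq_zero_of_le (by omega) hc⟩
  -- Iterating the hypothesis gives invariance under the exponentials of all natural multiples.
  have hn (n : ℕ) : nilExp 𝕂 ((n : 𝕂) • DW) (m u v) =
      m (nilExp 𝕂 ((n : 𝕂) • DU) u) (nilExp 𝕂 ((n : 𝕂) • DV) v) := by
    rw [nilExp_natCast_smul 𝕂 hU, nilExp_natCast_smul 𝕂 hV, nilExp_natCast_smul 𝕂 hW]
    induction n with
    | zero => simp
    | succ n ih => simp only [pow_succ', Module.End.mul_apply, ih, h]
  let F (ij : ℕ × ℕ) : W := ((ij.1 ! : 𝕂)⁻¹ * (ij.2 ! : 𝕂)⁻¹) • m ((DU ^ ij.1) u) ((DV ^ ij.2) v)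
  let I := Finset.range (K + 2) ×ˢ Finset.range (K + 2)
  -- Both sides are polynomials in n; the coefficient of n is the Leibniz rule. On the right-hand
  -- side the degree i + j is at most 2 (K + 1), which explains the bound 2 K + 4.
  have key := eq_zero_of_sum_natCast_pow_smul (𝕂 := 𝕂) (K := 2 * K + 4) (k := 1)
    (w := fun k => (if k < K + 2 then (k ! : 𝕂)⁻¹ • (DW ^ k) (m u v) else 0) -
      ∑ ij ∈ I with ij.1 + ij.2 = k, F ij) (fun n => ?_) (by omega)
  · have hI : ({ij ∈ I | ij.1 + ij.2 = 1} : Finset (ℕ × ℕ)) = {(0, 1), (1, 0)} := by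
      ext ⟨i, j⟩
      simp only [I, Finset.mem_filter, Finset.mem_product, Finset.mem_range, Finset.mem_insert,
        Finset.mem_singleton, Prod.mk.injEq]
      omega
    rw [hI, Finset.sum_pair (by simp)] at key
    simp only [F] at key
    simp at key
    rw [sub_eq_zero] at key
    rw [key, add_comm]
  · have h1 := hn n
    rw [nilExp_natCast_smul_apply 𝕂 hU', nilExp_natCast_smul_apply 𝕂 hV',
      nilExp_natCast_smul_apply 𝕂 hW'] at h1
    rw [← sub_eq_zero] at h1
    refine Eq.trans ?_ h1
    simp only [smul_sub, Finset.sum_sub_distrib]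
    congr 1
    · symm
      refine Finset.sum_subset_zero_on_sdiff (Finset.range_mono (by omega)) (fun k hk => ?_)
        (fun k hk => ?_)
      · rw [if_neg (by simpa using (Finset.mem_sdiff.1 hk).2), smul_zero]
      · rw [if_pos (Finset.mem_range.1 hk)]
    · have h2 : ∑ k ∈ Finset.range (2 * K + 4), ∑ ij ∈ I with ij.1 + ij.2 = k,
          (n : 𝕂) ^ (ij.1 + ij.2) • F ij = ∑ ij ∈ I, (n : 𝕂) ^ (ij.1 + ij.2) • F ij := by
        refine Finset.sum_fiberwise_of_maps_to (fun ij hij => ?_) _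
        have := Finset.mem_product.1 hij
        simp only [Finset.mem_range] at this ⊢
        omega
      have h3 : ∑ k ∈ Finset.range (2 * K + 4), (n : 𝕂) ^ k • ∑ ij ∈ I with ij.1 + ij.2 = k, F ij =
          ∑ ij ∈ I, (n : 𝕂) ^ (ij.1 + ij.2) • F ij := by
        rw [← h2]
        refine Finset.sum_congr rfl fun k _ => ?_
        rw [Finset.smul_sum]
        refine Finset.sum_congr rfl fun ij hij => ?_
        rw [(Finset.mem_filter.1 hij).2]
      rw [h3, Finset.sum_product, Finset.sum_comm]
      simp only [map_sum, LinearMap.sum_apply]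
      refine Finset.sum_congr rfl fun i _ => Finset.sum_congr rfl fun j _ => ?_
      simp only [F, LinearMap.map_smul_of_tower, LinearMap.smul_apply, smul_smul]
      congr 1
      ring

end

end Exponential
end LieDef
end

noncomputable section

namespace LieDef

/-! ### Operators filtered by the powers of an ideal -/

section Filtration

variable {A M : Type*} [CommRing A] [AddCommGroup M] [Module A M] (I : Ideal A)

/-- The endomorphisms with values in `I ^ k • M`. -/
def endFil (M : Type*) [AddCommGroup M] [Module A M] (k : ℕ) : Submodule A (Module.End A M) where
  carrier := {f | ∀ v, f v ∈ I ^ k • (⊤ : Submodule A M)}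
  zero_mem' _ := Submodule.zero_mem _
  add_mem' hf hg v := Submodule.add_mem _ (hf v) (hg v)
  smul_mem' a _ hf v := Submodule.smul_mem _ a (hf v)

variable {I}

theorem mem_endFil_zero (f : Module.End A M) : f ∈ endFil I M 0 := fun v => by simp

theorem mul_mem_endFil {k l : ℕ} {f g : Module.End A M} (hf : f ∈ endFil I M k)
    (hg : g ∈ endFil I M l) : f * g ∈ endFil I M (k + l) := by
  intro v
  -- By linearity f maps I^l M to I^l f(M), and f(M) lies in I^k M.
  have h : Submodule.map f (I ^ l • (⊤ : Submodule A M)) ≤ I ^ (k + l) • (⊤ : Submodule A M) := by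
    rw [Submodule.map_smul'', add_comm, pow_add, mul_smul]
    refine Submodule.smul_mono le_rfl ?_
    rintro _ ⟨x, -, rfl⟩
    exact hf x
  exact h ⟨g v, hg v, rfl⟩

theorem mul_left_mem_endFil {k : ℕ} (f : Module.End A M) {g : Module.End A M}
    (hg : g ∈ endFil I M k) : f * g ∈ endFil I M k := by
  simpa using mul_mem_endFil (mem_endFil_zero f) hg

theorem mul_right_mem_endFil {k : ℕ} {f : Module.End A M} (hf : f ∈ endFil I M k)
    (g : Module.End A M) : f * g ∈ endFil I M k := by
  simpa using mul_mem_endFil hf (mem_endFil_zero g)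

theorem eq_zero_of_mem_endFil {n : ℕ} (hI : I ^ n = ⊥) {k : ℕ} (hk : n ≤ k) {f : Module.End A M}
    (hf : f ∈ endFil I M k) : f = 0 := by
  have h : I ^ k = ⊥ := pow_eq_zero_of_le hk hI
  ext v
  simpa [h] using hf v

theorem pow_mem_endFil {f : Module.End A M} (hf : f ∈ endFil I M 1) (n : ℕ) :
    f ^ n ∈ endFil I M n := by
  induction n with
  | zero => exact mem_endFil_zero _
  | succ n ih => exact pow_succ f n ▸ mul_mem_endFil ih hf

theorem isNilpotent_of_mem_endFil {n : ℕ} (hI : I ^ n = ⊥) {f : Module.End A M}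
    (hf : f ∈ endFil I M 1) : IsNilpotent f :=
  ⟨n, eq_zero_of_mem_endFil hI le_rfl (pow_mem_endFil hf n)⟩

end Filtration

/-! ### The maximal ideal of a local Artinian algebra -/

namespace ArtAlg

variable {𝕂 : Type k} [Field 𝕂] (𝒜 : ArtAlg.{k, v} 𝕂)

theorem exists_max_pow_eq_bot : ∃ n, 𝒜.max ^ n = ⊥ := by
  have h := IsArtinianRing.isNilpotent_jacobson_bot (R := 𝒜)
  rwa [IsLocalRing.jacobson_eq_maximalIdeal _ bot_ne_top] at h

/-- The nilpotent part `a - ev a` of an element. -/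
def nilPart : 𝒜 →ₗ[𝕂] 𝒜.max where
  toFun a := ⟨a - algebraMap 𝕂 𝒜 (𝒜.ev a), by
    rw [← ev_eq_zero_iff, map_sub, AlgHom.commutes]; exact sub_self _⟩
  map_add' a b := Subtype.ext (by simp; ring)
  map_smul' c a := Subtype.ext (by simp [Algebra.smul_def, mul_sub])

theorem coe_nilPart (a : 𝒜) : (𝒜.nilPart a : 𝒜) = a - algebraMap 𝕂 𝒜 (𝒜.ev a) := rfl

theorem ev_max (a : 𝒜.max) : 𝒜.ev (a : 𝒜) = 0 := (ev_eq_zero_iff _).2 a.2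

/-- The powers of 𝔪 form a finite filtration by finitely generated ideals, and on each quotient 𝔪ⁿ /
𝔪ⁿ⁺¹ the algebra 𝒜 acts through its residue field 𝕂. Finiteness is needed in order to expand
elements of 𝔪 ⊗ G in a finite basis of 𝔪. -/
instance finite : Module.Finite 𝕂 𝒜 := by
  have key (n : ℕ) : ∃ s : Finset 𝒜, ∀ a : 𝒜, ∃ b ∈ Submodule.span 𝕂 (s : Set 𝒜),
      a - b ∈ 𝒜.max ^ n := by
    induction n with
    | zero => exact ⟨∅, fun a => ⟨0, zero_mem _, by simp⟩⟩
    | succ n ih =>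
      classical
      obtain ⟨s, hs⟩ := ih
      obtain ⟨t, ht⟩ := IsNoetherian.noetherian (𝒜.max ^ n)
      refine ⟨s ∪ t, fun a => ?_⟩
      obtain ⟨b, hb, hab⟩ := hs a
      have h2 (c : 𝒜) (hc : c ∈ 𝒜.max ^ n) :
          ∃ d ∈ Submodule.span 𝕂 (t : Set 𝒜), c - d ∈ 𝒜.max ^ (n + 1) := by
        rw [← ht] at hc
        induction hc using Submodule.span_induction with
        | mem x hx => exact ⟨x, Submodule.subset_span hx, by simp⟩
        | zero => exact ⟨0, zero_mem _, by simp⟩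
        | add x y _ _ hx hy =>
          obtain ⟨d, hd, hxd⟩ := hx
          obtain ⟨e, he, hye⟩ := hy
          exact ⟨d + e, add_mem hd he, by rw [add_sub_add_comm]; exact add_mem hxd hye⟩
        | smul r x hx ih =>
          obtain ⟨d, hd, hxd⟩ := ih
          -- Modulo the next power of 𝔪 the scalar r may be replaced by its value in 𝕂.
          refine ⟨𝒜.ev r • d, Submodule.smul_mem _ _ hd, ?_⟩
          have h3 : r • x - 𝒜.ev r • d = (𝒜.nilPart r : 𝒜) * x + 𝒜.ev r • (x - d) := by
            rw [coe_nilPart, smul_eq_mul, Algebra.smul_def, Algebra.smul_def]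
            ring
          rw [h3]
          have hx' : x ∈ 𝒜.max ^ n := ht ▸ hx
          refine add_mem ?_ (Submodule.smul_of_tower_mem _ _ hxd)
          rw [pow_succ']
          exact Ideal.mul_mem_mul (𝒜.nilPart r).2 hx'
      obtain ⟨d, hd, h3⟩ := h2 _ hab
      refine ⟨b + d, add_mem (Submodule.span_mono (by simp) hb)
        (Submodule.span_mono (by simp) hd), by rwa [← sub_sub]⟩
  obtain ⟨n, hn⟩ := 𝒜.exists_max_pow_eq_bot
  obtain ⟨s, hs⟩ := key n
  refine ⟨⟨s, eq_top_iff.2 fun a _ => ?_⟩⟩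
  obtain ⟨b, hb, hab⟩ := hs a
  rw [hn, Ideal.mem_bot, sub_eq_zero] at hab
  exact hab ▸ hb

/-- The inclusion of the maximal ideal. -/
def maxIncl : 𝒜.max →ₗ[𝕂] 𝒜 := (Submodule.subtype 𝒜.max).restrictScalars 𝕂

theorem maxIncl_apply (a : 𝒜.max) : 𝒜.maxIncl a = a := rfl

instance finite_max : Module.Finite 𝕂 𝒜.max :=
  Module.Finite.of_injective 𝒜.maxIncl Subtype.val_injective

end ArtAlg

/-! ### Operators on X ⊗ 𝒜 with coefficients in 𝔪 -/

section Thick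

variable {𝕂 : Type k} [Field 𝕂] {𝒜 ℬ : ArtAlg.{k, v} 𝕂}
  {G H X Y Z : Type*} [AddCommGroup X] [Module 𝕂 X] [AddCommGroup Y] [Module 𝕂 Y]
  [AddCommGroup Z] [Module 𝕂 Z] [AddCommGroup G] [Module 𝕂 G] [AddCommGroup H] [Module 𝕂 H]

theorem tmul_eq_smul_inc (a : 𝒜) (x : X) : a ⊗ₜ[𝕂] x = a • inc 𝒜 x := by
  simp [inc, TensorProduct.smul_tmul']

theorem evT_tmul (a : 𝒜) (x : X) : evT 𝒜 (a ⊗ₜ[𝕂] x) = 𝒜.ev a • x := by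
  simp [evT]

theorem evT_lTensor (f : X →ₗ[𝕂] Y) (x : Thick 𝒜 X) :
    evT 𝒜 (f.lTensor 𝒜 x) = f (evT 𝒜 x) := by
  induction x using TensorProduct.induction_on with
  | zero => simp
  | add x y hx hy => simp only [map_add, hx, hy]
  | tmul a x => simp [evT_tmul]

theorem sub_inc_evT_mem (x : Thick 𝒜 X) :
    x - inc 𝒜 (evT 𝒜 x) ∈ 𝒜.max • (⊤ : Submodule 𝒜 (Thick 𝒜 X)) := by
  induction x using TensorProduct.induction_on with
  | zero => simp
  | add x y hx hy =>
    rw [map_add, map_add, add_sub_add_comm]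
    exact add_mem hx hy
  | tmul a x =>
    have : a ⊗ₜ[𝕂] x - inc 𝒜 (evT 𝒜 (a ⊗ₜ[𝕂] x)) = (𝒜.nilPart a : 𝒜) • inc 𝒜 x := by
      rw [evT_tmul, ArtAlg.coe_nilPart, ← tmul_eq_smul_inc, TensorProduct.sub_tmul, map_smul,
        tmul_eq_smul_inc (algebraMap 𝕂 𝒜 _), algebraMap_smul]
    rw [this]
    exact Submodule.smul_mem_smul (𝒜.nilPart a).2 trivial

theorem evT_eq_zero_iff (x : Thick 𝒜 X) :
    evT 𝒜 x = 0 ↔ x ∈ 𝒜.max • (⊤ : Submodule 𝒜 (Thick 𝒜 X)) := by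
  constructor
  · intro h
    simpa [h] using sub_inc_evT_mem x
  · intro h
    induction h using Submodule.smul_induction_on' with
    | smul a ha y _ => rw [evT_smul, (ArtAlg.ev_eq_zero_iff a).2 ha, zero_smul]
    | add x _ y _ hx hy => rw [map_add, hx, hy, add_zero]

/-- Having center zero is the same as having values in 𝔪, because the kernel of the evaluation is 𝔪
· (X ⊗ 𝒜). This is the source of all nilpotency below: small automorphisms differ from the identity
by such operators. -/
theorem mem_endFil_one_iff (f : Module.End 𝒜 (Thick 𝒜 X)) :
    f ∈ endFil 𝒜.max (Thick 𝒜 X) 1 ↔ ∀ x, evT 𝒜 (f (inc 𝒜 x)) = 0 := by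
  constructor
  · intro h x
    rw [evT_eq_zero_iff]
    simpa using h (inc 𝒜 x)
  · intro h v
    rw [pow_one, ← evT_eq_zero_iff]
    induction v using thick_induction with
    | hi x => exact h x
    | hs a x hx => rw [map_smul, evT_smul, hx, smul_zero]
    | ha x y hx hy => rw [map_add, map_add, hx, hy, add_zero]

/-- The operators `a ⊗ g ↦ a • τ g` on `X ⊗ 𝒜` for a linear family `τ` of maps. -/
def ten (𝒜 : ArtAlg.{k, v} 𝕂) (τ : G →ₗ[𝕂] X →ₗ[𝕂] Y) :
    𝒜.max ⊗[𝕂] G →ₗ[𝕂] (Thick 𝒜 X →ₗ[𝒜] Thick 𝒜 Y) :=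
  TensorProduct.lift (LinearMap.mk₂ 𝕂 (fun a g => (a : 𝒜) • (τ g).baseChange 𝒜)
    (fun a b g => by simp [add_smul])
    (fun c a g => by simp)
    (fun a g h => by simp [LinearMap.baseChange_add])
    (fun c a g => by rw [map_smul, LinearMap.baseChange_smul, smul_comm]))

theorem ten_tmul (τ : G →ₗ[𝕂] X →ₗ[𝕂] Y) (a : 𝒜.max) (g : G) :
    ten 𝒜 τ (a ⊗ₜ g) = (a : 𝒜) • (τ g).baseChange 𝒜 := rfl

theorem baseChange_inc (f : X →ₗ[𝕂] Y) (x : X) : f.baseChange 𝒜 (inc 𝒜 x) = inc 𝒜 (f x) := by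
  simp [inc]

theorem ten_inc (τ : G →ₗ[𝕂] X →ₗ[𝕂] Y) (t : 𝒜.max ⊗[𝕂] G) (x : X) :
    ten 𝒜 τ t (inc 𝒜 x) = 𝒜.maxIncl.rTensor Y ((τ.flip x).lTensor 𝒜.max t) := by
  induction t with
  | zero => simp
  | add s t hs ht => simp only [map_add, LinearMap.add_apply, hs, ht]
  | tmul a g =>
    rw [ten_tmul, LinearMap.smul_apply, baseChange_inc, ← tmul_eq_smul_inc]
    simp [ArtAlg.maxIncl_apply]

theorem evT_ten_inc (τ : G →ₗ[𝕂] X →ₗ[𝕂] Y) (t : 𝒜.max ⊗[𝕂] G) (x : X) :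
    evT 𝒜 (ten 𝒜 τ t (inc 𝒜 x)) = 0 := by
  induction t with
  | zero => simp
  | add s t hs ht => simp only [map_add, LinearMap.add_apply, hs, ht, add_zero]
  | tmul a g =>
    rw [ten_tmul, LinearMap.smul_apply, evT_smul, ArtAlg.ev_max, zero_smul]

theorem ten_mem_endFil (τ : G →ₗ[𝕂] X →ₗ[𝕂] X) (t : 𝒜.max ⊗[𝕂] G) :
    ten 𝒜 τ t ∈ endFil 𝒜.max (Thick 𝒜 X) 1 :=
  (mem_endFil_one_iff _).2 (evT_ten_inc τ t)

/-- The bilinear operations `a ⊗ g ↦ a • τ g` on thick modules. -/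
def ten₂ (𝒜 : ArtAlg.{k, v} 𝕂) (τ : G →ₗ[𝕂] X →ₗ[𝕂] Y →ₗ[𝕂] Z) :
    𝒜.max ⊗[𝕂] G →ₗ[𝕂] (Thick 𝒜 X →ₗ[𝒜] Thick 𝒜 Y →ₗ[𝒜] Thick 𝒜 Z) :=
  TensorProduct.lift (LinearMap.mk₂ 𝕂 (fun a g => (a : 𝒜) • extBil 𝒜 (τ g))
    (fun a b g => by simp [add_smul])
    (fun c a g => by simp)
    (fun a g h => by
      rw [← smul_add]
      refine congrArg _ (bil_ext 𝒜 fun x y => ?_)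
      simp [extBil_inc])
    (fun c a g => by
      rw [smul_comm]
      refine congrArg _ (bil_ext 𝒜 fun x y => ?_)
      simp [extBil_inc]))

theorem ten₂_tmul (τ : G →ₗ[𝕂] X →ₗ[𝕂] Y →ₗ[𝕂] Z) (a : 𝒜.max) (g : G) :
    ten₂ 𝒜 τ (a ⊗ₜ g) = (a : 𝒜) • extBil 𝒜 (τ g) := rfl

theorem ten₂_inc (τ : G →ₗ[𝕂] X →ₗ[𝕂] Y →ₗ[𝕂] Z) (t : 𝒜.max ⊗[𝕂] G) (x : X) (y : Y) :
    ten₂ 𝒜 τ t (inc 𝒜 x) (inc 𝒜 y) =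
      𝒜.maxIncl.rTensor Z (((LinearMap.applyₗ y) ∘ₗ τ.flip x).lTensor 𝒜.max t) := by
  induction t with
  | zero => simp
  | add s t hs ht => simp only [map_add, LinearMap.add_apply, hs, ht]
  | tmul a g =>
    rw [ten₂_tmul, LinearMap.smul_apply, LinearMap.smul_apply, extBil_inc, ← tmul_eq_smul_inc]
    simp [ArtAlg.maxIncl_apply]

/-- Elements of `𝔪 ⊗ G` are separated by a jointly injective family of linear maps on `G`. -/
theorem eq_zero_of_forall_lTensor {ι : Type*} (f : ι → G →ₗ[𝕂] Y)
    (hf : ∀ g, (∀ i, f i g = 0) → g = 0) (t : 𝒜.max ⊗[𝕂] G)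
    (h : ∀ i, 𝒜.maxIncl.rTensor Y ((f i).lTensor 𝒜.max t) = 0) : t = 0 := by
  let b := Module.finBasis 𝕂 𝒜.max
  have h' (i) : (f i).lTensor 𝒜.max t = 0 := by
    -- Over a field Y is flat, so that 𝔪 ⊗ Y embeds in 𝒜 ⊗ Y.
    have hi : Function.Injective (𝒜.maxIncl.rTensor Y) :=
      Module.Flat.rTensor_preserves_injective_linearMap _ Subtype.val_injective
    exact hi (by rw [h i, map_zero])
  -- Coordinates with respect to a basis of 𝔪 commute with f i, so each coordinate of t in G is
  -- killed by the whole family.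
  have hc (i) (j) (s : 𝒜.max ⊗[𝕂] G) : TensorProduct.equivFinsuppOfBasisLeft b ((f i).lTensor 𝒜.max s) j =
      f i (TensorProduct.equivFinsuppOfBasisLeft b s j) := by
    induction s with
    | zero => simp
    | add s t hs ht => simp only [map_add, Finsupp.add_apply, hs, ht]
    | tmul a g => simp [TensorProduct.equivFinsuppOfBasisLeft_apply_tmul_apply]
  apply (TensorProduct.equivFinsuppOfBasisLeft b).injective
  rw [map_zero]
  ext j
  refine hf _ fun i => ?_
  rw [← hc, h', map_zero]
  rfl

/-- The evaluations of τ at the points of X separate elements of G, hence also elements of 𝔪 ⊗ G.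
This allows identities between forms to be checked on the associated operators. -/
theorem ten_injective {τ : G →ₗ[𝕂] X →ₗ[𝕂] Y} (hτ : Function.Injective τ) :
    Function.Injective (ten 𝒜 τ) := by
  rw [injective_iff_map_eq_zero]
  intro t ht
  refine eq_zero_of_forall_lTensor (fun x => τ.flip x) (fun g hg => hτ ?_) t fun x => ?_
  · rw [map_zero]
    exact LinearMap.ext hg
  · rw [← ten_inc, ht]
    rfl

theorem ten₂_injective {τ : G →ₗ[𝕂] X →ₗ[𝕂] Y →ₗ[𝕂] Z} (hτ : Function.Injective τ) :
    Function.Injective (ten₂ 𝒜 τ) := by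
  rw [injective_iff_map_eq_zero]
  intro t ht
  refine eq_zero_of_forall_lTensor (fun x : X × Y => (LinearMap.applyₗ x.2) ∘ₗ τ.flip x.1)
    (fun g hg => hτ ?_) t fun x => ?_
  · rw [map_zero]
    exact LinearMap.ext fun x => LinearMap.ext fun y => hg (x, y)
  · rw [← ten₂_inc, ht]
    rfl

theorem pushT_ten (ϑ : 𝒜 ⟶ ℬ) (τ : G →ₗ[𝕂] X →ₗ[𝕂] Y) (t : 𝒜.max ⊗[𝕂] G) (x : Thick 𝒜 X) :
    ten ℬ τ (push ϑ G t) (pushT ϑ x) = pushT ϑ (ten 𝒜 τ t x) := by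
  refine lin_pushT ϑ (fun x => ?_) x
  induction t with
  | zero => simp
  | add s t hs ht => simp only [map_add, LinearMap.add_apply, hs, ht]
  | tmul a g =>
    simp only [push, LinearMap.rTensor_tmul, ten_tmul, LinearMap.smul_apply, baseChange_inc,
      pushT_smul, pushT_inc]
    rfl

/-- The coordinate `Y ⊗ 𝒜 → Y` given by a linear form on the maximal ideal. -/
def coord (c : 𝒜.max →ₗ[𝕂] 𝕂) : Thick 𝒜 Y →ₗ[𝕂] Y :=
  (TensorProduct.lid 𝕂 Y).toLinearMap ∘ₗ (c ∘ₗ 𝒜.nilPart).rTensor Y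

theorem coord_tmul (c : 𝒜.max →ₗ[𝕂] 𝕂) (a : 𝒜) (y : Y) :
    coord c (a ⊗ₜ[𝕂] y) = c (𝒜.nilPart a) • y := by
  simp [coord]

theorem coord_baseChange (c : 𝒜.max →ₗ[𝕂] 𝕂) (f : X →ₗ[𝕂] Y) (x : Thick 𝒜 X) :
    coord c (f.baseChange 𝒜 x) = f (coord c x) := by
  induction x using TensorProduct.induction_on with
  | zero => simp
  | add x y hx hy => simp only [map_add, hx, hy]
  | tmul a x => simp [coord_tmul]

theorem coord_extBil_left (c : 𝒜.max →ₗ[𝕂] 𝕂) (f : X →ₗ[𝕂] Y →ₗ[𝕂] Z) (x : X) (y : Thick 𝒜 Y) :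
    coord c (extBil 𝒜 f (inc 𝒜 x) y) = f x (coord c y) := by
  have : extBil 𝒜 f (inc 𝒜 x) = (f x).baseChange 𝒜 :=
    lin_ext 𝒜 fun y => by rw [extBil_inc, baseChange_inc]
  rw [this, coord_baseChange]

theorem coord_extBil_right (c : 𝒜.max →ₗ[𝕂] 𝕂) (f : X →ₗ[𝕂] Y →ₗ[𝕂] Z) (x : Thick 𝒜 X) (y : Y) :
    coord c (extBil 𝒜 f x (inc 𝒜 y)) = f (coord c x) y := by
  have : (extBil 𝒜 f).flip (inc 𝒜 y) = (f.flip y).baseChange 𝒜 :=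
    lin_ext 𝒜 fun x => by rw [LinearMap.flip_apply, extBil_inc, baseChange_inc]; rfl
  rw [← LinearMap.flip_apply (f := extBil 𝒜 f), this, coord_baseChange]
  rfl

/-- An element with zero center is 𝔪-valued, so it is recovered from its coordinates in a basis of
𝔪. Statements on thick operators thereby reduce to statements over 𝕂, one coordinate at a time. -/
theorem eq_sum_coord {ι : Type*} [Fintype ι] (b : Module.Basis ι 𝕂 𝒜.max) {y : Thick 𝒜 Y}
    (hy : evT 𝒜 y = 0) : y = ∑ i, (b i : 𝒜) • inc 𝒜 (coord (b.coord i) y) := by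
  have key (y : Thick 𝒜 Y) :
      y - inc 𝒜 (evT 𝒜 y) = ∑ i, (b i : 𝒜) • inc 𝒜 (coord (b.coord i) y) := by
    induction y using TensorProduct.induction_on with
    | zero => simp
    | add x y hx hy =>
      simp only [map_add, smul_add, Finset.sum_add_distrib, ← hx, ← hy]
      abel
    | tmul a y =>
      have h1 : (𝒜.nilPart a : 𝒜) = ∑ i, b.coord i (𝒜.nilPart a) • (b i : 𝒜) := by
        conv_lhs => rw [← b.sum_repr (𝒜.nilPart a)]
        rw [← 𝒜.maxIncl_apply, map_sum]
        rfl
      have h2 : a ⊗ₜ[𝕂] y - inc 𝒜 (evT 𝒜 (a ⊗ₜ[𝕂] y)) = (𝒜.nilPart a : 𝒜) • inc 𝒜 y := by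
        rw [evT_tmul, ArtAlg.coe_nilPart, ← tmul_eq_smul_inc, TensorProduct.sub_tmul, map_smul,
        tmul_eq_smul_inc (algebraMap 𝕂 𝒜 _), algebraMap_smul]
      rw [h2, h1, Finset.sum_smul]
      refine Finset.sum_congr rfl fun i _ => ?_
      rw [coord_tmul, map_smul, smul_assoc, smul_comm]
  rw [← key, hy, map_zero, sub_zero]

/-- A map with zero center is of the form `ten τ t` if all its coordinates are. -/
theorem exists_ten_eq (τ : G →ₗ[𝕂] X →ₗ[𝕂] Y) (f : Thick 𝒜 X →ₗ[𝒜] Thick 𝒜 Y)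
    (hf : ∀ x, evT 𝒜 (f (inc 𝒜 x)) = 0)
    (h : ∀ c : 𝒜.max →ₗ[𝕂] 𝕂, ∃ g, ∀ x, τ g x = coord c (f (inc 𝒜 x))) :
    ∃ t, ten 𝒜 τ t = f := by
  let b := Module.finBasis 𝕂 𝒜.max
  choose g hg using h
  refine ⟨∑ i, b i ⊗ₜ g (b.coord i), lin_ext 𝒜 fun x => ?_⟩
  rw [map_sum, LinearMap.sum_apply, eq_sum_coord b (hf x)]
  refine Finset.sum_congr rfl fun i _ => ?_
  rw [ten_tmul, LinearMap.smul_apply, baseChange_inc, hg]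

end Thick

end LieDef
end

noncomputable section

namespace LieDef

/-! ### The brackets of 𝔥 in degrees 0, 1 and 2 -/

namespace Pair

section ShuffleSums

variable {𝕂 R A N : Type*} [Field 𝕂] [CommRing R] [Algebra 𝕂 R] [AddCommGroup A] [Module R A]
  [AddCommGroup N] [Module R N] [Module 𝕂 N] [IsScalarTower 𝕂 R N]

theorem shuffleSum_one_zero (m : MultilinearMap R (fun _ : Fin 1 ⊕ Fin 0 => A) N)
    (a : Fin 1 → A) : shuffleSum 𝕂 m a = m (fun _ => a 0) := by
  have : Subsingleton (Equiv.Perm (Fin 1 ⊕ Fin 0)) :=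
    (Equiv.sumEmpty _ _ : Fin 1 ⊕ Fin 0 ≃ Fin 1).permCongr.subsingleton
  rw [shuffleSum_apply, Fintype.sum_subsingleton _ 1]
  simp
  congr 1
  funext i
  exact congrArg a (Subsingleton.elim _ _)

theorem shuffleSum_zero_one (m : MultilinearMap R (fun _ : Fin 0 ⊕ Fin 1 => A) N)
    (a : Fin 1 → A) : shuffleSum 𝕂 (p := 0) (q := 1) m a = m (fun _ => a 0) := by
  have : Subsingleton (Equiv.Perm (Fin 0 ⊕ Fin 1)) :=
    (Equiv.emptySum _ _ : Fin 0 ⊕ Fin 1 ≃ Fin 1).permCongr.subsingleton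
  rw [shuffleSum_apply, Fintype.sum_subsingleton _ 1]
  simp
  congr 1
  funext i
  exact congrArg a (Subsingleton.elim (α := Fin 1) _ _)

theorem shuffleSum_one_one (m : MultilinearMap R (fun _ : Fin 1 ⊕ Fin 1 => A) N)
    (a : Fin 2 → A) : shuffleSum 𝕂 (p := 1) (q := 1) m a =
      m (Sum.elim (fun _ => a 0) (fun _ => a 1)) - m (Sum.elim (fun _ => a 1) (fun _ => a 0)) := by
  have h : (Finset.univ : Finset (Equiv.Perm (Fin 1 ⊕ Fin 1))) =
      {1, Equiv.swap (Sum.inl 0) (Sum.inr 0)} := by decide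
  rw [shuffleSum_apply, h, Finset.sum_pair (by decide), sub_eq_add_neg]
  rw [Equiv.Perm.sign_swap (by simp)]
  simp only [Nat.factorial_one, Nat.cast_one, mul_one, inv_one, one_smul, Equiv.Perm.sign_one,
    Units.neg_smul]
  congr 2
  · funext i
    rcases i with i | i <;> rw [Subsingleton.elim i 0] <;> rfl
  · congr 1
    funext i
    rcases i with i | i <;> rw [Subsingleton.elim i 0] <;> rfl

/-- The two permutations of the first block contribute equally by skew-symmetry, and their number
cancels 1 / 2!. The arguments z and w range over the one-point set of empty tuples; they are kept
separate so that no identification of empty tuples is required. -/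
theorem shuffleSum_two_zero [CharZero 𝕂] (m : MultilinearMap R (fun _ : Fin 2 ⊕ Fin 0 => A) N)
    (h : ∀ x y z w, m (Sum.elim ![x, y] z) = - m (Sum.elim ![y, x] w))
    (a : Fin 2 → A) : shuffleSum 𝕂 (p := 2) (q := 0) m a =
      m (Sum.elim ![a 0, a 1] Fin.elim0) := by
  have hu : (Finset.univ : Finset (Equiv.Perm (Fin 2 ⊕ Fin 0))) =
      {1, Equiv.swap (Sum.inl 0) (Sum.inl 1)} := by decide
  rw [shuffleSum_apply, hu, Finset.sum_pair (by decide), Equiv.Perm.sign_swap (by simp)]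
  have h1 : (fun i => a (finSumFinEquiv ((1 : Equiv.Perm (Fin 2 ⊕ Fin 0)) i))) =
      Sum.elim ![a 0, a 1] Fin.elim0 := by
    funext i
    rcases i with i | i
    · fin_cases i <;> rfl
    · exact i.elim0
  have h2 : (fun i => a (finSumFinEquiv (Equiv.swap (Sum.inl 0) (Sum.inl 1) i :
      Fin 2 ⊕ Fin 0))) = Sum.elim ![a 1, a 0] Fin.elim0 := by
    funext i
    rcases i with i | i
    · fin_cases i <;> rfl
    · exact i.elim0
  rw [h1, h2, h (a 1) (a 0) _ Fin.elim0]
  simp only [Nat.factorial_two, Nat.factorial_zero, Equiv.Perm.sign_one, one_smul, Units.neg_smul,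
    neg_neg, ← two_smul 𝕂]
  simp [smul_smul]

end ShuffleSums

variable {𝕂 : Type k} {R V : Type u} [Field 𝕂] [CommRing R] [Algebra 𝕂 R]
  [AddCommGroup V] [Module 𝕂 V] [Module R V] [IsScalarTower 𝕂 R V] {P : Pair 𝕂 R V}

/-- The derivation `[v, -]`. -/
def innerDer (P : Pair 𝕂 R V) : V →ₗ[𝕂] P.Der where
  toFun v := ⟨(P.bracket v, P.anchor v), fun f u => by rw [P.leibniz],
    fun u => (P.anchor_bracket v u).symm, fun u w => P.jacobi v u w⟩
  map_add' v w := by ext1; simp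
  map_smul' c v := by
    ext1
    refine Prod.ext (map_smul P.bracket c v) ?_
    change P.anchor (c • v) = c • P.anchor v
    rw [← algebraMap_smul R c v, map_smul, algebraMap_smul]

variable (S : P.Splitting)

/-- The value of forms at a tuple of arguments. -/
def evalForm {p : ℕ} (u : Fin p → P.sub) : Form P p →ₗ[𝕂] V ⧸ P.sub where
  toFun X := X u
  map_add' _ _ := rfl
  map_smul' _ _ := rfl

variable (S : P.Splitting)

/-- The derivation `δ + [j X, -]` for an element `δ + X` of degree `0`. -/
def totalDer : P.Ext 0 →ₗ[𝕂] P.Der :=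
  P.derOf 0 + P.innerDer ∘ₗ (S.toFun.restrictScalars 𝕂) ∘ₗ evalForm 0 ∘ₗ P.formOf 0

/-- The operator of a derivation. -/
def derOp (P : Pair 𝕂 R V) : P.Der →ₗ[𝕂] V →ₗ[𝕂] V := LinearMap.fst 𝕂 _ _ ∘ₗ P.Der.subtype

theorem totalDer_apply (b : P.Ext 0) (v : V) : derOp P (totalDer S b) v =
    (P.derOf 0 b).1.1 v + P.bracket (S.toFun (P.formOf 0 b 0)) v := rfl

/-- The linear map of a form of degree `1`. -/
def toLin (X : Form P 1) : P.sub →ₗ[R] V ⧸ P.sub :=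
  (AlternatingMap.ofSubsingleton R P.sub (V ⧸ P.sub) (0 : Fin 1)).symm X

theorem toLin_apply (X : Form P 1) (a : P.sub) : toLin X a = X fun _ => a := by
  simp [toLin]

theorem apply_eq_toLin (X : Form P 1) (u : Fin 1 → P.sub) : X u = toLin X (u 0) := by
  rw [toLin_apply]
  congr 1
  funext i
  rw [Subsingleton.elim i 0]

theorem slotSum_one (X : Form P 1) (D : P.sub → P.sub) (u : Fin 1 → P.sub) :
    slotSum X D u = toLin X (D (u 0)) := by
  simp [slotSum, apply_eq_toLin]

theorem slotSum_zero (X : Form P 0) (D : P.sub → P.sub) (u : Fin 0 → P.sub) :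
    slotSum X D u = 0 := by
  simp [slotSum]

theorem castForm_apply {p q : ℕ} (h : p = q) (X : Form P p) (u : Fin q → P.sub) :
    castForm (𝕂 := 𝕂) p q X u = X (fun i => u (finCongr h i)) := by
  subst h
  rw [castForm_self]
  rfl

theorem c2_one_zero (X : Form P 1) (Y : Form P 0) (u : Fin 1 → P.sub) :
    c2 S 1 0 X Y u = - (P.prB (P.bracket (S.toFun (Y 0)) (S.toFun (toLin X (u 0))))
      - toLin X (prA S (P.bracket (S.toFun (Y 0)) (u 0)))) := by
  change shuffleSum 𝕂 (c2Mul S X Y) u = _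
  rw [shuffleSum_one_zero]
  simp only [c2Mul, biMul, MultilinearMap.coe_mk, c2Fun, slotSum_one, slotSum_zero,
    apply_eq_toLin X, Function.comp_apply, Subsingleton.elim (_ ∘ _ : Fin 0 → P.sub) 0]
  rw [P.bracket_skew, map_neg]
  simp only [adA, LinearMap.comp_apply, LinearMap.restrictScalars_apply, Submodule.subtype_apply]
  abel

theorem c2_zero_one (X : Form P 1) (Y : Form P 0) (u : Fin 1 → P.sub) :
    c2 S 0 1 Y X u = P.prB (P.bracket (S.toFun (Y 0)) (S.toFun (toLin X (u 0))))
      - toLin X (prA S (P.bracket (S.toFun (Y 0)) (u 0))) := by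
  change shuffleSum 𝕂 (c2Mul S Y X) u = _
  rw [shuffleSum_zero_one]
  simp only [c2Mul, biMul, MultilinearMap.coe_mk, c2Fun, slotSum_one, slotSum_zero,
    apply_eq_toLin X, Function.comp_apply, Subsingleton.elim (_ ∘ _ : Fin 0 → P.sub) 0]
  simp only [adA, LinearMap.comp_apply, LinearMap.restrictScalars_apply, Submodule.subtype_apply]
  abel

theorem act_one (d : P.Der) (X : Form P 1) (u : Fin 1 → P.sub) :
    act S 1 d X u = P.prB (d.1.1 (S.toFun (toLin X (u 0)))) - toLin X (prA S (d.1.1 (u 0))) := by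
  change P.prB (d.1.1 (S.toFun (X u))) - slotSum X (derA S d) u = _
  rw [slotSum_one, apply_eq_toLin]
  rfl

/-- The linear map of an element of degree `1`. -/
def extLin (x : P.Ext 1) : P.sub →ₗ[R] V ⧸ P.sub := toLin (P.formOf 1 x)

/-- The values of an element of degree `2`. -/
def extBilin (x : P.Ext 2) (a b : P.sub) : V ⧸ P.sub := P.formOf 2 x ![a, b]

/-- The operator `j ∘ X ∘ Pr_A` of a form of degree `1`. -/
def formOp : P.Ext 1 →ₗ[𝕂] V →ₗ[𝕂] V :=
  LinearMap.mk₂ 𝕂 (fun X v => S.toFun (extLin X (prA S v)))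
    (fun X Y v => by rw [← map_add]; rfl)
    (fun c X v => by rw [← LinearMap.map_smul_of_tower]; rfl)
    (fun X v w => by simp only [map_add])
    (fun c X v => by simp only [LinearMap.map_smul_of_tower])

theorem formOp_apply (X : P.Ext 1) (v : V) : formOp S X v = S.toFun (extLin X (prA S v)) := rfl

variable {S}

theorem formOf_apply (x : P.Ext 1) (u : Fin 1 → P.sub) : P.formOf 1 x u = extLin x (u 0) :=
  apply_eq_toLin _ _

/-- The terms of δ and of X in b = δ + X have the same shape, with δ and [j X, -] in the same place,
so only their sum `totalDer` remains. The same holds for every bracket containing one element of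
degree 0 and otherwise elements of degree 1. -/
theorem h2_one_zero (x : P.Ext 1) (b : P.Ext 0) (a : P.sub) :
    extLin (h2 S 1 0 1 x b) a = - (P.prB (derOp P (totalDer S b) (S.toFun (extLin x a)))
      - extLin x (prA S (derOp P (totalDer S b) a))) := by
  refine (toLin_apply _ _).trans ?_
  change (castForm (1 + 0) 1 (c2 S 1 0 (P.formOf 1 x) (P.formOf 0 b)) +
      castForm 0 1 (act S 0 0 (P.formOf 0 b)) - castForm 1 1 (act S 1 (P.derOf 0 b) (P.formOf 1 x)) +
      (0 : Form P 1) : Form P 1) (fun _ => a) = _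
  simp only [map_zero, LinearMap.zero_apply, add_zero, AlternatingMap.sub_apply, castForm_self,
    castForm_apply (show 1 + 0 = 1 from rfl), c2_one_zero, act_one, totalDer_apply, map_add]
  rw [act_one]
  simp only [extLin]
  abel

theorem h2_zero_one (x : P.Ext 1) (b : P.Ext 0) (a : P.sub) :
    extLin (h2 S 0 1 1 b x) a = P.prB (derOp P (totalDer S b) (S.toFun (extLin x a)))
      - extLin x (prA S (derOp P (totalDer S b) a)) := by
  refine (toLin_apply _ _).trans ?_
  change (castForm (0 + 1) 1 (c2 S 0 1 (P.formOf 0 b) (P.formOf 1 x)) +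
      castForm 1 1 (act S 1 (P.derOf 0 b) (P.formOf 1 x)) - castForm 0 1 (act S 0 0 (P.formOf 0 b)) +
      (0 : Form P 1) : Form P 1) (fun _ => a) = _
  simp only [map_zero, LinearMap.zero_apply, add_zero, sub_zero, AlternatingMap.add_apply,
    castForm_self, castForm_apply (show 0 + 1 = 1 from rfl), c2_zero_one, act_one, totalDer_apply,
    map_add]
  rw [act_one]
  simp only [extLin]
  abel

/-- On the Γ(B)-component the Bott derivative is pr_B [a, j X] = -pr_B [j X, a], which has the sign
of [δ]₁ = -pr_B δ. -/
theorem h1_zero [CharZero 𝕂] (b : P.Ext 0) (a : P.sub) :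
    extLin (h1 S 0 b) a = - P.prB (derOp P (totalDer S b) a) := by
  refine (toLin_apply _ _).trans ?_
  change (c1 S 0 (P.formOf 0 b) + castForm 1 1 (kappa (P.derOf 0 b)) : Form P 1) (fun _ => a) = _
  rw [castForm_self, AlternatingMap.add_apply]
  have h1 : kappa (P.derOf 0 b) (fun _ => a) = - P.prB ((P.derOf 0 b).1.1 a) := rfl
  have h2 : c1 S 0 (P.formOf 0 b) (fun _ => a) =
      (0 ! : 𝕂)⁻¹ • MultilinearMap.alternatization (c1Mul S (P.formOf 0 b)) (fun _ => a) := rfl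
  have : Subsingleton (Equiv.Perm (Fin (0 + 1))) :=
    inferInstanceAs (Subsingleton (Equiv.Perm (Fin 1)))
  rw [h1, h2, MultilinearMap.alternatization_apply, Fintype.sum_subsingleton _ 1]
  have h3 : c1Fun S (P.formOf 0 b) (fun _ => a) =
      - P.prB (P.bracket (S.toFun (P.formOf 0 b 0)) a) := by
    rw [c1Fun, slotSum_zero, smul_zero, sub_zero, P.bracket_skew, map_neg,
      Subsingleton.elim (Fin.tail _) 0]
  have h4 : MultilinearMap.domDomCongr (1 : Equiv.Perm (Fin (0 + 1))) (c1Mul S (P.formOf 0 b)) (fun _ => a) =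
    c1Fun S (P.formOf 0 b) (fun _ => a) := rfl
  rw [h4, h3, totalDer_apply, map_add]
  simp

variable (S)

theorem ins_one {n : ℕ} (hn : n = 1) (Z : Form P 1) (K : FormA P n) (a : P.sub) :
    ins (𝕂 := 𝕂) n 1 Z K (fun _ => a) = toLin Z (K fun _ => a) := by
  subst hn
  refine (shuffleSum_one_zero (𝕂 := 𝕂) _ _).trans ?_
  simp only [biMul, MultilinearMap.coe_mk, AlternatingMap.curryLeft_apply_apply, apply_eq_toLin Z]
  rfl

theorem wedge_one_zero (X : Form P 1) (Y : Form P 0) (a : P.sub) :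
    wedge S 1 0 X Y (fun _ => a) =
      - prA S (P.bracket (S.toFun (Y 0)) (S.toFun (toLin X a))) := by
  refine (shuffleSum_one_zero (𝕂 := 𝕂) _ _).trans ?_
  simp only [biMul, MultilinearMap.coe_mk, apply_eq_toLin X, Function.comp_apply,
    Subsingleton.elim (_ ∘ _ : Fin 0 → P.sub) 0]
  rw [curv, LinearMap.mk₂_apply, P.bracket_skew, map_neg]

theorem wedge_zero_one (X : Form P 1) (Y : Form P 0) (a : P.sub) :
    wedge S 0 1 Y X (fun _ => a) = prA S (P.bracket (S.toFun (Y 0)) (S.toFun (toLin X a))) := by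
  refine (shuffleSum_zero_one (𝕂 := 𝕂) _ _).trans ?_
  simp only [biMul, MultilinearMap.coe_mk, apply_eq_toLin X, Function.comp_apply,
    Subsingleton.elim (_ ∘ _ : Fin 0 → P.sub) 0]
  rw [curv, LinearMap.mk₂_apply]

theorem d3_one_one (d : P.Der) (X Y : Form P 1) (a : P.sub) :
    d3 S 1 1 d X Y (fun _ => a) = toLin Y (prA S (d.1.1 (S.toFun (toLin X a)))) +
      toLin X (prA S (d.1.1 (S.toFun (toLin Y a)))) := by
  have h : d3 S 1 1 d X Y (fun _ => a) =
      (-1 : 𝕂) ^ (1 + 1) • ins 1 1 Y (derForm S 1 d X) (fun _ => a) +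
      (-1 : 𝕂) ^ (1 * (1 + 1)) • ins 1 1 X (derForm S 1 d Y) (fun _ => a) := rfl
  have h' (X : Form P 1) : derForm S 1 d X (fun _ => a) =
    prA S (d.1.1 (S.toFun (X fun _ => a))) := rfl
  rw [h, ins_one rfl, ins_one rfl, h', h', ← toLin_apply, ← toLin_apply]
  simp

variable {S}

theorem h3_one_one_zero (x y : P.Ext 1) (b : P.Ext 0) (a : P.sub) :
    extLin (h3 S 1 1 0 1 x y b) a =
      extLin x (prA S (derOp P (totalDer S b) (S.toFun (extLin y a)))) +
      extLin y (prA S (derOp P (totalDer S b) (S.toFun (extLin x a)))) := by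
  refine (toLin_apply _ _).trans ?_
  -- The first summand inserts into a form of degree 0 and vanishes. The next two contain pr_A [j X,
  -- -], and together with the last one, which contains pr_A δ, they form `totalDer`; elements of
  -- degree 1 have no Der(L)-component.
  change ((-1 : 𝕂) ^ (1 + 1 + 1) • (0 : Form P 1) (fun _ => a) +
      (-1 : 𝕂) ^ (1 * (1 + 0)) • (-1 : 𝕂) ^ (1 + 0 + 1) •
        ins (1 + 0) 1 (P.formOf 1 x) (wedge S 1 0 (P.formOf 1 y) (P.formOf 0 b)) (fun _ => a) +
      (-1 : 𝕂) ^ (0 * (1 + 1)) • (-1 : 𝕂) ^ (0 + 1 + 1) •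
        ins (0 + 1) 1 (P.formOf 1 y) (wedge S 0 1 (P.formOf 0 b) (P.formOf 1 x)) (fun _ => a)) +
      castForm 0 1 (d3 S 1 0 0 (P.formOf 1 y) (P.formOf 0 b)) (fun _ => a) -
      castForm 0 1 (d3 S 1 0 0 (P.formOf 1 x) (P.formOf 0 b)) (fun _ => a) +
      d3 S 1 1 (P.derOf 0 b) (P.formOf 1 x) (P.formOf 1 y) (fun _ => a) = _
  rw [ins_one rfl, ins_one rfl, wedge_one_zero, wedge_zero_one, d3_one_one]
  simp only [map_zero, LinearMap.zero_apply, AlternatingMap.zero_apply, totalDer_apply, map_add,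
    map_neg]
  simp [extLin]
  abel

theorem h3_zero_one_one (b : P.Ext 0) (x y : P.Ext 1) (a : P.sub) :
    extLin (h3 S 0 1 1 1 b x y) a =
      extLin x (prA S (derOp P (totalDer S b) (S.toFun (extLin y a)))) +
      extLin y (prA S (derOp P (totalDer S b) (S.toFun (extLin x a)))) := by
  refine (toLin_apply _ _).trans ?_
  change ((-1 : 𝕂) ^ (0 + 1 + 1) • ins (0 + 1) 1 (P.formOf 1 y) (wedge S 0 1 (P.formOf 0 b) (P.formOf 1 x)) (fun _ => a) +
      (-1 : 𝕂) ^ (0 * (1 + 1)) • (-1 : 𝕂) ^ (1 + 1 + 1) • (0 : Form P 1) (fun _ => a) +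
      (-1 : 𝕂) ^ (1 * (0 + 1)) • (-1 : 𝕂) ^ (1 + 0 + 1) •
        ins (1 + 0) 1 (P.formOf 1 x) (wedge S 1 0 (P.formOf 1 y) (P.formOf 0 b)) (fun _ => a)) +
      d3 S 1 1 (P.derOf 0 b) (P.formOf 1 x) (P.formOf 1 y) (fun _ => a) -
      castForm 0 1 (d3 S 0 1 0 (P.formOf 0 b) (P.formOf 1 y)) (fun _ => a) +
      castForm 0 1 (d3 S 0 1 0 (P.formOf 0 b) (P.formOf 1 x)) (fun _ => a) = _
  rw [ins_one rfl, ins_one rfl, wedge_one_zero, wedge_zero_one, d3_one_one]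
  simp only [map_zero, LinearMap.zero_apply, AlternatingMap.zero_apply, totalDer_apply, map_add,
    map_neg]
  simp [extLin]
  abel

theorem h3_one_zero_one (x : P.Ext 1) (b : P.Ext 0) (y : P.Ext 1) (a : P.sub) :
    extLin (h3 S 1 0 1 1 x b y) a =
      - (extLin x (prA S (derOp P (totalDer S b) (S.toFun (extLin y a)))) +
      extLin y (prA S (derOp P (totalDer S b) (S.toFun (extLin x a))))) := by
  refine (toLin_apply _ _).trans ?_
  change ((-1 : 𝕂) ^ (1 + 0 + 1) • ins (1 + 0) 1 (P.formOf 1 y) (wedge S 1 0 (P.formOf 1 x) (P.formOf 0 b)) (fun _ => a) +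
      (-1 : 𝕂) ^ (1 * (0 + 1)) • (-1 : 𝕂) ^ (0 + 1 + 1) •
        ins (0 + 1) 1 (P.formOf 1 x) (wedge S 0 1 (P.formOf 0 b) (P.formOf 1 y)) (fun _ => a) +
      (-1 : 𝕂) ^ (1 * (1 + 0)) • (-1 : 𝕂) ^ (1 + 1 + 1) • (0 : Form P 1) (fun _ => a)) +
      castForm 0 1 (d3 S 0 1 0 (P.formOf 0 b) (P.formOf 1 y)) (fun _ => a) -
      d3 S 1 1 (P.derOf 0 b) (P.formOf 1 x) (P.formOf 1 y) (fun _ => a) +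
      castForm 0 1 (d3 S 1 0 0 (P.formOf 1 x) (P.formOf 0 b)) (fun _ => a) = _
  rw [ins_one rfl, ins_one rfl, wedge_one_zero, wedge_zero_one, d3_one_one]
  simp only [map_zero, LinearMap.zero_apply, AlternatingMap.zero_apply, totalDer_apply, map_add,
    map_neg]
  simp [extLin]
  abel

theorem h2_one_one (x y : P.Ext 1) (a b : P.sub) :
    extBilin (h2 S 1 1 2 x y) a b =
      P.prB (P.bracket (S.toFun (extLin x a)) (S.toFun (extLin y b)))
      + P.prB (P.bracket (S.toFun (extLin y a)) (S.toFun (extLin x b)))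
      - extLin y (prA S (P.bracket (S.toFun (extLin x a)) b))
      - extLin x (prA S (P.bracket (S.toFun (extLin y a)) b))
      - extLin y (prA S (P.bracket a (S.toFun (extLin x b))))
      - extLin x (prA S (P.bracket a (S.toFun (extLin y b)))) := by
  change shuffleSum (p := 1) (q := 1) 𝕂 (c2Mul S (P.formOf 1 x) (P.formOf 1 y)) ![a, b]
      + castForm 1 2 (act S 1 0 (P.formOf 1 y)) ![a, b] - castForm 1 2 (act S 1 0 (P.formOf 1 x)) ![a, b] +
      (0 : V ⧸ P.sub) = _
  rw [shuffleSum_one_one]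
  have h1 (a b : P.sub) : c2Mul S (p := 1) (q := 1) (P.formOf 1 x) (P.formOf 1 y) (Sum.elim (fun _ => a) (fun _ => b)) =
      P.prB (P.bracket (S.toFun (extLin x a)) (S.toFun (extLin y b)))
      - extLin y (prA S (P.bracket (S.toFun (extLin x a)) b))
      + extLin x (prA S (P.bracket (S.toFun (extLin y b)) a)) := by
    change c2Fun S (p := 1) (q := 1) (P.formOf 1 x) (P.formOf 1 y) _ _ = _
    simp only [c2Fun, slotSum_one, apply_eq_toLin]
    rfl
  simp only [h1, Matrix.cons_val_zero, Matrix.cons_val_one]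
  rw [P.bracket_skew (S.toFun (extLin x b)) (S.toFun (extLin y a)),
    P.bracket_skew a (S.toFun (extLin x b)), P.bracket_skew a (S.toFun (extLin y b))]
  simp only [map_neg, map_zero, LinearMap.zero_apply, AlternatingMap.zero_apply]
  abel

variable [CharZero 𝕂]

theorem h1_one (x : P.Ext 1) (a b : P.sub) :
    extBilin (h1 S 1 x) a b = P.prB (P.bracket a (S.toFun (extLin x b)))
      + P.prB (P.bracket (S.toFun (extLin x a)) b) - extLin x (prA S (P.bracket a b)) := by
  have h : extBilin (h1 S 1 x) a b =
      (1 ! : 𝕂)⁻¹ • MultilinearMap.alternatization (c1Mul S (p := 1) (P.formOf 1 x)) ![a, b] +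
        (0 : V ⧸ P.sub) := rfl
  have hu : (Finset.univ : Finset (Equiv.Perm (Fin (1 + 1)))) = {1, Equiv.swap 0 1} := by decide
  rw [h, MultilinearMap.alternatization_apply, hu, Finset.sum_pair (by decide),
    Equiv.Perm.sign_swap (by decide)]
  have h1 : MultilinearMap.domDomCongr (1 : Equiv.Perm (Fin (1 + 1))) (c1Mul S (p := 1) (P.formOf 1 x)) ![a, b] =
    c1Fun S (p := 1) (P.formOf 1 x) ![a, b] := rfl
  have h2 : MultilinearMap.domDomCongr (Equiv.swap 0 1 : Equiv.Perm (Fin (1 + 1)))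
      (c1Mul S (p := 1) (P.formOf 1 x)) ![a, b] = c1Fun S (p := 1) (P.formOf 1 x) ![b, a] := by
    rw [MultilinearMap.domDomCongr_apply]
    change c1Fun S (p := 1) (P.formOf 1 x) (fun i => ![a, b] (Equiv.swap 0 1 i)) = _
    congr 1
    funext i
    fin_cases i <;> rfl
  have h3 (a b : P.sub) : c1Fun S (p := 1) (P.formOf 1 x) ![a, b] = P.prB (P.bracket a (S.toFun (extLin x b)))
      - (2⁻¹ : 𝕂) • extLin x (prA S (P.bracket a b)) := by
    rw [c1Fun, slotSum_one, apply_eq_toLin]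
    rfl
  rw [h1, h2, h3, h3, P.bracket_skew b a, P.bracket_skew b]
  simp only [map_neg, smul_neg, Nat.factorial_one, Nat.cast_one, inv_one, one_smul,
    Equiv.Perm.sign_one, Units.neg_smul, add_zero]
  -- Each of the two permutations carries one half of the term with pr_A [a, b].
  have h4 (z : V ⧸ P.sub) : z = (2⁻¹ : 𝕂) • z + (2⁻¹ : 𝕂) • z := by
    rw [← add_smul, ← two_mul, mul_inv_cancel₀ two_ne_zero, one_smul]
  conv_rhs => rw [h4 (extLin x (prA S _))]
  abel

theorem ins_two (Z : Form P 1) (K : FormA P 2) (a b : P.sub) :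
    ins (𝕂 := 𝕂) 2 1 Z K ![a, b] = toLin Z (K ![a, b]) := by
  refine (shuffleSum_two_zero (𝕂 := 𝕂) _ (fun x y z w => ?_) _).trans ?_
  · simp only [biMul, MultilinearMap.coe_mk, AlternatingMap.curryLeft_apply_apply,
      apply_eq_toLin Z]
    have h1 : K (Sum.elim ![x, y] z ∘ Sum.inl) = K ![x, y] := rfl
    have h2 : K (Sum.elim ![y, x] w ∘ Sum.inl) = K ![y, x] := rfl
    have h3 : ![x, y] = ![y, x] ∘ Equiv.swap 0 1 := by
      funext i
      fin_cases i <;> rfl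
    rw [h1, h2, h3, K.map_swap _ (by decide)]
    simp
  · simp only [biMul, MultilinearMap.coe_mk, AlternatingMap.curryLeft_apply_apply,
      apply_eq_toLin Z]
    rfl

theorem wedge_one_one (X Y : Form P 1) (a b : P.sub) :
    wedge S 1 1 X Y ![a, b] = prA S (P.bracket (S.toFun (toLin X a)) (S.toFun (toLin Y b)) +
      P.bracket (S.toFun (toLin Y a)) (S.toFun (toLin X b))) := by
  refine (shuffleSum_one_one (𝕂 := 𝕂) _ _).trans ?_
  simp only [biMul, MultilinearMap.coe_mk, apply_eq_toLin]
  rw [map_add, P.bracket_skew (S.toFun (toLin Y a)), map_neg, ← sub_eq_add_neg]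
  rfl

/-- In degree 1 all Koszul signs of the cyclic sum are even, and only the common sign (-1)^(1 + 1 +
1) = -1 survives. -/
theorem h3_one_one_one (x y z : P.Ext 1) (a b : P.sub) :
    extBilin (h3 S 1 1 1 2 x y z) a b =
      - extLin z (prA S (P.bracket (S.toFun (extLin x a)) (S.toFun (extLin y b)) +
        P.bracket (S.toFun (extLin y a)) (S.toFun (extLin x b))))
      - extLin x (prA S (P.bracket (S.toFun (extLin y a)) (S.toFun (extLin z b)) +
        P.bracket (S.toFun (extLin z a)) (S.toFun (extLin y b))))
      - extLin y (prA S (P.bracket (S.toFun (extLin z a)) (S.toFun (extLin x b)) +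
        P.bracket (S.toFun (extLin x a)) (S.toFun (extLin z b)))) := by
  change (c3 S 1 1 1 (P.formOf 1 x) (P.formOf 1 y) (P.formOf 1 z) +
    castForm 1 2 (d3 S 1 1 0 (P.formOf 1 y) (P.formOf 1 z)) -
    castForm 1 2 (d3 S 1 1 0 (P.formOf 1 x) (P.formOf 1 z)) +
    castForm 1 2 (d3 S 1 1 0 (P.formOf 1 x) (P.formOf 1 y)) : Form P 2) ![a, b] = _
  have hc : c3 S 1 1 1 (P.formOf 1 x) (P.formOf 1 y) (P.formOf 1 z) ![a, b] =
      (-1 : 𝕂) ^ (1 + 1 + 1) • ins 2 1 (P.formOf 1 z) (wedge S 1 1 (P.formOf 1 x) (P.formOf 1 y)) ![a, b] +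
      (-1 : 𝕂) ^ (1 * (1 + 1)) • (-1 : 𝕂) ^ (1 + 1 + 1) • ins 2 1 (P.formOf 1 x) (wedge S 1 1 (P.formOf 1 y) (P.formOf 1 z)) ![a, b] +
      (-1 : 𝕂) ^ (1 * (1 + 1)) • (-1 : 𝕂) ^ (1 + 1 + 1) • ins 2 1 (P.formOf 1 y) (wedge S 1 1 (P.formOf 1 z) (P.formOf 1 x)) ![a, b] :=
    rfl
  simp only [map_zero, LinearMap.zero_apply, add_zero, sub_zero]
  have hs : (-1 : 𝕂) ^ (1 + 1 + 1) = -1 := by norm_num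
  rw [hc, hs, ins_two, ins_two, ins_two, wedge_one_one, wedge_one_one, wedge_one_one]
  simp [extLin]
  abel

end Pair

end LieDef
end

noncomputable section

set_option maxSynthPendingDepth 3

namespace LieDef

/-! ### Forms and derivations as block operators on Γ(L_𝒜) -/

namespace Pair

variable {𝕂 : Type k} {R V : Type u} [Field 𝕂] [CommRing R] [Algebra 𝕂 R]
  [AddCommGroup V] [Module 𝕂 V] [Module R V] [IsScalarTower 𝕂 R V] {P : Pair 𝕂 R V}
  (S : P.Splitting)

/-- The projection of `Γ(L)` to `j Γ(B)`. -/
def projB : Module.End 𝕂 V := (S.toFun ∘ₗ P.prB).restrictScalars 𝕂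

/-- The projection of `Γ(L)` to `Γ(A)`. -/
def projA : Module.End 𝕂 V := (P.sub.subtype ∘ₗ prA S).restrictScalars 𝕂

theorem projB_apply (v : V) : projB S v = S.toFun (P.prB v) := rfl
theorem projA_apply (v : V) : projA S v = prA S v := rfl

theorem projB_add_projA : projB S + projA S = 1 := by
  ext v
  simp [projB_apply, projA_apply, prA, prB]

/-- With p = `projB S`, q = `projA S`, D the total derivation and x, y the operators of forms, the
brackets become noncommutative polynomials: [b]₁ is -p D q, [b, x]₂ is p D x - x D q, and [b, x, y]₃
is x D y + y D x. This and the following lemmas translate the gauge action into this algebra. -/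
theorem formOp_h1 [CharZero 𝕂] (b : P.Ext 0) :
    (formOp S (h1 S 0 b) : Module.End 𝕂 V) =
      -(projB S * (derOp P (totalDer S b) : Module.End 𝕂 V) * projA S) := by
  ext v
  change S.toFun (extLin (h1 S 0 b) (prA S v)) = - S.toFun (P.prB (derOp P (totalDer S b) (prA S v)))
  rw [h1_zero, map_neg]

theorem formOp_h2_one_zero (x : P.Ext 1) (b : P.Ext 0) :
    (formOp S (h2 S 1 0 1 x b) : Module.End 𝕂 V) =
      (formOp S x : Module.End 𝕂 V) * (derOp P (totalDer S b) : Module.End 𝕂 V) * projA S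
        - projB S * (derOp P (totalDer S b) : Module.End 𝕂 V) * (formOp S x : Module.End 𝕂 V) := by
  ext v
  change S.toFun (extLin (h2 S 1 0 1 x b) (prA S v)) =
    S.toFun (extLin x (prA S (derOp P (totalDer S b) (prA S v)))) -
    S.toFun (P.prB (derOp P (totalDer S b) (S.toFun (extLin x (prA S v)))))
  rw [h2_one_zero, ← map_sub, neg_sub]

theorem formOp_h2_zero_one (b : P.Ext 0) (x : P.Ext 1) :
    (formOp S (h2 S 0 1 1 b x) : Module.End 𝕂 V) =
      projB S * (derOp P (totalDer S b) : Module.End 𝕂 V) * (formOp S x : Module.End 𝕂 V)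
       - (formOp S x : Module.End 𝕂 V) * (derOp P (totalDer S b) : Module.End 𝕂 V) * projA S := by
  ext v
  change S.toFun (extLin (h2 S 0 1 1 b x) (prA S v)) =
    S.toFun (P.prB (derOp P (totalDer S b) (S.toFun (extLin x (prA S v))))) -
    S.toFun (extLin x (prA S (derOp P (totalDer S b) (prA S v))))
  rw [h2_zero_one, ← map_sub]

theorem formOp_h3_one_one_zero (x y : P.Ext 1) (b : P.Ext 0) :
    (formOp S (h3 S 1 1 0 1 x y b) : Module.End 𝕂 V) =
      (formOp S x : Module.End 𝕂 V) * (derOp P (totalDer S b) : Module.End 𝕂 V) * (formOp S y : Module.End 𝕂 V)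
       + (formOp S y : Module.End 𝕂 V) * (derOp P (totalDer S b) : Module.End 𝕂 V) *
        (formOp S x : Module.End 𝕂 V) := by
  ext v
  change S.toFun (extLin (h3 S 1 1 0 1 x y b) (prA S v)) =
    S.toFun (extLin x (prA S (derOp P (totalDer S b) (S.toFun (extLin y (prA S v)))))) +
    S.toFun (extLin y (prA S (derOp P (totalDer S b) (S.toFun (extLin x (prA S v))))))
  rw [h3_one_one_zero, ← map_add]

theorem formOp_h3_zero_one_one (b : P.Ext 0) (x y : P.Ext 1) :
    (formOp S (h3 S 0 1 1 1 b x y) : Module.End 𝕂 V) =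
      (formOp S x : Module.End 𝕂 V) * (derOp P (totalDer S b) : Module.End 𝕂 V) * (formOp S y : Module.End 𝕂 V)
       + (formOp S y : Module.End 𝕂 V) * (derOp P (totalDer S b) : Module.End 𝕂 V) *
        (formOp S x : Module.End 𝕂 V) := by
  ext v
  change S.toFun (extLin (h3 S 0 1 1 1 b x y) (prA S v)) =
    S.toFun (extLin x (prA S (derOp P (totalDer S b) (S.toFun (extLin y (prA S v)))))) +
    S.toFun (extLin y (prA S (derOp P (totalDer S b) (S.toFun (extLin x (prA S v))))))
  rw [h3_zero_one_one, ← map_add]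

theorem formOp_h3_one_zero_one (x : P.Ext 1) (b : P.Ext 0) (y : P.Ext 1) :
    (formOp S (h3 S 1 0 1 1 x b y) : Module.End 𝕂 V) =
      -((formOp S x : Module.End 𝕂 V) * (derOp P (totalDer S b) : Module.End 𝕂 V) * (formOp S y : Module.End 𝕂 V)
       + (formOp S y : Module.End 𝕂 V) * (derOp P (totalDer S b) : Module.End 𝕂 V) *
        (formOp S x : Module.End 𝕂 V)) := by
  ext v
  change S.toFun (extLin (h3 S 1 0 1 1 x b y) (prA S v)) =
    - (S.toFun (extLin x (prA S (derOp P (totalDer S b) (S.toFun (extLin y (prA S v)))))) +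
    S.toFun (extLin y (prA S (derOp P (totalDer S b) (S.toFun (extLin x (prA S v)))))))
  rw [h3_one_zero_one, ← map_add, map_neg]

section Operators

variable (𝒜 : ArtAlg.{k, v} 𝕂)

/-- The projection of `Γ(L_𝒜)` to `j Γ(B_𝒜)`. -/
def thickB : Module.End 𝒜 (Thick 𝒜 V) := (projB S).baseChange 𝒜

/-- The projection of `Γ(L_𝒜)` to `Γ(A_𝒜)`. -/
def thickA : Module.End 𝒜 (Thick 𝒜 V) := (projA S).baseChange 𝒜

/-- The operator on `Γ(L_𝒜)` of an element of `𝔪 ⊗ Ω¹_A(B)`. -/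
def thickForm : 𝒜.max ⊗[𝕂] P.Ext 1 →ₗ[𝕂] Module.End 𝒜 (Thick 𝒜 V) := ten 𝒜 (formOp S)

/-- The operator on `Γ(L_𝒜)` of an element of `𝔪 ⊗ Der(L)`. -/
def thickDer (P : Pair 𝕂 R V) (𝒜 : ArtAlg.{k, v} 𝕂) :
    𝒜.max ⊗[𝕂] P.Der →ₗ[𝕂] Module.End 𝒜 (Thick 𝒜 V) := ten 𝒜 (derOp P)

/-- The operator on `Γ(L_𝒜)` of an element of `𝔪 ⊗ 𝔥⁰`. -/
def thickGauge : 𝒜.max ⊗[𝕂] P.Ext 0 →ₗ[𝕂] Module.End 𝒜 (Thick 𝒜 V) :=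
  thickDer P 𝒜 ∘ₗ (totalDer S).lTensor 𝒜.max

theorem thickB_add_thickA : thickB S 𝒜 + thickA S 𝒜 = 1 := by
  rw [thickB, thickA, ← LinearMap.baseChange_add, projB_add_projA]
  exact LinearMap.baseChange_one ..

theorem thickForm_tmul (a : 𝒜.max) (x : P.Ext 1) :
    thickForm S 𝒜 (a ⊗ₜ x) = (a : 𝒜) • (formOp S x).baseChange 𝒜 := rfl

theorem thickGauge_tmul (a : 𝒜.max) (b : P.Ext 0) :
    thickGauge S 𝒜 (a ⊗ₜ b) = (a : 𝒜) • (derOp P (totalDer S b)).baseChange 𝒜 := rfl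

/-- A form is recovered from its operator by restriction to Γ(A) and projection to Γ(B), so the
gauge recursion may be solved on operators. -/
theorem thickForm_injective : Function.Injective (thickForm S 𝒜) := by
  refine ten_injective fun x y h => ?_
  have h1 : extLin x = extLin y := by
    ext1 a
    have := congrArg P.prB (LinearMap.congr_fun h (a : V))
    rw [formOp_apply, formOp_apply, prB_j, prB_j, prA_coe] at this
    exact this
  have h2 : P.formOf 1 x = P.formOf 1 y :=
    AlternatingMap.ext fun u => by rw [formOf_apply, formOf_apply, h1]
  exact h2

variable {S 𝒜}

theorem baseChange_mul' (f g : Module.End 𝕂 V) :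
    ((f * g).baseChange 𝒜 : Module.End 𝒜 (Thick 𝒜 V)) = f.baseChange 𝒜 * g.baseChange 𝒜 :=
  LinearMap.baseChange_mul ..

theorem ext2_tmul {X Y Z : Type*} [AddCommGroup X] [Module 𝕂 X] [AddCommGroup Y] [Module 𝕂 Y]
    [AddCommGroup Z] [Module 𝕂 Z] (f : X →ₗ[𝕂] Y →ₗ[𝕂] Z) (a b : 𝒜.max) (x : X) (y : Y) :
    ext2 𝒜 f (a ⊗ₜ x) (b ⊗ₜ y) = (𝒜.mulMax a b) ⊗ₜ f x y := by
  simp [ext2]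

theorem thickForm_h1 [CharZero 𝕂] (b : 𝒜.max ⊗[𝕂] P.Ext 0) :
    thickForm S 𝒜 (ext1 𝒜 (h1 S 0) b) = -(thickB S 𝒜 * thickGauge S 𝒜 b * thickA S 𝒜) := by
  induction b with
  | zero => simp
  | add x y hx hy => simp only [map_add, hx, hy, mul_add, add_mul, neg_add]
  | tmul a b =>
    rw [ext1, LinearMap.lTensor_tmul, thickForm_tmul, formOp_h1, thickGauge_tmul,
      LinearMap.baseChange_neg, baseChange_mul', baseChange_mul', smul_neg, mul_smul_comm,
      smul_mul_assoc]
    rfl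

theorem thickForm_h2_one_zero (x : 𝒜.max ⊗[𝕂] P.Ext 1) (b : 𝒜.max ⊗[𝕂] P.Ext 0) :
    thickForm S 𝒜 (ext2 𝒜 (h2 S 1 0 1) x b) =
      thickForm S 𝒜 x * thickGauge S 𝒜 b * thickA S 𝒜
        - thickB S 𝒜 * thickGauge S 𝒜 b * thickForm S 𝒜 x := by
  induction x with
  | zero => simp
  | add x y hx hy =>
    simp only [map_add, LinearMap.add_apply, hx, hy, mul_add, add_mul]
    abel
  | tmul a x =>
    induction b with
    | zero => simp
    | add x y hx hy =>
      simp only [map_add, hx, hy, mul_add, add_mul]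
      abel
    | tmul c b =>
      rw [ext2_tmul, thickForm_tmul, formOp_h2_one_zero,
        thickGauge_tmul, thickForm_tmul, LinearMap.baseChange_sub, baseChange_mul', baseChange_mul',
        baseChange_mul', baseChange_mul']
      simp only [smul_sub, mul_smul_comm, smul_mul_assoc, smul_smul]
      rw [mul_comm (c : 𝒜)]
      rfl

theorem thickForm_h2_zero_one (b : 𝒜.max ⊗[𝕂] P.Ext 0) (x : 𝒜.max ⊗[𝕂] P.Ext 1) :
    thickForm S 𝒜 (ext2 𝒜 (h2 S 0 1 1) b x) =
      thickB S 𝒜 * thickGauge S 𝒜 b * thickForm S 𝒜 x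
       - thickForm S 𝒜 x * thickGauge S 𝒜 b * thickA S 𝒜 := by
  induction x with
  | zero => simp
  | add x y hx hy =>
    simp only [map_add, hx, hy, mul_add, add_mul]
    abel
  | tmul a x =>
    induction b with
    | zero => simp
    | add x y hx hy =>
      simp only [map_add, LinearMap.add_apply, hx, hy, mul_add, add_mul]
      abel
    | tmul c b =>
      rw [ext2_tmul, thickForm_tmul, formOp_h2_zero_one,
        thickGauge_tmul, thickForm_tmul, LinearMap.baseChange_sub, baseChange_mul', baseChange_mul',
        baseChange_mul', baseChange_mul']
      simp only [smul_sub, mul_smul_comm, smul_mul_assoc, smul_smul]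
      rw [mul_comm (a : 𝒜)]
      rfl

theorem ext3_tmul {X Y Z W : Type*} [AddCommGroup X] [Module 𝕂 X] [AddCommGroup Y] [Module 𝕂 Y]
    [AddCommGroup Z] [Module 𝕂 Z] [AddCommGroup W] [Module 𝕂 W] (f : X →ₗ[𝕂] Y →ₗ[𝕂] Z →ₗ[𝕂] W)
    (a b c : 𝒜.max) (x : X) (y : Y) (z : Z) :
    ext3 𝒜 f (a ⊗ₜ x) (b ⊗ₜ y) (c ⊗ₜ z) = (𝒜.mulMax (𝒜.mulMax a b) c) ⊗ₜ f x y z := by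
  simp [ext3, ext2]

/-- Additivity in each argument already forces vanishing at zero, so agreement on pure tensors
suffices. -/
theorem ext3_induction {X Y Z : Type*} [AddCommGroup X] [Module 𝕂 X] [AddCommGroup Y] [Module 𝕂 Y]
    [AddCommGroup Z] [Module 𝕂 Z] {W : Type*} [AddCommGroup W] {f g : 𝒜.max ⊗[𝕂] X → 𝒜.max ⊗[𝕂] Y →
      𝒜.max ⊗[𝕂] Z → W}
    (hf₁ : ∀ x x' y z, f (x + x') y z = f x y z + f x' y z)
    (hf₂ : ∀ x y y' z, f x (y + y') z = f x y z + f x y' z)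
    (hf₃ : ∀ x y z z', f x y (z + z') = f x y z + f x y z')
    (hg₁ : ∀ x x' y z, g (x + x') y z = g x y z + g x' y z)
    (hg₂ : ∀ x y y' z, g x (y + y') z = g x y z + g x y' z)
    (hg₃ : ∀ x y z z', g x y (z + z') = g x y z + g x y z')
    (h : ∀ a x b y c z, f (a ⊗ₜ x) (b ⊗ₜ y) (c ⊗ₜ z) = g (a ⊗ₜ x) (b ⊗ₜ y) (c ⊗ₜ z))
    (x : 𝒜.max ⊗[𝕂] X) (y : 𝒜.max ⊗[𝕂] Y) (z : 𝒜.max ⊗[𝕂] Z) : f x y z = g x y z := by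
  induction x with
  | zero =>
    have h1 := hf₁ 0 0 y z
    have h2 := hg₁ 0 0 y z
    rw [add_zero, left_eq_add] at h1 h2
    rw [h1, h2]
  | add x x' hx hx' => rw [hf₁, hg₁, hx, hx']
  | tmul a x =>
    induction y with
    | zero =>
      have h1 := hf₂ (a ⊗ₜ x) 0 0 z
      have h2 := hg₂ (a ⊗ₜ x) 0 0 z
      rw [add_zero, left_eq_add] at h1 h2
      rw [h1, h2]
    | add y y' hy hy' => rw [hf₂, hg₂, hy, hy']
    | tmul b y =>
      induction z with
      | zero =>
        have h1 := hf₃ (a ⊗ₜ x) (b ⊗ₜ y) 0 0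
        have h2 := hg₃ (a ⊗ₜ x) (b ⊗ₜ y) 0 0
        rw [add_zero, left_eq_add] at h1 h2
        rw [h1, h2]
      | add z z' hz hz' => rw [hf₃, hg₃, hz, hz']
      | tmul c z => exact h a x b y c z

theorem thickForm_h3_one_one_zero (x y : 𝒜.max ⊗[𝕂] P.Ext 1) (b : 𝒜.max ⊗[𝕂] P.Ext 0) :
    thickForm S 𝒜 (ext3 𝒜 (h3 S 1 1 0 1) x y b) =
      thickForm S 𝒜 x * thickGauge S 𝒜 b * thickForm S 𝒜 y
        + thickForm S 𝒜 y * thickGauge S 𝒜 b * thickForm S 𝒜 x := by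
  refine ext3_induction (f := fun x y b => thickForm S 𝒜 (ext3 𝒜 (h3 S 1 1 0 1) x y b))
    (g := fun x y b => thickForm S 𝒜 x * thickGauge S 𝒜 b * thickForm S 𝒜 y
        + thickForm S 𝒜 y * thickGauge S 𝒜 b * thickForm S 𝒜 x) (by simp) (by simp) (by simp)
    ?_ ?_ ?_ (fun a x c y d b => ?_) x y b
  · intros; simp only [map_add, mul_add, add_mul]; abel
  · intros; simp only [map_add, mul_add, add_mul]; abel
  · intros; simp only [map_add, mul_add, add_mul]; abel
  · simp only [ext3_tmul, thickForm_tmul, formOp_h3_one_one_zero, thickGauge_tmul,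
      LinearMap.baseChange_add, baseChange_mul', smul_add, mul_smul_comm, smul_mul_assoc, smul_smul]
    congr 2
    · change ((a : 𝒜) * c) * d = _
      ring
    · change ((a : 𝒜) * c) * d = _
      ring

theorem thickForm_h3_zero_one_one (b : 𝒜.max ⊗[𝕂] P.Ext 0) (x y : 𝒜.max ⊗[𝕂] P.Ext 1) :
    thickForm S 𝒜 (ext3 𝒜 (h3 S 0 1 1 1) b x y) =
      thickForm S 𝒜 x * thickGauge S 𝒜 b * thickForm S 𝒜 y
        + thickForm S 𝒜 y * thickGauge S 𝒜 b * thickForm S 𝒜 x := by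
  refine ext3_induction (f := fun b x y => thickForm S 𝒜 (ext3 𝒜 (h3 S 0 1 1 1) b x y))
    (g := fun b x y => thickForm S 𝒜 x * thickGauge S 𝒜 b * thickForm S 𝒜 y
        + thickForm S 𝒜 y * thickGauge S 𝒜 b * thickForm S 𝒜 x) (by simp) (by simp) (by simp)
    ?_ ?_ ?_ (fun d b a x c y => ?_) b x y
  · intros; simp only [map_add, mul_add, add_mul]; abel
  · intros; simp only [map_add, mul_add, add_mul]; abel
  · intros; simp only [map_add, mul_add, add_mul]; abel
  · simp only [ext3_tmul, thickForm_tmul, formOp_h3_zero_one_one, thickGauge_tmul,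
      LinearMap.baseChange_add, baseChange_mul', smul_add, mul_smul_comm, smul_mul_assoc, smul_smul]
    congr 2
    · change ((d : 𝒜) * a) * c = _
      ring
    · change ((d : 𝒜) * a) * c = _
      ring

theorem thickForm_h3_one_zero_one (x : 𝒜.max ⊗[𝕂] P.Ext 1) (b : 𝒜.max ⊗[𝕂] P.Ext 0)
    (y : 𝒜.max ⊗[𝕂] P.Ext 1) :
    thickForm S 𝒜 (ext3 𝒜 (h3 S 1 0 1 1) x b y) =
      -(thickForm S 𝒜 x * thickGauge S 𝒜 b * thickForm S 𝒜 y
        + thickForm S 𝒜 y * thickGauge S 𝒜 b * thickForm S 𝒜 x) := by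
  refine ext3_induction (f := fun x b y => thickForm S 𝒜 (ext3 𝒜 (h3 S 1 0 1 1) x b y))
    (g := fun x b y => -(thickForm S 𝒜 x * thickGauge S 𝒜 b * thickForm S 𝒜 y
        + thickForm S 𝒜 y * thickGauge S 𝒜 b * thickForm S 𝒜 x)) (by simp) (by simp) (by simp)
    ?_ ?_ ?_ (fun a x d b c y => ?_) x b y
  · intros; simp only [map_add, mul_add, add_mul]; abel
  · intros; simp only [map_add, mul_add, add_mul]; abel
  · intros; simp only [map_add, mul_add, add_mul]; abel
  · simp only [ext3_tmul, thickForm_tmul, formOp_h3_one_zero_one, thickGauge_tmul,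
      LinearMap.baseChange_add, LinearMap.baseChange_neg, baseChange_mul', smul_add, smul_neg,
      mul_smul_comm, smul_mul_assoc, smul_smul]
    congr 3
    · change ((a : 𝒜) * d) * c = _
      ring
    · change ((a : 𝒜) * d) * c = _
      ring

theorem thickGauge_mem (b : 𝒜.max ⊗[𝕂] P.Ext 0) :
    thickGauge S 𝒜 b ∈ endFil 𝒜.max (Thick 𝒜 V) 1 := ten_mem_endFil _ _

/-- Operators of forms kill j Γ(B) and have values in it. These block relations, including that
products of two such operators vanish, are all that the flow argument needs to know about forms. -/
theorem thickForm_mul_thickB (x : 𝒜.max ⊗[𝕂] P.Ext 1) : thickForm S 𝒜 x * thickB S 𝒜 = 0 := by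
  induction x with
  | zero => simp
  | add x y hx hy => simp only [map_add, add_mul, hx, hy, add_zero]
  | tmul a x =>
    have h : (formOp S x : Module.End 𝕂 V) * projB S = 0 := by
      ext v
      change S.toFun (extLin x (prA S (S.toFun (P.prB v)))) = 0
      rw [prA_j, map_zero, map_zero]
    rw [thickForm_tmul, smul_mul_assoc, thickB, ← baseChange_mul', h, LinearMap.baseChange_zero,
      smul_zero]

theorem thickA_mul_thickForm (x : 𝒜.max ⊗[𝕂] P.Ext 1) : thickA S 𝒜 * thickForm S 𝒜 x = 0 := by
  induction x with
  | zero => simp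
  | add x y hx hy => simp only [map_add, mul_add, hx, hy, add_zero]
  | tmul a x =>
    have h : projA S * (formOp S x : Module.End 𝕂 V) = 0 := by
      ext v
      change ((prA S (S.toFun (extLin x (prA S v))) : P.sub) : V) = 0
      rw [prA_j]
      rfl
    rw [thickForm_tmul, mul_smul_comm, thickA, ← baseChange_mul', h, LinearMap.baseChange_zero,
      smul_zero]

theorem thickForm_mul_thickA (x : 𝒜.max ⊗[𝕂] P.Ext 1) :
    thickForm S 𝒜 x * thickA S 𝒜 = thickForm S 𝒜 x := by
  have h := thickB_add_thickA S 𝒜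
  rw [← eq_sub_iff_add_eq'] at h
  rw [h, mul_sub, thickForm_mul_thickB, mul_one, sub_zero]

theorem thickB_mul_thickForm (x : 𝒜.max ⊗[𝕂] P.Ext 1) :
    thickB S 𝒜 * thickForm S 𝒜 x = thickForm S 𝒜 x := by
  have h := thickB_add_thickA S 𝒜
  rw [← eq_sub_iff_add_eq] at h
  rw [h, sub_mul, thickA_mul_thickForm, one_mul, sub_zero]

theorem thickForm_mul_thickForm (x y : 𝒜.max ⊗[𝕂] P.Ext 1) :
    thickForm S 𝒜 x * thickForm S 𝒜 y = 0 := by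
  rw [← thickForm_mul_thickA, mul_assoc, thickA_mul_thickForm, mul_zero]

theorem thickB_mul_thickA : thickB S 𝒜 * thickA S 𝒜 = 0 := by
  have h : projB S * projA S = 0 := by
    ext v
    change S.toFun (P.prB (prA S v : V)) = 0
    rw [prB_coe, map_zero]
  rw [thickA, thickB, ← baseChange_mul', h, LinearMap.baseChange_zero]

theorem thickA_mul_thickA : thickA S 𝒜 * thickA S 𝒜 = thickA S 𝒜 := by
  have h := thickB_add_thickA S 𝒜
  rw [← eq_sub_iff_add_eq'] at h
  nth_rw 1 [h]
  rw [sub_mul, one_mul, thickB_mul_thickA, sub_zero]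

end Operators

end Pair

end LieDef
end

noncomputable section

set_option maxSynthPendingDepth 3

namespace LieDef

/-! ### The gauge action as the flow of a derivation on graphs -/

section AbstractGauge
variable {𝕂 E : Type*} [Field 𝕂] [CharZero 𝕂] [Ring E] [Algebra 𝕂 E]

/-- The recursion for the terms of the `L_∞`-exponential is a Riccati equation for the generating
function of the `y n`. -/
theorem riccati_of_gauge_recursion {p q D x : E} {t y : ℕ → E}
    (h0 : t 0 = -(p * D * q) + (x * D * q - p * D * x) + x * D * x)
    (hs : ∀ n, t (n + 1) = p * D * t n - t n * D * q - (x * D * t n + t n * D * x) +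
      (2 ! : 𝕂)⁻¹ • ∑ i : Fin n, (((n + 1) ! : 𝕂) / (((i : ℕ) + 1) ! * (n - (i : ℕ)) ! : 𝕂)) •
        (t i * D * t (n - 1 - i) + t (n - 1 - i) * D * t i))
    (hy0 : y 0 = x) (hy : ∀ n, y (n + 1) = -(((n + 1) ! : 𝕂)⁻¹ • t n)) (n : ℕ) :
    (n + 1) • y (n + 1) = (if n = 0 then p * D * q else 0) + p * D * y n
      - y n * D * q - ∑ kl ∈ Finset.HasAntidiagonal.antidiagonal n, y kl.1 * D * y kl.2 := by
  cases n with
  | zero =>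
    simp only [hy, h0, hy0, Finset.Nat.antidiagonal_zero, Finset.sum_singleton, if_true]
    simp
    abel
  | succ m =>
    have hsum : ∑ kl ∈ Finset.HasAntidiagonal.antidiagonal (m + 1), y kl.1 * D * y kl.2 =
        ∑ i ∈ Finset.range m, ((((i + 1) ! : 𝕂) * ((m - i) ! : 𝕂))⁻¹) •
          (t i * D * t (m - 1 - i)) + x * D * y (m + 1) + y (m + 1) * D * x := by
      -- The two extreme terms contain y 0 = x and account for the twisting by ξ in [b, -]₂^ξ; the
      -- interior terms come from [b, -, -]₃.
      rw [Finset.Nat.sum_antidiagonal_eq_sum_range_succ (fun k l => y k * D * y l),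
        Finset.sum_range_succ, Finset.sum_range_succ']
      simp only [Nat.sub_self, hy0, Nat.sub_zero]
      congr 2
      refine Finset.sum_congr rfl fun i hi => ?_
      have hi := Finset.mem_range.1 hi
      obtain ⟨j, rfl⟩ := Nat.exists_eq_add_of_lt hi
      have e1 : i + j + 1 + 1 - (i + 1) = j + 1 := by omega
      have e2 : i + j + 1 - 1 - i = j := by omega
      have e3 : i + j + 1 - i = j + 1 := by omega
      rw [e1, e2, e3, hy, hy]
      simp only [neg_mul, mul_neg, smul_neg, neg_neg, smul_mul_assoc, mul_smul_comm, smul_smul]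
      rw [mul_inv, mul_comm]
    -- The weights are symmetric under i ↔ m - 1 - i, so the symmetrised sum is twice the plain one
    -- and cancels the factor 1 / 2!.
    have hrefl : ∑ i ∈ Finset.range m, ((((i + 1) ! : 𝕂) * ((m - i) ! : 𝕂))⁻¹) •
          (t (m - 1 - i) * D * t i) = ∑ i ∈ Finset.range m,
          ((((i + 1) ! : 𝕂) * ((m - i) ! : 𝕂))⁻¹) • (t i * D * t (m - 1 - i)) := by
      rw [← Finset.sum_range_reflect]
      refine Finset.sum_congr rfl fun i hi => ?_
      have hi := Finset.mem_range.1 hi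
      obtain ⟨j, rfl⟩ := Nat.exists_eq_add_of_lt hi
      have e1 : i + j + 1 - 1 - i = j := by omega
      have e2 : i + j + 1 - 1 - j = i := by omega
      have e3 : i + j + 1 - j = i + 1 := by omega
      have e4 : i + j + 1 - i = j + 1 := by omega
      rw [e1, e2, e3, e4, mul_comm ((j + 1) ! : 𝕂)]
    have hne : ((m + 1) ! : 𝕂) ≠ 0 := Nat.cast_ne_zero.2 (Nat.factorial_ne_zero _)
    have hfin : ((m + 1) ! : 𝕂)⁻¹ • (2 ! : 𝕂)⁻¹ • ∑ i : Fin m,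
        (((m + 1) ! : 𝕂) / (((i : ℕ) + 1) ! * (m - (i : ℕ)) ! : 𝕂)) •
        (t i * D * t (m - 1 - i) + t (m - 1 - i) * D * t i) =
        ∑ i ∈ Finset.range m, ((((i + 1) ! : 𝕂) * ((m - i) ! : 𝕂))⁻¹) •
          (t i * D * t (m - 1 - i)) := by
      rw [Fin.sum_univ_eq_sum_range (fun i => (((m + 1) ! : 𝕂) / ((i + 1) ! * (m - i) ! : 𝕂)) •
        (t i * D * t (m - 1 - i) + t (m - 1 - i) * D * t i)) m]
      have : ∑ i ∈ Finset.range m, (((m + 1) ! : 𝕂) / ((i + 1) ! * (m - i) ! : 𝕂)) •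
          (t i * D * t (m - 1 - i) + t (m - 1 - i) * D * t i) =
          ((m + 1) ! : 𝕂) • ((2 : 𝕂) • ∑ i ∈ Finset.range m,
          ((((i + 1) ! : 𝕂) * ((m - i) ! : 𝕂))⁻¹) • (t i * D * t (m - 1 - i))) := by
        rw [two_smul]
        nth_rewrite 2 [← hrefl]
        rw [← Finset.sum_add_distrib, Finset.smul_sum]
        refine Finset.sum_congr rfl fun i _ => ?_
        rw [div_eq_mul_inv, mul_smul, smul_add]
      rw [this, smul_comm (2 ! : 𝕂)⁻¹, smul_smul, inv_mul_cancel₀ hne, one_smul, smul_smul]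
      norm_num
    -- Dividing by (m + 2)! and differentiating formally leaves the factor 1 / (m + 1)!.
    have hl : (m + 1 + 1) • y (m + 1 + 1) = -(((m + 1) ! : 𝕂)⁻¹ • t (m + 1)) := by
      rw [hy, smul_neg, ← Nat.cast_smul_eq_nsmul 𝕂, smul_smul, Nat.factorial_succ (m + 1)]
      congr 2
      have h2 : ((m + 1 + 1 : ℕ) : 𝕂) ≠ 0 := Nat.cast_ne_zero.2 (by omega)
      rw [Nat.cast_mul, mul_inv, ← mul_assoc, mul_inv_cancel₀ h2, one_mul]
    rw [hl, hs, smul_add, hfin, hsum, hy, if_neg (by omega)]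
    simp only [smul_add, smul_sub, mul_neg, neg_mul, mul_smul_comm, smul_mul_assoc]
    abel

/-- This is the evaluation at time 1 of a product of two polynomials of degree less than K, whose
product has degree less than 2 K. -/
theorem sum_antidiagonal_eq_mul_sum {y g : ℕ → E} {K : ℕ} (hy : ∀ n, K ≤ n → y n = 0)
    (hg : ∀ n, K ≤ n → g n = 0) :
    ∑ n ∈ Finset.range (2 * K), ∑ kl ∈ Finset.HasAntidiagonal.antidiagonal n, y kl.1 * g kl.2 =
      (∑ n ∈ Finset.range K, y n) * ∑ n ∈ Finset.range K, g n := by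
  rw [Finset.sum_mul_sum, ← Finset.sum_product',
    ← Finset.sum_fiberwise_of_maps_to (t := Finset.range (2 * K)) (g := fun kl : ℕ × ℕ => kl.1 + kl.2)]
  · refine Finset.sum_congr rfl fun n _ => (Finset.sum_subset (fun kl h => ?_) fun kl h h' => ?_).symm
    · exact Finset.HasAntidiagonal.mem_antidiagonal.2 (Finset.mem_filter.1 h).2
    · by_cases h1 : K ≤ kl.1
      · rw [hy _ h1, zero_mul]
      by_cases h2 : K ≤ kl.2
      · rw [hg _ h2, mul_zero]
      refine absurd (Finset.mem_filter.2 ⟨Finset.mem_product.2 ⟨?_, ?_⟩, ?_⟩) h'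
      · exact Finset.mem_range.2 (by omega)
      · exact Finset.mem_range.2 (by omega)
      · exact Finset.HasAntidiagonal.mem_antidiagonal.1 h
  · intro kl h
    have := Finset.mem_product.1 h
    have h1 := Finset.mem_range.1 this.1
    have h2 := Finset.mem_range.1 this.2
    exact Finset.mem_range.2 (by omega)

/-- The flow of a linear vector field on graphs: it maps the graph of `x` to the graph of the sum of a
solution of the Riccati equation. -/
theorem nilExp_graph {p q D x : E} {y : ℕ → E} (hpq : p + q = 1) (hpq0 : p * q = 0)
    (hpx : p * x = x) (hxq : x * q = x) (hxx : x * x = 0)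
    (hy : ∀ n, (n + 1) • y (n + 1) = (if n = 0 then p * D * q else 0) + p * D * y n
      - y n * D * q - ∑ kl ∈ Finset.HasAntidiagonal.antidiagonal n, y kl.1 * D * y kl.2)
    (hy0 : y 0 = x) {K : ℕ} (hD : D ^ K = 0) (hyK : ∀ n, K ≤ n → y n = 0) :
    (p - ∑ n ∈ Finset.range K, y n) * (nilExp 𝕂 D * (q + x)) = 0 := by
  let _ : Module ℚ E := Module.compHom E (algebraMap ℚ 𝕂)
  have : IsAddTorsionFree E := .of_module_rat E
  -- The coefficients of the flow exp(t D) (q + x), which starts at the parametrisation q + x of the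
  -- graph of x.
  set g : ℕ → E := fun n => (n ! : 𝕂)⁻¹ • D ^ n * (q + x) with hg
  have hg1 : ∀ n, (n + 1) • g (n + 1) = D * g n := by
    intro n
    have h2 : ((n + 1 : ℕ) : 𝕂) ≠ 0 := Nat.cast_ne_zero.2 (by omega)
    rw [hg]
    simp only [smul_mul_assoc, mul_smul_comm]
    rw [← Nat.cast_smul_eq_nsmul 𝕂, smul_smul, Nat.factorial_succ, Nat.cast_mul, mul_inv,
      ← mul_assoc ((n + 1 : ℕ) : 𝕂), mul_inv_cancel₀ h2, one_mul, ← mul_assoc, pow_succ']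
  have hg0 : g 0 = q + x := by simp [hg]
  have hgK : ∀ n, K ≤ n → g n = 0 := by
    intro n hn
    rw [hg]
    simp only [pow_eq_zero_of_le hn hD, smul_zero, zero_mul]
  have key := riccati_graph hpq hy hg1 (by rw [hg0, hy0, mul_add, mul_add, hpq0, hpx, hxq, hxx]; abel)
  have hsum : ∑ n ∈ Finset.range K, g n = nilExp 𝕂 D * (q + x) := by
    rw [nilExp_eq_sum 𝕂 hD, Finset.sum_mul]
  -- Summation over n sets t = 1: `key` says that the flow stays on the graph of y(t) as a power
  -- series in t.
  have h1 := sum_antidiagonal_eq_mul_sum hyK hgK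
  simp only [← key, ← Finset.mul_sum] at h1
  have h2 : ∑ n ∈ Finset.range (2 * K), g n = ∑ n ∈ Finset.range K, g n := by
    refine (Finset.sum_subset (fun n hn => ?_) fun n _ hn => hgK n ?_).symm
    · rw [Finset.mem_range] at hn ⊢; omega
    · rw [Finset.mem_range] at hn; omega
  rw [sub_mul, ← hsum, ← h1, h2, sub_self]

end AbstractGauge

namespace Pair

variable {𝕂 : Type k} {R V : Type u} [Field 𝕂] [CommRing R] [Algebra 𝕂 R]
  [AddCommGroup V] [Module 𝕂 V] [Module R V] [IsScalarTower 𝕂 R V] {P : Pair 𝕂 R V}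
  {S : P.Splitting} {𝒜 : ArtAlg.{k, v} 𝕂} [CharZero 𝕂]

/-- The two equal terms of [ξ, ξ, b]₃ cancel 1 / 2!, and the result is -(p - x) D (q + x), minus the
velocity of the graph of ξ under D. -/
theorem thickForm_tw1 (ξ : 𝒜.max ⊗[𝕂] P.Ext 1) (b : 𝒜.max ⊗[𝕂] P.Ext 0) :
    thickForm S 𝒜 ((extended S).tw1 ξ b) =
      -(thickB S 𝒜 * thickGauge S 𝒜 b * thickA S 𝒜) +
      (thickForm S 𝒜 ξ * thickGauge S 𝒜 b * thickA S 𝒜 -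
        thickB S 𝒜 * thickGauge S 𝒜 b * thickForm S 𝒜 ξ) +
      thickForm S 𝒜 ξ * thickGauge S 𝒜 b * thickForm S 𝒜 ξ := by
  rw [CubicBrackets.tw1, map_add, map_add, map_smul]
  change thickForm S 𝒜 (ext1 𝒜 (h1 S 0) b) + thickForm S 𝒜 (ext2 𝒜 (h2 S 1 0 1) ξ b) +
    (2 ! : 𝕂)⁻¹ • thickForm S 𝒜 (ext3 𝒜 (h3 S 1 1 0 1) ξ ξ b) = _
  rw [thickForm_h1, thickForm_h2_one_zero, thickForm_h3_one_one_zero, ← two_smul 𝕂, smul_smul]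
  norm_num

theorem thickForm_tw2 (ξ : 𝒜.max ⊗[𝕂] P.Ext 1) (b : 𝒜.max ⊗[𝕂] P.Ext 0)
    (x : 𝒜.max ⊗[𝕂] P.Ext 1) :
    thickForm S 𝒜 ((extended S).tw2 ξ b x) =
      thickB S 𝒜 * thickGauge S 𝒜 b * thickForm S 𝒜 x -
        thickForm S 𝒜 x * thickGauge S 𝒜 b * thickA S 𝒜 -
      (thickForm S 𝒜 ξ * thickGauge S 𝒜 b * thickForm S 𝒜 x +
        thickForm S 𝒜 x * thickGauge S 𝒜 b * thickForm S 𝒜 ξ) := by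
  rw [CubicBrackets.tw2, map_add]
  change thickForm S 𝒜 (ext2 𝒜 (h2 S 0 1 1) b x) +
    thickForm S 𝒜 (ext3 𝒜 (h3 S 1 0 1 1) ξ b x) = _
  rw [thickForm_h2_zero_one, thickForm_h3_one_zero_one, ← sub_eq_add_neg]

theorem thickForm_tw3 (b : 𝒜.max ⊗[𝕂] P.Ext 0) (x y : 𝒜.max ⊗[𝕂] P.Ext 1) :
    thickForm S 𝒜 ((extended S).tw3 b x y) =
      thickForm S 𝒜 x * thickGauge S 𝒜 b * thickForm S 𝒜 y +
        thickForm S 𝒜 y * thickGauge S 𝒜 b * thickForm S 𝒜 x :=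
  thickForm_h3_zero_one_one b x y

variable (S)

/-- The operators of the terms of `e^b * ξ`. -/
def gaugeCoeff (ξ : 𝒜.max ⊗[𝕂] P.Ext 1) (b : 𝒜.max ⊗[𝕂] P.Ext 0) : ℕ → Module.End 𝒜 (Thick 𝒜 V)
  | 0 => thickForm S 𝒜 ξ
  | n + 1 => -(((n + 1) ! : 𝕂)⁻¹ • thickForm S 𝒜 ((extended S).gaugeTerm ξ b n))

theorem gaugeCoeff_riccati (ξ : 𝒜.max ⊗[𝕂] P.Ext 1) (b : 𝒜.max ⊗[𝕂] P.Ext 0) (n : ℕ) :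
    (n + 1) • gaugeCoeff S ξ b (n + 1) =
      (if n = 0 then thickB S 𝒜 * thickGauge S 𝒜 b * thickA S 𝒜 else 0)
      + thickB S 𝒜 * thickGauge S 𝒜 b * gaugeCoeff S ξ b n
      - gaugeCoeff S ξ b n * thickGauge S 𝒜 b * thickA S 𝒜
      - ∑ kl ∈ Finset.HasAntidiagonal.antidiagonal n,
        gaugeCoeff S ξ b kl.1 * thickGauge S 𝒜 b * gaugeCoeff S ξ b kl.2 := by
  refine riccati_of_gauge_recursion (𝕂 := 𝕂) (x := thickForm S 𝒜 ξ)
    (t := fun n => thickForm S 𝒜 ((extended S).gaugeTerm ξ b n)) ?_ (fun n => ?_) rfl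
    (fun _ => rfl) n
  · simp only [CubicBrackets.gaugeTerm]
    rw [thickForm_tw1]
  · rw [CubicBrackets.gaugeTerm, map_add, map_smul, map_sum, thickForm_tw2]
    simp only [map_smul, thickForm_tw3]

/-- Each summand of the Riccati recursion contains one more factor D, which has values in 𝔪. So the
coefficient of index n has values in 𝔪ⁿ, and the exponential series terminates. -/
theorem gaugeCoeff_mem (ξ : 𝒜.max ⊗[𝕂] P.Ext 1) (b : 𝒜.max ⊗[𝕂] P.Ext 0) (n : ℕ) :
    gaugeCoeff S ξ b n ∈ endFil 𝒜.max (Thick 𝒜 V) n := by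
  induction n using Nat.strongRec with
  | ind n ih =>
    cases n with
    | zero => exact mem_endFil_zero _
    | succ n =>
      have hD := thickGauge_mem (S := S) b
      have h2 : ((n + 1 : ℕ) : 𝕂) ≠ 0 := Nat.cast_ne_zero.2 (by omega)
      have hmem : (n + 1) • gaugeCoeff S ξ b (n + 1) ∈ endFil 𝒜.max (Thick 𝒜 V) (n + 1) := by
        rw [gaugeCoeff_riccati]
        refine Submodule.sub_mem _ (Submodule.sub_mem _ (Submodule.add_mem _ ?_ ?_) ?_)
          (Submodule.sum_mem _ fun kl hkl => ?_)
        · split_ifs with h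
          · subst h
            exact mul_right_mem_endFil (mul_left_mem_endFil _ hD) _
          · exact Submodule.zero_mem _
        · rw [mul_assoc, add_comm n]
          exact mul_left_mem_endFil _ (mul_mem_endFil hD (ih n (by omega)))
        · exact mul_right_mem_endFil (mul_mem_endFil (ih n (by omega)) hD) _
        · have hk := Finset.HasAntidiagonal.mem_antidiagonal.1 hkl
          rw [← hk, add_right_comm]
          exact mul_mem_endFil (mul_mem_endFil (ih kl.1 (by omega)) hD) (ih kl.2 (by omega))
      -- The factor n + 1 is invertible in 𝕂 and is removed.
      have := Submodule.smul_mem (endFil 𝒜.max (Thick 𝒜 V) (n + 1))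
        (algebraMap 𝕂 𝒜 ((n + 1 : ℕ) : 𝕂)⁻¹) hmem
      rwa [algebraMap_smul, ← Nat.cast_smul_eq_nsmul 𝕂, smul_smul, inv_mul_cancel₀ h2,
        one_smul] at this

theorem thickForm_sub_sum_gaugeTerm (ξ : 𝒜.max ⊗[𝕂] P.Ext 1) (b : 𝒜.max ⊗[𝕂] P.Ext 0) (N : ℕ) :
    thickForm S 𝒜 (ξ - ∑ n ∈ Finset.range N, ((n + 1) ! : 𝕂)⁻¹ • (extended S).gaugeTerm ξ b n) =
      ∑ n ∈ Finset.range (N + 1), gaugeCoeff S ξ b n := by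
  rw [Finset.sum_range_succ', map_sub, map_sum]
  simp only [gaugeCoeff, Finset.sum_neg_distrib, map_smul]
  abel

/-- The bound is the nilpotency exponent of 𝔪 and does not depend on ξ or b. -/
theorem exists_gauge_aux (𝒜 : ArtAlg.{k, v} 𝕂) : ∃ K, ∀ (ξ : 𝒜.max ⊗[𝕂] P.Ext 1)
    (b : 𝒜.max ⊗[𝕂] P.Ext 0), thickGauge S 𝒜 b ^ (K + 1) = 0 ∧
      ∀ N, K + 1 ≤ N → gaugeCoeff S ξ b N = 0 := by
  obtain ⟨K, hK⟩ := 𝒜.exists_max_pow_eq_bot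
  exact ⟨K, fun ξ b => ⟨eq_zero_of_mem_endFil hK (by omega) (pow_mem_endFil (thickGauge_mem b) _),
    fun N hN => eq_zero_of_mem_endFil hK (by omega) (gaugeCoeff_mem S ξ b N)⟩⟩

theorem exists_gauge (ξ : 𝒜.max ⊗[𝕂] P.Ext 1) (b : 𝒜.max ⊗[𝕂] P.Ext 0) :
    ∃ η, ∀ᶠ N in Filter.atTop,
      η = ξ - ∑ n ∈ Finset.range N, ((n + 1) ! : 𝕂)⁻¹ • (extended S).gaugeTerm ξ b n := by
  obtain ⟨K, hK⟩ := exists_gauge_aux S 𝒜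
  refine ⟨ξ - ∑ n ∈ Finset.range K, ((n + 1) ! : 𝕂)⁻¹ • (extended S).gaugeTerm ξ b n,
    Filter.eventually_atTop.2 ⟨K, fun N hN => ?_⟩⟩
  apply thickForm_injective S 𝒜
  rw [thickForm_sub_sum_gaugeTerm, thickForm_sub_sum_gaugeTerm]
  refine Finset.sum_subset (fun n hn => ?_) fun n _ hn => (hK ξ b).2 n ?_
  · rw [Finset.mem_range] at hn ⊢; omega
  · rw [Finset.mem_range] at hn; omega

variable {S}

/-- The equation says that exp D maps the graph of ξ into the graph of η = e^b * ξ, the graphs being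
the image of q + x and the kernel of p - y. It follows from `nilExp_graph`, as the terms of e^b * ξ
solve the Riccati equation. -/
theorem nilExp_mul_graph {ξ η : 𝒜.max ⊗[𝕂] P.Ext 1} {b : 𝒜.max ⊗[𝕂] P.Ext 0}
    (h : ∀ᶠ N in Filter.atTop,
      η = ξ - ∑ n ∈ Finset.range N, ((n + 1) ! : 𝕂)⁻¹ • (extended S).gaugeTerm ξ b n) :
    (thickB S 𝒜 - thickForm S 𝒜 η) *
      (nilExp 𝕂 (thickGauge S 𝒜 b) * (thickA S 𝒜 + thickForm S 𝒜 ξ)) = 0 := by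
  obtain ⟨N, hN⟩ := Filter.eventually_atTop.1 h
  obtain ⟨K, hK⟩ := exists_gauge_aux S 𝒜
  obtain ⟨hD, hy⟩ := hK ξ b
  -- The truncation must be late enough both for the formula for η to hold and for all later
  -- coefficients to vanish.
  have hη := hN (Nat.max N K) (le_max_left _ _)
  have hKK : K ≤ Nat.max N K := le_max_right _ _
  rw [hη, thickForm_sub_sum_gaugeTerm]
  exact nilExp_graph (thickB_add_thickA S 𝒜) (thickB_mul_thickA) (thickB_mul_thickForm ξ)
    (thickForm_mul_thickA ξ) (thickForm_mul_thickForm ξ ξ) (gaugeCoeff_riccati S ξ b) rfl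
    (pow_eq_zero_of_le (by omega) hD) (fun n hn => hy n (by omega))

end Pair

end LieDef
end

noncomputable section

set_option maxSynthPendingDepth 3

namespace LieDef

/-! ### The Maurer–Cartan equation as closedness of the graph -/

namespace Pair

variable {𝕂 : Type k} {R V : Type u} [Field 𝕂] [CommRing R] [Algebra 𝕂 R]
  [AddCommGroup V] [Module 𝕂 V] [Module R V] [IsScalarTower 𝕂 R V] {P : Pair 𝕂 R V}

theorem extBilin_eq_toLin (x : P.Ext 2) (a b : P.sub) :
    extBilin x a b = toLin (AlternatingMap.curryLeft (P.formOf 2 x) a) b := by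
  rw [toLin_apply, AlternatingMap.curryLeft_apply_apply]
  refine congrArg (P.formOf 2 x) (funext fun i => ?_)
  fin_cases i <;> rfl

theorem extBilin_add (x y : P.Ext 2) (a b : P.sub) :
    extBilin (x + y) a b = extBilin x a b + extBilin y a b := rfl

theorem extBilin_smul (c : 𝕂) (x : P.Ext 2) (a b : P.sub) :
    extBilin (c • x) a b = c • extBilin x a b := rfl

variable (S : P.Splitting)

/-- The bilinear operation `(u, v) ↦ j X (Pr_A u, Pr_A v)` of a `2`-form `X`. -/
def formOp₂ : P.Ext 2 →ₗ[𝕂] V →ₗ[𝕂] V →ₗ[𝕂] V :=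
  mk₃ (fun x u v => S.toFun (extBilin x (prA S u) (prA S v)))
    (fun x y u v => by rw [extBilin_add, map_add])
    (fun c x u v => by rw [extBilin_smul, LinearMap.map_smul_of_tower])
    (fun x u u' v => by
      rw [← map_add, map_add (prA S)]
      simp only [extBilin_eq_toLin, map_add, toLin_apply, AlternatingMap.add_apply])
    (fun c x u v => by
      rw [LinearMap.map_smul_of_tower, ← LinearMap.map_smul_of_tower S.toFun,
        ← algebraMap_smul R c (prA S u), extBilin_eq_toLin, map_smul, toLin_apply,
        AlternatingMap.smul_apply, algebraMap_smul, ← toLin_apply, ← extBilin_eq_toLin])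
    (fun x u v v' => by simp only [extBilin_eq_toLin, map_add])
    (fun c x u v => by simp only [extBilin_eq_toLin, LinearMap.map_smul_of_tower])

theorem formOp₂_apply (x : P.Ext 2) (u v : V) :
    formOp₂ S x u v = S.toFun (extBilin x (prA S u) (prA S v)) := rfl

theorem formOp₂_injective : Function.Injective (formOp₂ S) := by
  intro x y h
  have h2 : P.formOf 2 x = P.formOf 2 y := by
    refine AlternatingMap.ext fun u => ?_
    have := congrArg P.prB (LinearMap.congr_fun (LinearMap.congr_fun h (u 0 : V)) (u 1 : V))
    rw [formOp₂_apply, formOp₂_apply, prB_j, prB_j, prA_coe, prA_coe] at this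
    have hu : u = ![u 0, u 1] := by funext i; fin_cases i <;> rfl
    rw [hu]
    exact this
  exact h2

variable (𝒜 : ArtAlg.{k, v} 𝕂)

/-- The bilinear operation on `Γ(L_𝒜)` of an element of `𝔪 ⊗ Ω²_A(B)`. -/
def thickForm₂ : 𝒜.max ⊗[𝕂] P.Ext 2 →ₗ[𝕂] Thick 𝒜 V →ₗ[𝒜] Thick 𝒜 V →ₗ[𝒜] Thick 𝒜 V :=
  ten₂ 𝒜 (formOp₂ S)

/-- The operation `(u, v) ↦ f [g u, h v]`. -/
def sandwich (P : Pair 𝕂 R V) (𝒜 : ArtAlg.{k, v} 𝕂) :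
    Module.End 𝒜 (Thick 𝒜 V) →ₗ[𝒜] Module.End 𝒜 (Thick 𝒜 V) →ₗ[𝒜] Module.End 𝒜 (Thick 𝒜 V) →ₗ[𝒜]
      Thick 𝒜 V →ₗ[𝒜] Thick 𝒜 V →ₗ[𝒜] Thick 𝒜 V :=
  LinearMap.mk₂ 𝒜 (fun f g =>
    { toFun := fun h => ((extBil 𝒜 P.bracket).compl₁₂ g h).compr₂ f
      map_add' := fun h h' => by ext; simp
      map_smul' := fun c h => by ext; simp })
    (fun f f' g => by ext; simp) (fun c f g => by ext; simp)
    (fun f g g' => by ext; simp) (fun c f g => by ext; simp)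

theorem sandwich_apply (f g h : Module.End 𝒜 (Thick 𝒜 V)) (u v : Thick 𝒜 V) :
    sandwich P 𝒜 f g h u v = f (extBil 𝒜 P.bracket (g u) (h v)) := rfl

theorem thickForm₂_tmul (a : 𝒜.max) (x : P.Ext 2) :
    thickForm₂ S 𝒜 (a ⊗ₜ x) = (a : 𝒜) • extBil 𝒜 (formOp₂ S x) := rfl

variable {S 𝒜}

section
variable {ξ : 𝒜.max ⊗[𝕂] P.Ext 1}

theorem sandwich_baseChange_inc (f g h : Module.End 𝕂 V) (u v : V) :
    sandwich P 𝒜 (f.baseChange 𝒜) (g.baseChange 𝒜) (h.baseChange 𝒜) (inc 𝒜 u) (inc 𝒜 v) =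
      inc 𝒜 (f (P.bracket (g u) (h v))) := by
  rw [sandwich_apply, baseChange_inc, baseChange_inc, extBil_inc, baseChange_inc]

theorem thickForm₂_h2 (x y : 𝒜.max ⊗[𝕂] P.Ext 1) :
    thickForm₂ S 𝒜 (ext2 𝒜 (h2 S 1 1 2) x y) =
      sandwich P 𝒜 (thickB S 𝒜) (thickForm S 𝒜 x) (thickForm S 𝒜 y)
      + sandwich P 𝒜 (thickB S 𝒜) (thickForm S 𝒜 y) (thickForm S 𝒜 x)
      - sandwich P 𝒜 (thickForm S 𝒜 y) (thickForm S 𝒜 x) (thickA S 𝒜)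
      - sandwich P 𝒜 (thickForm S 𝒜 x) (thickForm S 𝒜 y) (thickA S 𝒜)
      - sandwich P 𝒜 (thickForm S 𝒜 y) (thickA S 𝒜) (thickForm S 𝒜 x)
      - sandwich P 𝒜 (thickForm S 𝒜 x) (thickA S 𝒜) (thickForm S 𝒜 y) := by
  induction x with
  | zero => simp
  | add x x' hx hx' =>
    simp only [map_add, LinearMap.add_apply, hx, hx']
    abel
  | tmul a x =>
    induction y with
    | zero => simp
    | add y y' hy hy' =>
      simp only [map_add, LinearMap.add_apply, hy, hy']
      abel
    | tmul c y =>
      rw [ext2_tmul, thickForm₂_tmul]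
      simp only [thickForm_tmul, LinearMap.map_smul, LinearMap.smul_apply]
      refine bil_ext 𝒜 fun u v => ?_
      simp only [LinearMap.sub_apply, LinearMap.add_apply, LinearMap.smul_apply, thickA, thickB,
        sandwich_baseChange_inc, extBil_inc]
      rw [formOp₂_apply, h2_one_one]
      have e : ((𝒜.mulMax a c : 𝒜.max) : 𝒜) = a * c := rfl
      simp only [e, map_add, map_sub, projB_apply, projA_apply, formOp_apply]
      module

variable [CharZero 𝕂]

theorem thickForm₂_h1 (x : 𝒜.max ⊗[𝕂] P.Ext 1) :
    thickForm₂ S 𝒜 (ext1 𝒜 (h1 S 1) x) =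
      sandwich P 𝒜 (thickB S 𝒜) (thickA S 𝒜) (thickForm S 𝒜 x)
      + sandwich P 𝒜 (thickB S 𝒜) (thickForm S 𝒜 x) (thickA S 𝒜)
      - sandwich P 𝒜 (thickForm S 𝒜 x) (thickA S 𝒜) (thickA S 𝒜) := by
  induction x with
  | zero => simp
  | add x x' hx hx' =>
    simp only [map_add, LinearMap.add_apply, hx, hx']
    abel
  | tmul a x =>
    rw [ext1, LinearMap.lTensor_tmul, thickForm₂_tmul]
    simp only [thickForm_tmul, LinearMap.map_smul, LinearMap.smul_apply]
    refine bil_ext 𝒜 fun u v => ?_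
    simp only [LinearMap.sub_apply, LinearMap.add_apply, LinearMap.smul_apply, thickA, thickB,
      sandwich_baseChange_inc, extBil_inc]
    simp only [← smul_add, ← smul_sub, ← map_add, ← map_sub]
    congr 2
    rw [formOp₂_apply, h1_one]
    simp only [map_add, map_sub]
    rfl

theorem thickForm₂_h3 (x y z : 𝒜.max ⊗[𝕂] P.Ext 1) :
    thickForm₂ S 𝒜 (ext3 𝒜 (h3 S 1 1 1 2) x y z) =
      - (sandwich P 𝒜 (thickForm S 𝒜 z) (thickForm S 𝒜 x) (thickForm S 𝒜 y) +
        sandwich P 𝒜 (thickForm S 𝒜 z) (thickForm S 𝒜 y) (thickForm S 𝒜 x))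
      - (sandwich P 𝒜 (thickForm S 𝒜 x) (thickForm S 𝒜 y) (thickForm S 𝒜 z) +
        sandwich P 𝒜 (thickForm S 𝒜 x) (thickForm S 𝒜 z) (thickForm S 𝒜 y))
      - (sandwich P 𝒜 (thickForm S 𝒜 y) (thickForm S 𝒜 z) (thickForm S 𝒜 x) +
        sandwich P 𝒜 (thickForm S 𝒜 y) (thickForm S 𝒜 x) (thickForm S 𝒜 z)) := by
  refine ext3_induction (f := fun x y z => thickForm₂ S 𝒜 (ext3 𝒜 (h3 S 1 1 1 2) x y z))
    (g := fun x y z => - (sandwich P 𝒜 (thickForm S 𝒜 z) (thickForm S 𝒜 x) (thickForm S 𝒜 y) +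
        sandwich P 𝒜 (thickForm S 𝒜 z) (thickForm S 𝒜 y) (thickForm S 𝒜 x))
      - (sandwich P 𝒜 (thickForm S 𝒜 x) (thickForm S 𝒜 y) (thickForm S 𝒜 z) +
        sandwich P 𝒜 (thickForm S 𝒜 x) (thickForm S 𝒜 z) (thickForm S 𝒜 y))
      - (sandwich P 𝒜 (thickForm S 𝒜 y) (thickForm S 𝒜 z) (thickForm S 𝒜 x) +
        sandwich P 𝒜 (thickForm S 𝒜 y) (thickForm S 𝒜 x) (thickForm S 𝒜 z)))
    (by simp) (by simp) (by simp) ?_ ?_ ?_ (fun a x c y d z => ?_) x y z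
  · intros; simp only [map_add, LinearMap.add_apply]; abel
  · intros; simp only [map_add, LinearMap.add_apply]; abel
  · intros; simp only [map_add, LinearMap.add_apply]; abel
  · simp only [ext3_tmul, thickForm₂_tmul, thickForm_tmul, LinearMap.map_smul,
      LinearMap.smul_apply]
    refine bil_ext 𝒜 fun u v => ?_
    simp only [LinearMap.sub_apply, LinearMap.add_apply, LinearMap.neg_apply, LinearMap.smul_apply,
      sandwich_baseChange_inc, extBil_inc, formOp₂_apply, h3_one_one_one, map_sub, map_neg, map_add,
      smul_smul]
    have e : ((𝒜.mulMax (𝒜.mulMax a c) d : 𝒜.max) : 𝒜) = a * c * d := rfl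
    simp only [e, formOp_apply]
    module

/-- With equal arguments each term of the binary bracket occurs twice and the term of the ternary
bracket six times, which cancels 1 / 2! and 1 / 3!. -/
theorem cubic_sum {M : Type*} [AddCommGroup M] [Module 𝕂 M] (a b c d e f g : M) :
    (a + b - c) + (2 ! : 𝕂)⁻¹ • (d + d - e - e - f - f)
      + (3 ! : 𝕂)⁻¹ • (-(g + g) - (g + g) - (g + g)) = a + b - c + d - e - f - g := by
  have e2 : (2 ! : 𝕂)⁻¹ = 1 / 2 := by norm_num
  have e3 : (3 ! : 𝕂)⁻¹ = 1 / 6 := by norm_num [Nat.factorial]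
  rw [e2, e3]
  module

/-- In the expansion by degree in x, the linear, quadratic and cubic parts are those of the
Maurer–Cartan equation; the hypothesis removes the constant part. -/
theorem sandwich_sub_add_add {p q x : Module.End 𝒜 (Thick 𝒜 V)} (h : sandwich P 𝒜 p q q = 0) :
    sandwich P 𝒜 (p - x) (q + x) (q + x) = sandwich P 𝒜 p q x
      + sandwich P 𝒜 p x q - sandwich P 𝒜 x q q + sandwich P 𝒜 p x x - sandwich P 𝒜 x x q
      - sandwich P 𝒜 x q x - sandwich P 𝒜 x x x := by
  refine LinearMap.ext fun u => LinearMap.ext fun v => ?_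
  have h' : p (extBil 𝒜 P.bracket (q u) (q v)) = 0 :=
    LinearMap.congr_fun (LinearMap.congr_fun h u) v
  simp only [sandwich_apply, LinearMap.sub_apply, LinearMap.add_apply, map_add, h']
  abel

/-- The left-hand side of the Maurer–Cartan equation, read as a bilinear operation, is exactly (p -
x)[(q + x)u, (q + x)v]. It vanishes iff the bracket of two elements of the graph lies in the kernel
of p - x, which is the graph. -/
theorem isMC_iff (ξ : 𝒜.max ⊗[𝕂] P.Ext 1) : (extended S).IsMC 𝒜 ξ ↔
    ∀ u v, (thickB S 𝒜 - thickForm S 𝒜 ξ) (extBil 𝒜 P.bracket ((thickA S 𝒜 + thickForm S 𝒜 ξ) u)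
      ((thickA S 𝒜 + thickForm S 𝒜 ξ) v)) = 0 := by
  -- This is where A is used to be closed under the bracket: for ξ = 0 the graph is A itself.
  have h0 : sandwich P 𝒜 (thickB S 𝒜) (thickA S 𝒜) (thickA S 𝒜) = 0 := by
    refine bil_ext 𝒜 fun u v => ?_
    rw [thickA, thickB, sandwich_baseChange_inc]
    have : projB S (P.bracket (projA S u) (projA S v)) = 0 := by
      have h := prB_coe (P := P) ⟨_, P.bracket_mem _ (prA S u).2 _ (prA S v).2⟩
      rw [projB_apply, projA_apply, projA_apply, h, map_zero]
    rw [this, map_zero]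
    rfl
  have key : thickForm₂ S 𝒜 (ext1 𝒜 (h1 S 1) ξ + (2 ! : 𝕂)⁻¹ • ext2 𝒜 (h2 S 1 1 2) ξ ξ
      + (3 ! : 𝕂)⁻¹ • ext3 𝒜 (h3 S 1 1 1 2) ξ ξ ξ) =
      sandwich P 𝒜 (thickB S 𝒜 - thickForm S 𝒜 ξ) (thickA S 𝒜 + thickForm S 𝒜 ξ)
        (thickA S 𝒜 + thickForm S 𝒜 ξ) := by
    rw [map_add, map_add, map_smul, map_smul, thickForm₂_h1, thickForm₂_h2, thickForm₂_h3,
      cubic_sum, sandwich_sub_add_add h0]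
  constructor
  · intro h u v
    have h' := key.symm.trans ((congrArg (thickForm₂ S 𝒜) h).trans (map_zero _))
    exact LinearMap.congr_fun (LinearMap.congr_fun h' u) v
  · intro h
    refine ten₂_injective (formOp₂_injective S) (Eq.trans ?_ (map_zero _).symm)
    refine key.trans (LinearMap.ext fun u => LinearMap.ext fun v => h u v)

end

end Pair

end LieDef
end

noncomputable section

set_option maxSynthPendingDepth 3

namespace LieDef

/-! ### Graphs as infinitesimal deformations -/

section Thick
variable {𝕂 : Type k} {R : Type u} [Field 𝕂] [CommRing R] [Algebra 𝕂 R] {𝒜 ℬ : ArtAlg.{k, v} 𝕂}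
  {X Y Z : Type u} [AddCommGroup X] [Module 𝕂 X] [Module R X]
  [IsScalarTower 𝕂 R X] [AddCommGroup Y] [Module 𝕂 Y] [Module R Y] [IsScalarTower 𝕂 R Y]
  [AddCommGroup Z] [Module 𝕂 Z]

theorem evT_baseChange (f : X →ₗ[𝕂] Y) (x : Thick 𝒜 X) :
    evT 𝒜 (f.baseChange 𝒜 x) = f (evT 𝒜 x) := evT_lTensor f x

theorem evT_extBil (f : X →ₗ[𝕂] Y →ₗ[𝕂] Z) (x : Thick 𝒜 X) (y : Thick 𝒜 Y) :
    evT 𝒜 (extBil 𝒜 f x y) = f (evT 𝒜 x) (evT 𝒜 y) := by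
  induction x using thick_induction with
  | hs a x hx => simp only [map_smul, LinearMap.smul_apply, evT_smul, hx]
  | ha x y hx hy => simp only [map_add, LinearMap.add_apply, hx, hy]
  | hi x =>
    induction y using thick_induction with
    | hs a x hx => simp only [map_smul, evT_smul, hx]
    | ha x y hx hy => simp only [map_add, hx, hy]
    | hi y => rw [extBil_inc, evT_inc, evT_inc, evT_inc]

theorem rsm_baseChange (g : X →ₗ[R] Y) (f : Thick 𝒜 R) (x : Thick 𝒜 X) :
    (g.restrictScalars 𝕂).baseChange 𝒜 (rsm 𝒜 f x) =
      rsm 𝒜 f ((g.restrictScalars 𝕂).baseChange 𝒜 x) := by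
  induction x using thick_induction with
  | hs a x hx => simp only [map_smul, hx]
  | ha x y hx hy => simp only [map_add, hx, hy]
  | hi x =>
    induction f using thick_induction with
    | hs a x hx => simp only [map_smul, LinearMap.smul_apply, hx]
    | ha x y hx hy => simp only [map_add, LinearMap.add_apply, hx, hy]
    | hi f =>
      rw [rsm_inc, baseChange_inc, baseChange_inc, rsm_inc]
      exact congrArg (inc 𝒜) (map_smul g f x)

theorem pushT_baseChange (ϑ : 𝒜 ⟶ ℬ) (f : X →ₗ[𝕂] Y) (x : Thick 𝒜 X) :
    f.baseChange ℬ (pushT ϑ x) = pushT ϑ (f.baseChange 𝒜 x) :=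
  lin_pushT ϑ (fun x => by rw [baseChange_inc, baseChange_inc, pushT_inc]) x

theorem pushT_extBil (ϑ : 𝒜 ⟶ ℬ) (f : X →ₗ[𝕂] Y →ₗ[𝕂] Z) (x : Thick 𝒜 X) (y : Thick 𝒜 Y) :
    extBil ℬ f (pushT ϑ x) (pushT ϑ y) = pushT ϑ (extBil 𝒜 f x y) :=
  bil_pushT ϑ (fun x y => by rw [extBil_inc, extBil_inc, pushT_inc]) x y

/-- The identity of `E_𝒜`. -/
def RingedMap.id (𝒜 : ArtAlg.{k, v} 𝕂) (R X : Type u) [CommRing R] [Algebra 𝕂 R] [AddCommGroup X]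
    [Module 𝕂 X] [Module R X] [IsScalarTower 𝕂 R X] : RingedMap 𝒜 R X X where
  toFun := LinearMap.id
  base := AlgHom.id _ _
  ev_base f := evT_inc 𝒜 f
  map_smul _ _ := rfl

theorem RingedMap.isLieHom_id (Q : RingedLA 𝒜 R X) : (RingedMap.id 𝒜 R X).IsLieHom Q Q where
  map_bracket _ _ := rfl
  map_anchor _ _ := rfl

end Thick

namespace Pair

variable {𝕂 : Type k} {R V : Type u} [Field 𝕂] [CommRing R] [Algebra 𝕂 R]
  [AddCommGroup V] [Module 𝕂 V] [Module R V] [IsScalarTower 𝕂 R V] {P : Pair 𝕂 R V}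

/-- The inclusion `Γ(A_𝒜) → Γ(L_𝒜)`. -/
def thickIncl (P : Pair 𝕂 R V) (𝒜 : ArtAlg.{k, v} 𝕂) : Thick 𝒜 P.sub →ₗ[𝒜] Thick 𝒜 V :=
  (P.sub.subtype.restrictScalars 𝕂).baseChange 𝒜

variable (S : P.Splitting) (𝒜 ℬ : ArtAlg.{k, v} 𝕂)

/-- The projection `Γ(L_𝒜) → Γ(A_𝒜)`. -/
def thickProj : Thick 𝒜 V →ₗ[𝒜] Thick 𝒜 P.sub := ((prA S).restrictScalars 𝕂).baseChange 𝒜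

variable {𝒜 ℬ}

theorem thickProj_thickIncl (a : Thick 𝒜 P.sub) : thickProj S 𝒜 (thickIncl P 𝒜 a) = a := by
  have : thickProj S 𝒜 ∘ₗ thickIncl P 𝒜 = LinearMap.id := by
    refine lin_ext 𝒜 fun a => ?_
    rw [LinearMap.comp_apply, thickProj, thickIncl, baseChange_inc, baseChange_inc]
    exact congrArg (inc 𝒜) (prA_coe S a)
  exact LinearMap.congr_fun this a

theorem thickIncl_thickProj (u : Thick 𝒜 V) : thickIncl P 𝒜 (thickProj S 𝒜 u) = thickA S 𝒜 u := by
  have : thickIncl P 𝒜 ∘ₗ thickProj S 𝒜 = thickA S 𝒜 := by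
    refine lin_ext 𝒜 fun a => ?_
    rw [LinearMap.comp_apply, thickProj, thickIncl, baseChange_inc, baseChange_inc, thickA,
      baseChange_inc]
    rfl
  exact LinearMap.congr_fun this u

theorem thickProj_thickB (u : Thick 𝒜 V) : thickProj S 𝒜 (thickB S 𝒜 u) = 0 := by
  have : thickProj S 𝒜 ∘ₗ thickB S 𝒜 = 0 := by
    refine lin_ext 𝒜 fun v => ?_
    rw [LinearMap.comp_apply, thickProj, thickB, baseChange_inc, baseChange_inc]
    change inc 𝒜 (prA S (S.toFun (P.prB v))) = 0
    rw [prA_j, map_zero]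
  exact LinearMap.congr_fun this u

theorem thickProj_thickForm (ξ : 𝒜.max ⊗[𝕂] P.Ext 1) (u : Thick 𝒜 V) :
    thickProj S 𝒜 (thickForm S 𝒜 ξ u) = 0 := by
  rw [← thickB_mul_thickForm, Module.End.mul_apply, thickProj_thickB]

theorem thickForm_rsm (ξ : 𝒜.max ⊗[𝕂] P.Ext 1) (f : Thick 𝒜 R) (u : Thick 𝒜 V) :
    thickForm S 𝒜 ξ (rsm 𝒜 f u) = rsm 𝒜 f (thickForm S 𝒜 ξ u) := by
  induction ξ with
  | zero => simp
  | add x y hx hy => simp only [map_add, LinearMap.add_apply, hx, hy]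
  | tmul a x =>
    have : formOp S x = (S.toFun ∘ₗ extLin x ∘ₗ prA S).restrictScalars 𝕂 := rfl
    rw [thickForm_tmul, this, LinearMap.smul_apply, LinearMap.smul_apply, rsm_baseChange, map_smul]

/-- The inclusion of `Γ(A_𝒜)` in `Γ(L_𝒜)` with image the graph of `ξ`. -/
def graphMap (ξ : 𝒜.max ⊗[𝕂] P.Ext 1) : Thick 𝒜 P.sub →ₗ[𝒜] Thick 𝒜 V :=
  (LinearMap.id + thickForm S 𝒜 ξ) ∘ₗ thickIncl P 𝒜

theorem graphMap_apply (ξ : 𝒜.max ⊗[𝕂] P.Ext 1) (a : Thick 𝒜 P.sub) :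
    graphMap S ξ a = thickIncl P 𝒜 a + thickForm S 𝒜 ξ (thickIncl P 𝒜 a) := rfl

theorem thickProj_graphMap (ξ : 𝒜.max ⊗[𝕂] P.Ext 1) (a : Thick 𝒜 P.sub) :
    thickProj S 𝒜 (graphMap S ξ a) = a := by
  rw [graphMap_apply, map_add, thickProj_thickIncl, thickProj_thickForm, add_zero]

theorem graphMap_thickProj (ξ : 𝒜.max ⊗[𝕂] P.Ext 1) (u : Thick 𝒜 V) :
    graphMap S ξ (thickProj S 𝒜 u) = (thickA S 𝒜 + thickForm S 𝒜 ξ) u := by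
  rw [graphMap_apply, thickIncl_thickProj, ← Module.End.mul_apply, thickForm_mul_thickA]
  rfl

theorem graphMap_eq (ξ : 𝒜.max ⊗[𝕂] P.Ext 1) (a : Thick 𝒜 P.sub) :
    graphMap S ξ a = (thickA S 𝒜 + thickForm S 𝒜 ξ) (thickIncl P 𝒜 a) := by
  rw [← graphMap_thickProj, thickProj_thickIncl]

/-- An element w with p w = x w is w = q w + x w, the point of the graph above pr_A w. -/
theorem graphMap_thickProj_of_mem {ξ : 𝒜.max ⊗[𝕂] P.Ext 1} {w : Thick 𝒜 V}
    (h : (thickB S 𝒜 - thickForm S 𝒜 ξ) w = 0) : graphMap S ξ (thickProj S 𝒜 w) = w := by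
  have h1 := LinearMap.congr_fun (thickB_add_thickA S 𝒜) w
  rw [LinearMap.sub_apply, sub_eq_zero] at h
  rw [graphMap_thickProj, LinearMap.add_apply, ← h, add_comm]
  exact h1

theorem evT_graphMap (ξ : 𝒜.max ⊗[𝕂] P.Ext 1) (a : P.sub) :
    evT 𝒜 (graphMap S ξ (inc 𝒜 a)) = a := by
  rw [graphMap_apply, thickIncl, baseChange_inc, map_add, evT_inc, thickForm, evT_ten_inc, add_zero]
  rfl

theorem graphMap_rsm (ξ : 𝒜.max ⊗[𝕂] P.Ext 1) (f : Thick 𝒜 R) (a : Thick 𝒜 P.sub) :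
    graphMap S ξ (rsm 𝒜 f a) = rsm 𝒜 f (graphMap S ξ a) := by
  rw [graphMap_apply, graphMap_apply, thickIncl, rsm_baseChange, thickForm_rsm, map_add]

theorem thickProj_rsm (f : Thick 𝒜 R) (u : Thick 𝒜 V) :
    thickProj S 𝒜 (rsm 𝒜 f u) = rsm 𝒜 f (thickProj S 𝒜 u) := rsm_baseChange _ _ _

variable [CharZero 𝕂]

theorem isMC_iff_graphMap (ξ : 𝒜.max ⊗[𝕂] P.Ext 1) : (extended S).IsMC 𝒜 ξ ↔
    ∀ a b, (thickB S 𝒜 - thickForm S 𝒜 ξ)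
      (extBil 𝒜 P.bracket (graphMap S ξ a) (graphMap S ξ b)) = 0 := by
  rw [isMC_iff]
  refine ⟨fun h a b => ?_, fun h u v => ?_⟩
  · rw [graphMap_eq, graphMap_eq, h]
  · rw [← graphMap_thickProj, ← graphMap_thickProj, h]

theorem graphMap_bracket {ξ : 𝒜.max ⊗[𝕂] P.Ext 1} (h : (extended S).IsMC 𝒜 ξ)
    (a b : Thick 𝒜 P.sub) :
    graphMap S ξ (thickProj S 𝒜 ((P.cartesian 𝒜).bracket (graphMap S ξ a) (graphMap S ξ b))) =
      (P.cartesian 𝒜).bracket (graphMap S ξ a) (graphMap S ξ b) :=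
  graphMap_thickProj_of_mem S ((isMC_iff_graphMap S ξ).1 h a b)

/-- The infinitesimal deformation of a Maurer–Cartan element. -/
def graphDef (ξ : (extended S).MC 𝒜) : P.InfDef 𝒜 where
  alg :=
    { bracket := ((P.cartesian 𝒜).bracket.compl₁₂ (graphMap S ξ.1) (graphMap S ξ.1)).compr₂
        (thickProj S 𝒜)
      anchor := (P.cartesian 𝒜).anchor ∘ₗ graphMap S ξ.1
      anchor_smul := fun f x => by
        rw [LinearMap.comp_apply, LinearMap.comp_apply, graphMap_rsm, (P.cartesian 𝒜).anchor_smul]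
      bracket_skew := fun x y => by
        simp only [LinearMap.compr₂_apply, LinearMap.compl₁₂_apply]
        rw [(P.cartesian 𝒜).bracket_skew, map_neg]
      jacobi := fun x y z => by
        -- The Maurer–Cartan equation lets `graphMap` undo `thickProj` on brackets; what remains is
        -- the Jacobi identity of L⁰_𝒜.
        simp only [LinearMap.compr₂_apply, LinearMap.compl₁₂_apply, graphMap_bracket S ξ.2]
        rw [(P.cartesian 𝒜).jacobi, map_add]
      leibniz := fun x f y => by
        simp only [LinearMap.compr₂_apply, LinearMap.compl₁₂_apply, graphMap_rsm,
          LinearMap.comp_apply]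
        rw [(P.cartesian 𝒜).leibniz, map_add, thickProj_rsm, thickProj_rsm, thickProj_graphMap] }
  ev_bracket a b := by
    simp only [LinearMap.compr₂_apply, LinearMap.compl₁₂_apply, LieRinehart.cartesian, thickProj,
      evT_baseChange, evT_extBil, evT_graphMap]
    exact congrArg Subtype.val (prA_coe S ⟨_, P.bracket_mem _ a.2 _ b.2⟩)
  ev_anchor a := by
    simp only [LinearMap.comp_apply, LieRinehart.cartesian, evT_baseChange, evT_graphMap]
    rfl
  incl :=
    { toFun := graphMap S ξ.1
      base := AlgHom.id _ _
      ev_base := fun f => evT_inc 𝒜 f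
      map_smul := graphMap_rsm S ξ.1 }
  isLieHom :=
    { map_bracket := graphMap_bracket S ξ.2
      map_anchor := fun _ _ => rfl }
  ev_incl := evT_graphMap S ξ.1

theorem graphDef_incl (ξ : (extended S).MC 𝒜) : (graphDef S ξ).incl.toFun = graphMap S ξ.1 := rfl

/-- A small automorphism of `L⁰_𝒜` which maps `A'_𝒜` to the graph of `ξ` is a weak isomorphism. -/
theorem weakIso_graphDef (ξ : (extended S).MC 𝒜) (D : P.InfDef 𝒜) (Φ : RingedMap 𝒜 R V V)
    (hΦ : Φ.IsLieHom (P.cartesian 𝒜) (P.cartesian 𝒜))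
    (hev : ∀ u : V, evT 𝒜 (Φ.toFun (inc 𝒜 u)) = u)
    (h : ∀ a, (thickB S 𝒜 - thickForm S 𝒜 ξ.1) (Φ.toFun (D.incl.toFun a)) = 0) :
    WeakIso (graphDef S ξ) D := by
  have hI : ∀ a, graphMap S ξ.1 (thickProj S 𝒜 (Φ.toFun (D.incl.toFun a))) =
      Φ.toFun (D.incl.toFun a) := fun a => graphMap_thickProj_of_mem S (h a)
  -- A base map has center the identity on functions and is 𝒜-linear, so it preserves the evaluation
  -- of all elements, and composites of base maps have center the identity as well.
  have hbase : ∀ f : R, evT 𝒜 ((Φ.base.comp D.incl.base) (inc 𝒜 f)) = f := by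
    intro f
    have key : ∀ g : Thick 𝒜 R, evT 𝒜 (Φ.base g) = evT 𝒜 g := by
      intro g
      induction g using thick_induction with
      | hs a x hx => simp only [_root_.map_smul, evT_smul, hx]
      | ha x y hx hy => simp only [map_add, hx, hy]
      | hi g => rw [Φ.ev_base, evT_inc]
    rw [AlgHom.comp_apply, key, D.incl.ev_base]
  -- The map between the copies of A_𝒜 is forced to be pr_A ∘ Φ ∘ I', since pr_A inverts `graphMap`
  -- on the graph.
  refine ⟨Φ, hΦ, hev, ⟨thickProj S 𝒜 ∘ₗ Φ.toFun ∘ₗ D.incl.toFun, Φ.base.comp D.incl.base, hbase,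
    fun f x => ?_⟩, ⟨fun x y => ?_, fun x f => ?_⟩, ?_, ?_⟩
  · simp only [LinearMap.comp_apply, AlgHom.comp_apply]
    rw [D.incl.map_smul, Φ.map_smul, thickProj_rsm]
  · simp only [LinearMap.comp_apply, graphDef, LinearMap.compr₂_apply, LinearMap.compl₁₂_apply, hI]
    rw [D.isLieHom.map_bracket, hΦ.map_bracket]
  · simp only [LinearMap.comp_apply, graphDef, AlgHom.comp_apply, hI]
    rw [D.isLieHom.map_anchor, hΦ.map_anchor]
  · refine LinearMap.ext fun a => ?_
    exact (hI a).symm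
  · rfl

/-- Base change commutes with all maps from which the deformation is built, so it suffices to
compare on sections that do not involve the parameters. This is the naturality of the bijection. -/
theorem graphDef_push (ϑ : 𝒜 ⟶ ℬ) (ξ : (extended S).MC 𝒜) :
    (graphDef S ξ).push ϑ = graphDef S ⟨push ϑ (P.Ext 1) ξ.1, ξ.2.push (extended S) ϑ⟩ := by
  have hg : ∀ a : Thick 𝒜 P.sub, graphMap S (push ϑ (P.Ext 1) ξ.1) (pushT ϑ a) =
      pushT ϑ (graphMap S ξ.1 a) := by
    intro a
    rw [graphMap_apply, graphMap_apply, thickIncl, pushT_baseChange, thickForm, pushT_ten, map_add]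
    rfl
  have hg' : ∀ a : P.sub, graphMap S (push ϑ (P.Ext 1) ξ.1) (inc ℬ a) =
      pushT ϑ (graphMap S ξ.1 (inc 𝒜 a)) := fun a => by rw [← pushT_inc ϑ, hg]
  refine InfDef.ext (RingedLA.ext_inc (fun a b => ?_) fun a => ?_)
    (RingedMap.ext_inc (fun a => ?_) fun f => ?_)
  · simp only [InfDef.push, RingedLA.push, pushBil_inc, graphDef, LinearMap.compr₂_apply,
      LinearMap.compl₁₂_apply, hg', LieRinehart.cartesian, pushT_extBil, thickProj, pushT_baseChange]
  · simp only [InfDef.push, RingedLA.push, pushLin_inc, graphDef, LinearMap.comp_apply, hg',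
      LieRinehart.cartesian, pushT_baseChange]
  · simp only [InfDef.push, RingedMap.push, pushLin_inc, graphDef, hg']
  · simp only [InfDef.push, RingedMap.push, pushBase_inc, graphDef, AlgHom.id_apply, pushT_inc]

end Pair

end LieDef
end

noncomputable section

set_option maxSynthPendingDepth 3

namespace LieDef

/-! ### Small automorphisms as exponentials of derivations -/

namespace Pair

variable {𝕂 : Type k} {R V : Type u} [Field 𝕂] [CommRing R] [Algebra 𝕂 R]
  [AddCommGroup V] [Module 𝕂 V] [Module R V] [IsScalarTower 𝕂 R V] {P : Pair 𝕂 R V}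
  {𝒜 : ArtAlg.{k, v} 𝕂}

/-- The action of a derivation on functions, by its symbol. -/
def derSymbol (P : Pair 𝕂 R V) : P.Der →ₗ[𝕂] R →ₗ[𝕂] R where
  toFun d := d.1.2
  map_add' _ _ := rfl
  map_smul' _ _ := rfl

/-- The operator on `C^∞(M_𝒜)` of an element of `𝔪 ⊗ Der(L)`. -/
def thickSymbol (P : Pair 𝕂 R V) (𝒜 : ArtAlg.{k, v} 𝕂) :
    𝒜.max ⊗[𝕂] P.Der →ₗ[𝕂] Module.End 𝒜 (Thick 𝒜 R) := ten 𝒜 P.derSymbol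

/-- The derivative of functions by the anchor of a section. -/
def anchorAct (P : Pair 𝕂 R V) (𝒜 : ArtAlg.{k, v} 𝕂) :
    Thick 𝒜 V →ₗ[𝒜] Thick 𝒜 R →ₗ[𝒜] Thick 𝒜 R := vf 𝒜 ∘ₗ (P.cartesian 𝒜).anchor

theorem anchorAct_apply (u : Thick 𝒜 V) (f : Thick 𝒜 R) :
    P.anchorAct 𝒜 u f = vf 𝒜 ((P.cartesian 𝒜).anchor u) f := rfl

/-- Compatibility with anchors becomes invariance of a bilinear operation, so that it can be treated
like the other three structures. -/
theorem anchorAct_eq : P.anchorAct 𝒜 = extBil 𝒜 (LinearMap.mk₂ 𝕂 (fun u f => P.anchor u f)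
    (fun u v f => by rw [map_add]; rfl)
    (fun c u f => by
      rw [← algebraMap_smul R c u, map_smul, algebraMap_smul]
      rfl)
    (fun u f g => map_add _ f g) (fun c u f => (P.anchor u).map_smul c f)) := by
  refine bil_ext 𝒜 fun u f => ?_
  rw [extBil_inc, anchorAct_apply, LieRinehart.cartesian, baseChange_inc]
  exact vf_inc 𝒜 _ _

/-- A bilinear operation which is invariant under derivations has this property after extension
of scalars. -/
theorem ten_extBil {G X Y Z : Type*} [AddCommGroup G] [Module 𝕂 G] [AddCommGroup X] [Module 𝕂 X]
    [AddCommGroup Y] [Module 𝕂 Y] [AddCommGroup Z] [Module 𝕂 Z] (f : X →ₗ[𝕂] Y →ₗ[𝕂] Z)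
    (α : G →ₗ[𝕂] X →ₗ[𝕂] X) (β : G →ₗ[𝕂] Y →ₗ[𝕂] Y) (γ : G →ₗ[𝕂] Z →ₗ[𝕂] Z)
    (h : ∀ g x y, γ g (f x y) = f (α g x) y + f x (β g y)) (t : 𝒜.max ⊗[𝕂] G) (x : Thick 𝒜 X)
    (y : Thick 𝒜 Y) : ten 𝒜 γ t (extBil 𝒜 f x y) =
      extBil 𝒜 f (ten 𝒜 α t x) y + extBil 𝒜 f x (ten 𝒜 β t y) := by
  induction t with
  | zero => simp
  | add s t hs ht =>
    simp only [map_add, LinearMap.add_apply, hs, ht]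
    abel
  | tmul a g =>
    simp only [ten_tmul, LinearMap.smul_apply]
    induction x using thick_induction with
    | hs c x hx => simp only [map_smul, LinearMap.smul_apply, smul_comm _ c, hx, smul_add]
    | ha x y hx hy => simp only [map_add, LinearMap.add_apply, smul_add, hx, hy]; abel
    | hi x =>
      induction y using thick_induction with
      | hs c y hy => simp only [map_smul, smul_comm _ c, hy, smul_add]
      | ha x y hx hy => simp only [map_add, smul_add, hx, hy]; abel
      | hi y =>
        simp only [extBil_inc, baseChange_inc, map_smul, LinearMap.smul_apply, h, map_add, smul_add]

theorem mul_eq_extBil (f g : Thick 𝒜 R) : f * g = extBil 𝒜 (LinearMap.mul 𝕂 R) f g := by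
  have : LinearMap.mul 𝒜 (Thick 𝒜 R) = extBil 𝒜 (LinearMap.mul 𝕂 R) := by
    refine bil_ext 𝒜 fun f g => ?_
    rw [extBil_inc]
    simp [inc]
  exact LinearMap.congr_fun (LinearMap.congr_fun this f) g

section Exp
variable (d : 𝒜.max ⊗[𝕂] P.Der)

theorem thickDer_bracket (u v : Thick 𝒜 V) :
    thickDer P 𝒜 d ((P.cartesian 𝒜).bracket u v) =
      (P.cartesian 𝒜).bracket (thickDer P 𝒜 d u) v + (P.cartesian 𝒜).bracket u (thickDer P 𝒜 d v) :=
  ten_extBil P.bracket _ _ _ (fun d u v => d.2.2.2 u v) d u v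

theorem thickDer_rsm (f : Thick 𝒜 R) (u : Thick 𝒜 V) :
    thickDer P 𝒜 d (rsm 𝒜 f u) =
      rsm 𝒜 (thickSymbol P 𝒜 d f) u + rsm 𝒜 f (thickDer P 𝒜 d u) :=
  ten_extBil _ _ _ _ (fun d f u => d.2.1 f u) d f u

theorem thickSymbol_anchorAct (u : Thick 𝒜 V) (f : Thick 𝒜 R) :
    thickSymbol P 𝒜 d (P.anchorAct 𝒜 u f) =
      P.anchorAct 𝒜 (thickDer P 𝒜 d u) f + P.anchorAct 𝒜 u (thickSymbol P 𝒜 d f) := by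
  rw [anchorAct_eq]
  refine ten_extBil _ _ _ _ (fun d u f => ?_) d u f
  have h := DFunLike.congr_fun (d.2.2.1 u) f
  rw [Derivation.commutator_apply, sub_eq_iff_eq_add] at h
  exact h

theorem thickSymbol_mul (f g : Thick 𝒜 R) :
    thickSymbol P 𝒜 d (LinearMap.mul 𝒜 (Thick 𝒜 R) f g) =
      LinearMap.mul 𝒜 (Thick 𝒜 R) (thickSymbol P 𝒜 d f) g +
        LinearMap.mul 𝒜 (Thick 𝒜 R) f (thickSymbol P 𝒜 d g) := by
  simp only [LinearMap.mul_apply', mul_eq_extBil]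
  refine ten_extBil _ _ _ _ (fun d f g => ?_) d f g
  change d.1.2 (f * g) = d.1.2 f * g + f * d.1.2 g
  rw [Derivation.leibniz, smul_eq_mul, smul_eq_mul, mul_comm g, add_comm]

end Exp

end Pair

section Unipotent
variable {𝕂 : Type k} [Field 𝕂] {𝒜 : ArtAlg.{k, v} 𝕂} {X : Type*} [AddCommGroup X] [Module 𝕂 X]

theorem isNilpotent_of_mem {f : Module.End 𝒜 (Thick 𝒜 X)} (hf : f ∈ endFil 𝒜.max (Thick 𝒜 X) 1) :
    IsNilpotent f := by
  obtain ⟨n, hn⟩ := 𝒜.exists_max_pow_eq_bot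
  exact isNilpotent_of_mem_endFil hn hf

theorem sub_one_mem {f : Module.End 𝒜 (Thick 𝒜 X)} (hf : ∀ x, evT 𝒜 (f (inc 𝒜 x)) = x) :
    f - 1 ∈ endFil 𝒜.max (Thick 𝒜 X) 1 := by
  rw [mem_endFil_one_iff]
  intro x
  rw [LinearMap.sub_apply, map_sub, hf, Module.End.one_apply, evT_inc, sub_self]

theorem isUnit_of_evT {f : Module.End 𝒜 (Thick 𝒜 X)} (hf : ∀ x, evT 𝒜 (f (inc 𝒜 x)) = x) :
    IsUnit f := by
  have := (isNilpotent_of_mem (sub_one_mem hf)).isUnit_add_one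
  rwa [sub_add_cancel] at this

/-- All positive powers of D have values in 𝔪 and disappear under evaluation. -/
theorem evT_nilExp [CharZero 𝕂] {D : Module.End 𝒜 (Thick 𝒜 X)}
    (hD : D ∈ endFil 𝒜.max (Thick 𝒜 X) 1) (x : X) : evT 𝒜 (nilExp 𝕂 D (inc 𝒜 x)) = x := by
  obtain ⟨n, hn⟩ := isNilpotent_of_mem hD
  have h1 : D ^ (n + 1) = 0 := by rw [pow_succ, hn, zero_mul]
  rw [nilExp_eq_sum 𝕂 h1, Finset.sum_range_succ', LinearMap.add_apply, LinearMap.sum_apply,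
    map_add, map_sum, Finset.sum_eq_zero, zero_add]
  · simp [evT_inc]
  · intro i _
    rw [pow_succ', LinearMap.smul_apply, map_smul]
    rw [(mem_endFil_one_iff _).1 (mul_right_mem_endFil hD _), smul_zero]

end Unipotent

namespace Pair
variable {𝕂 : Type k} {R V : Type u} [Field 𝕂] [CommRing R] [Algebra 𝕂 R]
  [AddCommGroup V] [Module 𝕂 V] [Module R V] [IsScalarTower 𝕂 R V] {P : Pair 𝕂 R V}
  {𝒜 : ArtAlg.{k, v} 𝕂} [CharZero 𝕂]

/-- A derivation kills 1, so only the constant term of the exponential series acts on it. -/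
theorem nilExp_symbol_one (d : 𝒜.max ⊗[𝕂] P.Der) :
    nilExp 𝕂 (thickSymbol P 𝒜 d) (1 : Thick 𝒜 R) = 1 := by
  have h0 : thickSymbol P 𝒜 d (1 : Thick 𝒜 R) = 0 := by
    have := thickSymbol_mul d 1 1
    simpa using this
  obtain ⟨n, hn⟩ := isNilpotent_of_mem (𝒜 := 𝒜) (ten_mem_endFil P.derSymbol d)
  have h1 : thickSymbol P 𝒜 d ^ (n + 1) = 0 := by
    rw [pow_succ]
    exact (congrArg (· * _) hn).trans (zero_mul _)
  rw [nilExp_eq_sum 𝕂 h1, Finset.sum_range_succ', LinearMap.add_apply, LinearMap.sum_apply,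
    Finset.sum_eq_zero, zero_add]
  · simp
  · intro i _
    rw [pow_succ, LinearMap.smul_apply, Module.End.mul_apply, h0, map_zero, smul_zero]

/-- The small automorphism `exp d` of `L⁰_𝒜`. -/
def expMap (d : 𝒜.max ⊗[𝕂] P.Der) : RingedMap 𝒜 R V V where
  toFun := nilExp 𝕂 (thickDer P 𝒜 d)
  base := AlgHom.ofLinearMap (nilExp 𝕂 (thickSymbol P 𝒜 d)) (nilExp_symbol_one d) (fun f g =>
    nilExp_bilin (isNilpotent_of_mem (ten_mem_endFil _ d)) (isNilpotent_of_mem (ten_mem_endFil _ d))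
      (isNilpotent_of_mem (ten_mem_endFil _ d)) (LinearMap.mul 𝒜 (Thick 𝒜 R)) (thickSymbol_mul d)
      f g)
  ev_base f := evT_nilExp (ten_mem_endFil _ d) f
  map_smul f u := nilExp_bilin (isNilpotent_of_mem (ten_mem_endFil _ d))
    (isNilpotent_of_mem (ten_mem_endFil _ d)) (isNilpotent_of_mem (ten_mem_endFil _ d))
    (rsm 𝒜) (thickDer_rsm d) f u

/-- An element of 𝔪 ⊗ Der(L) differentiates the bracket and the action of the anchor, so its
exponential preserves both by `nilExp_bilin`. -/
theorem expMap_isLieHom (d : 𝒜.max ⊗[𝕂] P.Der) :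
    (expMap d).IsLieHom (P.cartesian 𝒜) (P.cartesian 𝒜) where
  map_bracket u v := nilExp_bilin (isNilpotent_of_mem (ten_mem_endFil _ d))
    (isNilpotent_of_mem (ten_mem_endFil _ d)) (isNilpotent_of_mem (ten_mem_endFil _ d))
    (P.cartesian 𝒜).bracket (thickDer_bracket d) u v
  map_anchor u f := nilExp_bilin (isNilpotent_of_mem (ten_mem_endFil _ d))
    (isNilpotent_of_mem (ten_mem_endFil _ d)) (isNilpotent_of_mem (ten_mem_endFil _ d))
    (P.anchorAct 𝒜) (thickSymbol_anchorAct d) u f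

theorem evT_expMap (d : 𝒜.max ⊗[𝕂] P.Der) (u : V) :
    evT 𝒜 ((expMap d).toFun (inc 𝒜 u)) = u := evT_nilExp (ten_mem_endFil _ d) u

end Pair

section Log
variable {𝕂 : Type k} [Field 𝕂] [CharZero 𝕂] {𝒜 : ArtAlg.{k, v} 𝕂} {X : Type*} [AddCommGroup X]
  [Module 𝕂 X]

theorem exists_nilExp_eq_of_evT {f : Module.End 𝒜 (Thick 𝒜 X)}
    (hf : ∀ x, evT 𝒜 (f (inc 𝒜 x)) = x) :
    ∃ D ∈ endFil 𝒜.max (Thick 𝒜 X) 1, nilExp 𝕂 D = f := by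
  have h := sub_one_mem hf
  obtain ⟨s, _, hs⟩ := exists_nilExp_eq 𝕂 (isNilpotent_of_mem h)
  exact ⟨_, mul_right_mem_endFil h s, by rw [hs, add_sub_cancel]⟩

end Log

namespace Pair
variable {𝕂 : Type k} {R V : Type u} [Field 𝕂] [CommRing R] [Algebra 𝕂 R]
  [AddCommGroup V] [Module 𝕂 V] [Module R V] [IsScalarTower 𝕂 R V] {P : Pair 𝕂 R V}
  {𝒜 : ArtAlg.{k, v} 𝕂}

/-- A derivation of `L⁰_𝒜` with values in the maximal ideal is an element of `𝔪 ⊗ Der(L)`. -/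
theorem exists_thickDer_eq {D : Module.End 𝒜 (Thick 𝒜 V)} {σ : Module.End 𝒜 (Thick 𝒜 R)}
    (hD : D ∈ endFil 𝒜.max (Thick 𝒜 V) 1)
    (hmul : ∀ f g, σ (f * g) = σ f * g + f * σ g)
    (hrsm : ∀ f u, D (rsm 𝒜 f u) = rsm 𝒜 (σ f) u + rsm 𝒜 f (D u))
    (hbr : ∀ u v, D ((P.cartesian 𝒜).bracket u v) =
      (P.cartesian 𝒜).bracket (D u) v + (P.cartesian 𝒜).bracket u (D v))
    (hanch : ∀ u f, σ (P.anchorAct 𝒜 u f) = P.anchorAct 𝒜 (D u) f + P.anchorAct 𝒜 u (σ f)) :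
    ∃ d, thickDer P 𝒜 d = D := by
  refine exists_ten_eq _ D ((mem_endFil_one_iff D).1 hD) fun c => ?_
  -- Each coordinate of D, with the same coordinate of σ as symbol, is a derivation of L over 𝕂: the
  -- invariance equations are evaluated on sections and functions without parameters, where
  -- coordinates pass through the operations.
  let δ : V →ₗ[𝕂] V := coord c ∘ₗ D.restrictScalars 𝕂 ∘ₗ inc 𝒜
  let s : R →ₗ[𝕂] R := coord c ∘ₗ σ.restrictScalars 𝕂 ∘ₗ inc 𝒜
  have hs : ∀ f g, s (f * g) = f • s g + g • s f := by
    intro f g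
    have h := congrArg (coord c) (hmul (inc 𝒜 f) (inc 𝒜 g))
    simp only [mul_eq_extBil] at h
    rw [extBil_inc, map_add, coord_extBil_left, coord_extBil_right] at h
    change s (f * g) = s f * g + f * s g at h
    rw [h, add_comm, smul_eq_mul, smul_eq_mul, mul_comm g]
  let τ : Derivation 𝕂 R R := Derivation.mk' s hs
  have hτ : ∀ f, τ f = s f := fun _ => rfl
  refine ⟨⟨(δ, τ), fun f u => ?_, fun u => ?_, fun u v => ?_⟩, fun u => rfl⟩
  · have h := congrArg (coord c) (hrsm (inc 𝒜 f) (inc 𝒜 u))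
    rw [rsm_inc, map_add, rsm, coord_extBil_left, coord_extBil_right] at h
    exact h
  · refine Derivation.ext fun f => ?_
    have h := congrArg (coord c) (hanch (inc 𝒜 u) (inc 𝒜 f))
    simp only [anchorAct_eq] at h
    rw [extBil_inc, map_add, coord_extBil_left, coord_extBil_right] at h
    rw [Derivation.commutator_apply, sub_eq_iff_eq_add]
    exact h
  · have h := congrArg (coord c) (hbr (inc 𝒜 u) (inc 𝒜 v))
    simp only [LieRinehart.cartesian] at h
    rw [extBil_inc, map_add, coord_extBil_left, coord_extBil_right] at h
    exact h

/-- The logarithms of Φ and of its base map are taken separately. Preservation of products, module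
structure, bracket and anchor then says that the pair of logarithms is an 𝔪-valued derivation with
its symbol. -/
theorem exists_nilExp_thickDer_eq [CharZero 𝕂] {Φ : RingedMap 𝒜 R V V}
    (hΦ : Φ.IsLieHom (P.cartesian 𝒜) (P.cartesian 𝒜))
    (hev : ∀ u : V, evT 𝒜 (Φ.toFun (inc 𝒜 u)) = u) :
    ∃ d, nilExp 𝕂 (thickDer P 𝒜 d) = Φ.toFun := by
  obtain ⟨D, hD, hDΦ⟩ := exists_nilExp_eq_of_evT hev
  obtain ⟨σ, hσ, hσΦ⟩ := exists_nilExp_eq_of_evT (f := Φ.base.toLinearMap) Φ.ev_base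
  have nD := isNilpotent_of_mem hD
  have nσ := isNilpotent_of_mem hσ
  obtain ⟨d, hd⟩ := exists_thickDer_eq (P := P) (D := D) (σ := σ) hD
    (bilin_of_nilExp_bilin (𝕂 := 𝕂) nσ nσ nσ (LinearMap.mul 𝒜 (Thick 𝒜 R)) fun f g => by
      rw [hσΦ]; exact map_mul Φ.base f g)
    (bilin_of_nilExp_bilin (𝕂 := 𝕂) nσ nD nD (rsm 𝒜) fun f u => by
      rw [hσΦ, hDΦ]; exact Φ.map_smul f u)
    (bilin_of_nilExp_bilin (𝕂 := 𝕂) nD nD nD (P.cartesian 𝒜).bracket fun u v => by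
      rw [hDΦ]; exact hΦ.map_bracket u v)
    (bilin_of_nilExp_bilin (𝕂 := 𝕂) nD nσ nσ (P.anchorAct 𝒜) fun u f => by
      rw [hσΦ, hDΦ]; exact hΦ.map_anchor u f)
  exact ⟨d, by rw [hd, hDΦ]⟩

end Pair

end LieDef
end

noncomputable section

set_option maxSynthPendingDepth 3

namespace LieDef

/-! ### Gauge equivalence and weak isomorphism -/

namespace Pair

variable {𝕂 : Type k} {R V : Type u} [Field 𝕂] [CommRing R] [Algebra 𝕂 R]
  [AddCommGroup V] [Module 𝕂 V] [Module R V] [IsScalarTower 𝕂 R V] {P : Pair 𝕂 R V}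
  {S : P.Splitting} {𝒜 ℬ : ArtAlg.{k, v} 𝕂}

/-- Inclusion of one graph in another suffices: by the block relations the product is y - x for the
operators x, y of ξ, η. -/
theorem eq_of_graph {ξ η : 𝒜.max ⊗[𝕂] P.Ext 1}
    (h : (thickB S 𝒜 - thickForm S 𝒜 ξ) * (thickA S 𝒜 + thickForm S 𝒜 η) = 0) : ξ = η := by
  apply thickForm_injective S 𝒜
  rw [sub_mul, mul_add, mul_add, thickB_mul_thickA, thickB_mul_thickForm, thickForm_mul_thickA,
    thickForm_mul_thickForm, zero_add, add_zero, sub_eq_zero] at h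
  exact h.symm

/-- The graph of a form determines it, also after a small automorphism. -/
theorem eq_of_graph_mul {ξ η ζ : 𝒜.max ⊗[𝕂] P.Ext 1} {Φ : Module.End 𝒜 (Thick 𝒜 V)}
    (hev : ∀ u : V, evT 𝒜 (Φ (inc 𝒜 u)) = u)
    (h : (thickB S 𝒜 - thickForm S 𝒜 ξ) * (Φ * (thickA S 𝒜 + thickForm S 𝒜 ζ)) = 0)
    (h' : (thickB S 𝒜 - thickForm S 𝒜 η) * (Φ * (thickA S 𝒜 + thickForm S 𝒜 ζ)) = 0) : ξ = η := by
  set x := thickForm S 𝒜 (ξ - η) with hx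
  set w := Φ * (thickA S 𝒜 + thickForm S 𝒜 ζ) with hw
  have h1 : x * w = 0 := by
    have := congrArg₂ (· - ·) h' h
    simp only [← sub_mul, sub_sub_sub_cancel_left, sub_zero] at this
    rwa [hx, map_sub]
  -- Here q w + p - 1 = q (Φ - 1)(q + z), with z the operator of ζ, has values in 𝔪. Thus the moved
  -- graph still projects onto Γ(A_𝒜), and an operator x = x q vanishing on it is zero.
  have hun : IsUnit (thickA S 𝒜 * w + thickB S 𝒜) := by
    have hmem : thickA S 𝒜 * w + thickB S 𝒜 - 1 ∈ endFil 𝒜.max (Thick 𝒜 V) 1 := by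
      have : thickA S 𝒜 * w + thickB S 𝒜 - 1 =
          thickA S 𝒜 * (Φ - 1) * (thickA S 𝒜 + thickForm S 𝒜 ζ) := by
        rw [mul_sub, mul_one, sub_mul, mul_add (thickA S 𝒜), thickA_mul_thickA,
          thickA_mul_thickForm, add_zero, hw, mul_assoc, ← thickB_add_thickA S 𝒜]
        abel
      rw [this]
      exact mul_right_mem_endFil (mul_left_mem_endFil _ (sub_one_mem hev)) _
    have := (isNilpotent_of_mem hmem).isUnit_add_one
    rwa [sub_add_cancel] at this
  have h2 : x * (thickA S 𝒜 * w + thickB S 𝒜) = 0 := by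
    rw [mul_add, ← mul_assoc, hx, thickForm_mul_thickA, thickForm_mul_thickB, ← hx, h1, add_zero]
  rw [hun.mul_left_eq_zero, hx] at h2
  exact sub_eq_zero.1 (thickForm_injective S 𝒜 (h2.trans (map_zero _).symm))

/-- The element of degree `1` of a linear map. -/
def ofLin (g : P.sub →ₗ[R] V ⧸ P.sub) : P.Ext 1 :=
  P.ofForm 1 (AlternatingMap.ofSubsingleton R P.sub (V ⧸ P.sub) (0 : Fin 1) g)

theorem extLin_ofLin (g : P.sub →ₗ[R] V ⧸ P.sub) : extLin (ofLin g) = g :=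
  (AlternatingMap.ofSubsingleton R P.sub (V ⧸ P.sub) (0 : Fin 1)).symm_apply_apply g

theorem coord_rsm (c : 𝒜.max →ₗ[𝕂] 𝕂) (f : R) (u : Thick 𝒜 V) :
    coord c (rsm 𝒜 (inc 𝒜 f) u) = f • coord c u := coord_extBil_left c _ f u

/-- The operators `j ∘ X ∘ Pr_A` of elements of `𝔪 ⊗ Ω¹_A(B)`. -/
theorem exists_thickForm_eq {x : Module.End 𝒜 (Thick 𝒜 V)}
    (hx : x ∈ endFil 𝒜.max (Thick 𝒜 V) 1) (hB : thickB S 𝒜 * x = x) (hA : x * thickA S 𝒜 = x)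
    (hr : ∀ (f : Thick 𝒜 R) u, x (rsm 𝒜 f u) = rsm 𝒜 f (x u)) : ∃ ξ, thickForm S 𝒜 ξ = x := by
  refine exists_ten_eq _ x ((mem_endFil_one_iff x).1 hx) fun c => ?_
  refine ⟨ofLin
    { toFun := fun a => P.prB (coord c (x (inc 𝒜 (a : V))))
      map_add' := fun a b => by simp only [Submodule.coe_add, map_add]
      map_smul' := fun f a => by
        simp only [Submodule.coe_smul, ← rsm_inc, hr, coord_rsm, map_smul, RingHom.id_apply] },
    fun v => ?_⟩
  rw [formOp_apply, extLin_ofLin]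
  have h1 : x (inc 𝒜 ((prA S v : P.sub) : V)) = x (inc 𝒜 v) := by
    conv_rhs => rw [← hA, Module.End.mul_apply, thickA, baseChange_inc]
    rfl
  have h2 : coord c (x (inc 𝒜 v)) = projB S (coord c (x (inc 𝒜 v))) := by
    rw [← coord_baseChange]
    exact congrArg (coord c) (LinearMap.congr_fun hB (inc 𝒜 v)).symm
  change S.toFun (P.prB (coord c (x (inc 𝒜 ((prA S v : P.sub) : V))))) = _
  rw [h1]
  exact h2.symm

theorem evT_incl (D : P.InfDef 𝒜) (a : Thick 𝒜 P.sub) :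
    evT 𝒜 (D.incl.toFun a) = (evT 𝒜 a : P.sub) := by
  induction a using thick_induction with
  | hs c x hx =>
    rw [_root_.map_smul, evT_smul, evT_smul, hx]
    rfl
  | ha x y hx hy => rw [map_add, map_add, map_add, hx, hy]; rfl
  | hi a => rw [D.ev_incl, evT_inc]

/-- The map pr_A ∘ I has center the identity, so it is unipotent and has an inverse K. Although I is
linear only over its base map λ, the parametrisation I ∘ K is linear over functions, because K is
linear over λ⁻¹. -/
theorem exists_graphMap_proj (S : P.Splitting) (D : P.InfDef 𝒜) :
    ∃ K : Module.End 𝒜 (Thick 𝒜 P.sub), (∀ a, thickProj S 𝒜 (D.incl.toFun (K a)) = a) ∧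
      (∀ a, K (thickProj S 𝒜 (D.incl.toFun a)) = a) ∧
      ∀ (f : Thick 𝒜 R) a, D.incl.toFun (K (rsm 𝒜 f a)) = rsm 𝒜 f (D.incl.toFun (K a)) := by
  have hev : ∀ a : P.sub, evT 𝒜 (thickProj S 𝒜 (D.incl.toFun (inc 𝒜 a))) = a := by
    intro a
    rw [thickProj, evT_baseChange, D.ev_incl]
    exact prA_coe S a
  obtain ⟨J, hJ⟩ := isUnit_of_evT (f := thickProj S 𝒜 ∘ₗ D.incl.toFun) hev
  obtain ⟨m, hm⟩ := isUnit_of_evT (f := D.incl.base.toLinearMap) D.incl.ev_base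
  have h1 : ∀ a, thickProj S 𝒜 (D.incl.toFun ((↑J⁻¹ : Module.End 𝒜 (Thick 𝒜 P.sub)) a)) = a := by
    intro a
    have := LinearMap.congr_fun J.mul_inv a
    rwa [hJ] at this
  have h2 : ∀ a, (↑J⁻¹ : Module.End 𝒜 (Thick 𝒜 P.sub)) (thickProj S 𝒜 (D.incl.toFun a)) = a := by
    intro a
    have := LinearMap.congr_fun J.inv_mul a
    rwa [hJ] at this
  refine ⟨_, h1, h2, fun f a => ?_⟩
  -- The base map is unipotent as well, hence surjective.
  obtain ⟨g, rfl⟩ : ∃ g, D.incl.base g = f := by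
    refine ⟨(↑m⁻¹ : Module.End 𝒜 (Thick 𝒜 R)) f, ?_⟩
    have := LinearMap.congr_fun m.mul_inv f
    rwa [hm] at this
  rw [← D.incl.map_smul]
  refine congrArg _ ?_
  conv_lhs => rw [← h1 a, ← thickProj_rsm, ← D.incl.map_smul, h2]

/-- Normalising the inclusion so that pr_A of it is the identity exhibits its image as a graph. The
graph is closed under the bracket because the inclusion preserves brackets, so the form is
Maurer–Cartan. -/
theorem exists_graph [CharZero 𝕂] (S : P.Splitting) (D : P.InfDef 𝒜) :
    ∃ ξ : (extended S).MC 𝒜, ∀ a, (thickB S 𝒜 - thickForm S 𝒜 ξ.1) (D.incl.toFun a) = 0 := by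
  obtain ⟨K, hK1, hK2, hK3⟩ := exists_graphMap_proj S D
  -- T is the projection onto the image of the inclusion along j Γ(B_𝒜). It will equal q + x, so the
  -- form is read off from x = p T.
  set T : Module.End 𝒜 (Thick 𝒜 V) := D.incl.toFun ∘ₗ K ∘ₗ thickProj S 𝒜 with hT
  have hTA : thickA S 𝒜 * T = thickA S 𝒜 := by
    refine LinearMap.ext fun u => ?_
    rw [Module.End.mul_apply, ← thickIncl_thickProj, ← thickIncl_thickProj]
    exact congrArg _ (hK1 _)
  have hAT : T * thickA S 𝒜 = T := by
    refine LinearMap.ext fun u => ?_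
    rw [Module.End.mul_apply, ← thickIncl_thickProj]
    change D.incl.toFun (K (thickProj S 𝒜 _)) = D.incl.toFun (K _)
    rw [thickProj_thickIncl]
  have hBB : thickB S 𝒜 * thickB S 𝒜 = thickB S 𝒜 := by
    have h := thickB_add_thickA S 𝒜
    rw [← eq_sub_iff_add_eq'] at h
    rw [eq_comm, ← sub_eq_zero]
    have h0 := thickB_mul_thickA (S := S) (𝒜 := 𝒜)
    rwa [h, mul_sub, mul_one] at h0
  obtain ⟨ξ, hξ⟩ : ∃ ξ, thickForm S 𝒜 ξ = thickB S 𝒜 * T := by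
    refine exists_thickForm_eq ?_ (by rw [← mul_assoc, hBB]) (by rw [mul_assoc, hAT]) ?_
    · rw [mem_endFil_one_iff]
      intro u
      rw [Module.End.mul_apply, thickB, evT_baseChange]
      change projB S (evT 𝒜 (D.incl.toFun _)) = 0
      -- At the center the inclusion takes values in A, which p kills; so p T is 𝔪-valued.
      rw [evT_incl, projB_apply, prB_coe, map_zero]
    · intro f u
      have : T (rsm 𝒜 f u) = rsm 𝒜 f (T u) := by
        change D.incl.toFun (K (thickProj S 𝒜 _)) = rsm 𝒜 f (D.incl.toFun (K _))
        rw [thickProj_rsm, hK3]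
      rw [Module.End.mul_apply, this, Module.End.mul_apply]
      exact rsm_baseChange (S.toFun ∘ₗ P.prB) f _
  have hI : ∀ a, (thickB S 𝒜 - thickForm S 𝒜 ξ) (D.incl.toFun a) = 0 := by
    intro a
    have : T (D.incl.toFun a) = D.incl.toFun a := congrArg D.incl.toFun (hK2 a)
    rw [hξ, LinearMap.sub_apply, Module.End.mul_apply, this, sub_self]
  have hTg : thickA S 𝒜 + thickForm S 𝒜 ξ = T := by
    rw [hξ]
    nth_rewrite 1 [← hTA]
    rw [← add_mul, add_comm, thickB_add_thickA, one_mul]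
  refine ⟨⟨ξ, (isMC_iff ξ).2 fun u v => ?_⟩, hI⟩
  rw [hTg]
  change (thickB S 𝒜 - thickForm S 𝒜 ξ) ((P.cartesian 𝒜).bracket (D.incl.toFun _) (D.incl.toFun _)) = 0
  rw [← D.isLieHom.map_bracket, hI]

/-- Every element of 𝔪 ⊗ Der(L), not only the inner ones, is the total derivation of some b; the
summand Der(L) of 𝔥⁰ is there to reach all small automorphisms. -/
theorem thickGauge_of_der (d : 𝒜.max ⊗[𝕂] P.Der) :
    thickGauge S 𝒜 ((P.ofDer 0).lTensor 𝒜.max d) = thickDer P 𝒜 d := by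
  have h : totalDer S ∘ₗ P.ofDer 0 = LinearMap.id := by
    refine LinearMap.ext fun d => ?_
    change d + P.innerDer (S.toFun 0) = d
    rw [map_zero, map_zero, add_zero]
  rw [thickGauge, LinearMap.comp_apply, ← LinearMap.lTensor_comp_apply, h, LinearMap.lTensor_id]
  rfl

variable [CharZero 𝕂]

theorem weakIso_of_gauge {ξ η : (extended S).MC 𝒜} (h : (extended S).Gauge ξ.1 η.1) :
    WeakIso (graphDef S η) (graphDef S ξ) := by
  obtain ⟨b, hb⟩ := h
  refine weakIso_graphDef S η _ (expMap ((totalDer S).lTensor 𝒜.max b)) (expMap_isLieHom _)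
    (evT_expMap _) fun a => ?_
  rw [graphDef_incl, graphMap_eq]
  exact LinearMap.congr_fun (nilExp_mul_graph hb) (thickIncl P 𝒜 a)

/-- Φ is the exponential of some d in 𝔪 ⊗ Der(L). Both the graph of ξ and the graph of the gauge
transform of η by d contain the image of the graph of η under Φ, so the two forms agree by
`eq_of_graph_mul`. The deformations D and D' need not be graphs themselves; only their images
matter. -/
theorem gauge_of_weakIso {D D' : P.InfDef 𝒜} {ξ η : 𝒜.max ⊗[𝕂] P.Ext 1}
    (hξ : ∀ a, (thickB S 𝒜 - thickForm S 𝒜 ξ) (D.incl.toFun a) = 0)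
    (hη : ∀ a, (thickB S 𝒜 - thickForm S 𝒜 η) (D'.incl.toFun a) = 0)
    (h : WeakIso D D') : (extended S).Gauge η ξ := by
  obtain ⟨Φ, hΦ, hev, Ψ, -, hI, -⟩ := h
  obtain ⟨d, hd⟩ := exists_nilExp_thickDer_eq hΦ hev
  obtain ⟨ζ, hζ⟩ := exists_gauge S η ((P.ofDer 0).lTensor 𝒜.max d)
  have h1 := nilExp_mul_graph hζ
  rw [thickGauge_of_der, hd] at h1
  have h2 : (thickB S 𝒜 - thickForm S 𝒜 ξ) * (Φ.toFun * (thickA S 𝒜 + thickForm S 𝒜 η)) = 0 := by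
    -- Every element of the graph of η is a value of the inclusion of D', so the relation Φ ∘ I' = I
    -- ∘ Ψ applies to it.
    obtain ⟨K, hK, -, -⟩ := exists_graphMap_proj S D'
    refine LinearMap.ext fun u => ?_
    have hu : (thickA S 𝒜 + thickForm S 𝒜 η) u = D'.incl.toFun (K (thickProj S 𝒜 u)) := by
      rw [← graphMap_thickProj, ← graphMap_thickProj_of_mem S (hη _), hK]
    rw [Module.End.mul_apply, Module.End.mul_apply, hu]
    exact (congrArg _ (LinearMap.congr_fun hI _)).trans (hξ _)
  rw [eq_of_graph_mul hev h2 h1]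
  exact ⟨_, hζ⟩

/-- The bijection between gauge classes of Maurer–Cartan elements and weak isomorphism classes of
infinitesimal deformations. -/
def graphEquiv (S : P.Splitting) (𝒜 : ArtAlg.{k, v} 𝕂) :
    (extended S).deformationFunctor.obj 𝒜 ≃ P.weakDef.obj 𝒜 where
  toFun := Quot.lift (fun ξ => Quot.mk _ (graphDef S ξ))
    -- Directions are reversed here; the quotients are by the generated equivalence relations, so
    -- neither relation has to be shown symmetric or transitive.
    fun _ _ h => (Quot.sound (weakIso_of_gauge h)).symm
  invFun := Quot.lift (fun D => Quot.mk _ (exists_graph S D).choose)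
    fun D D' h => (Quot.sound (r := fun ξ η : (extended S).MC 𝒜 => (extended S).Gauge ξ.1 η.1)
      (gauge_of_weakIso (exists_graph S D).choose_spec
      (exists_graph S D').choose_spec h)).symm
  left_inv x := by
    induction x using Quot.inductionOn with
    | h ξ =>
      -- The form chosen for a graph has a graph containing it, hence is the original form and not
      -- merely gauge equivalent to it.
      refine congrArg (Quot.mk _) (Subtype.ext (eq_of_graph (S := S) (LinearMap.ext fun u => ?_)))
      rw [Module.End.mul_apply, ← graphMap_thickProj, ← graphDef_incl]
      exact (exists_graph S (graphDef S ξ)).choose_spec _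
  right_inv x := by
    induction x using Quot.inductionOn with
    | h D =>
      -- A deformation and the graph of its form have the same image in L⁰_𝒜, so the identity of
      -- L⁰_𝒜 gives the weak isomorphism.
      exact Quot.sound (weakIso_graphDef S _ D (RingedMap.id 𝒜 R V) (RingedMap.isLieHom_id _)
        (fun u => evT_inc 𝒜 u) (exists_graph S D).choose_spec)

theorem nonempty_deformationFunctor_iso_weakDef (S : P.Splitting) :
    Nonempty ((extended S).deformationFunctor ≅
      (P.weakDef : ArtAlg.{k, v} 𝕂 ⥤ Type (max u v))) := by
  refine ⟨NatIso.ofComponents (fun 𝒜 => (graphEquiv S 𝒜).toIso) fun {𝒜 ℬ} ϑ => ?_⟩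
  ext x
  induction x using Quot.inductionOn with
  | h ξ => exact congrArg (Quot.mk _) (graphDef_push S ϑ ξ).symm

end Pair

end LieDef
end

/-! ### The theorem for Lie pairs over a manifold -/

set_option maxHeartbeats 1000000 in
theorem theorem2 {𝕂 : Type} [RCLike 𝕂]
    {E : Type*} [NormedAddCommGroup E] [NormedSpace ℝ E] [FiniteDimensional ℝ E]
    {M : Type u} [TopologicalSpace M] [T2Space M] [SecondCountableTopology M]
    [ChartedSpace E M] [IsManifold 𝓘(ℝ, E) ∞ M]
    {F : Type*} [NormedAddCommGroup F] [NormedSpace ℝ F] [NormedSpace 𝕂 F]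
    [IsScalarTower ℝ 𝕂 F] [FiniteDimensional 𝕂 F]
    {L : M → Type u} [∀ x, AddCommGroup (L x)] [∀ x, Module ℝ (L x)] [∀ x, Module 𝕂 (L x)]
    [∀ x, IsScalarTower ℝ 𝕂 (L x)] [∀ x, TopologicalSpace (L x)]
    [TopologicalSpace (TotalSpace F L)] [FiberBundle F L] [VectorBundle ℝ F L]
    [VectorBundle 𝕂 F L] [ContMDiffVectorBundle ∞ F L 𝓘(ℝ, E)]
    (P : LieDef.LiePair 𝕂 E F L) (S : P.toPair.Splitting) :
    Nonempty ((LieDef.Pair.extended S).deformationFunctor ≅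
      (P.toPair.weakDef : LieDef.ArtAlg.{0, v} 𝕂 ⥤ Type (max u v))) :=
  LieDef.Pair.nonempty_deformationFunctor_iso_weakDef S
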